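/- Let $K$ be a commutative $\mathbb Q$-algebra, $r\ge 1$, $m\ge 0$. "Functions" are formal power series over $K$ in the times $t_1=x,t_2,t_3,\dots$, expanded about an arbitrary point with finitely many nonzero coordinates; $\partial=\partial/\partial x$, $\partial_n=\partial/\partial t_n$. For a pseudo-differential operator $A=\sum_n a_nD^n$ (with $Df=fD+\partial f$) write $A_+=\sum_{n\ge0}a_nD^n$, $A_-=A-A_+$, let $A_+(f)$ denote the action on a function and $A_+^*$ the formal adjoint of $A_+$. A solution of the hierarchy $\mathsf{cKP}_{r,m}$ consists of a dressing operator $W=1+\sum_{n\ge1}w_nD^{-n}$ and functions $\Phi_i,\Psi_i$ $(1\le i\le m)$ such that, with $L^{n/r}=WD^nW^{-1}$ and $L=WD^rW^{-1}$, $$\partial_nW=-(L^{n/r})_-W,\qquad \partial_n\Phi_i=L^{n/r}_+(\Phi_i),\qquad \partial_n\Psi_i=-(L^{n/r})_+^*(\Psi_i)\quad(n\ge1),\qquad L_-=\sum_{i=1}^m\Phi_iD^{-1}\Psi_i .$$ Put $\psi(t,\lambda)=W(e^{\xi(t,\lambda)})$ with $\xi=\sum_l t_l\lambda^l$, and $M=WM^{(0)}W^{-1}$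 with $M^{(0)}=\sum_{l\ge1}\frac lr t_lD^{l-r}$. Define $L^p(\Phi_i)$ and $(L^*)^q(\Psi_i)$ recursively by $$L(f)=L_+(f)+\sum_j\Phi_j\,\partial_x^{-1}(\Psi_jf),\qquad L^*(g)=L_+^*(g)-\sum_j\Psi_j\,\partial_x^{-1}(\Phi_jg).$$ Here the functions $S^{p,q}_{ij}=\partial_x^{-1}\bigl(L^p(\Phi_i)(L^*)^q(\Psi_j)\bigr)$ are antiderivatives whose integration constants are fixed consistently, as follows. For a differential operator $B=\sum_{n\ge 0} b_nD^n$ let $\Omega_B(f,g)=\sum_n\sum_{s<n}(-1)^s\partial^s(b_ng)\,\partial^{n-1-s}f$, so that $\partial\,\Omega_B(f,g)=g\,B(f)-f\,B^*(g)$; then, with $f=L^p(\Phi_i)$ and $g=(L^*)^q(\Psi_j)$, for all $n\ge1$, $p,q\ge0$, $$\partial_nS^{p,q}_{ij}=\Omega_{L^{n/r}_+}(f,g),\qquad S^{p+1,q}_{ij}-S^{p,q+1}_{ij}=\Omega_{L_+}(f,g)+\sum_{l}S^{p,0}_{il}S^{0,q}_{lj}.$$ Set $$X^{(1)}_k=\sum_{i=1}^m\sum_{j=0}^{k-1}\Bigl(j-\tfrac{k-1}2\Bigr)L^{k-1-j}(\Phi_i)\,D^{-1}\,(L^*)^j(\Psi_i)\quad(k\ge1),\qquad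 X^{(1)}_{-1}=X^{(1)}_0=0,\qquad A_k=-(ML^k)_-+X^{(1)}_{k-1}\quad(k\ge0).$$ With $X(f)=\sum a\,\partial_x^{-1}(bf)$, $X^*(g)=-\sum b\,\partial_x^{-1}(ag)$ for $X=\sum aD^{-1}b$, define vector fields $\partial^*_k$, $k\ge 0$, on the data by $\partial^*_kW=A_kW$ and $$\partial^*_k\Phi_i=(ML^k)_+(\Phi_i)+\tfrac k2L^{k-1}(\Phi_i)+X^{(1)}_{k-1}(\Phi_i),\qquad \partial^*_k\Psi_i=-(ML^k)_+^*(\Psi_i)+\tfrac k2(L^*)^{k-1}(\Psi_i)-(X^{(1)}_{k-1})^*(\Psi_i),$$ and, on the integrals, with $f,g$ as above (terms with a negative index are absent, their coefficients being $0$), $$\partial^*_kS^{p,q}_{ij}=\Omega_{(ML^k)_+}(f,g)+\bigl(p+\tfrac k2\bigr)S^{p+k-1,q}_{ij}+\bigl(q+\tfrac k2\bigr)S^{p,q+k-1}_{ij}+\sum_{l}\sum_{s=0}^{k-2}\Bigl(s-\tfrac{k-2}2\Bigr)S^{p,s}_{il}\,S^{k-2-s,q}_{lj}.$$ For an expression $F$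 in the data, $\partial^*_kF$ is its first-order variation along this vector field. Then every solution admits such functions $S^{p,q}_{ij}$, and for every solution, every such choice of them, and all $k,l\ge0$: 1. $\partial^*_kL=[A_k,L]$, $\ \partial^*_kW=A_kW$, $\ \partial^*_k\psi=A_k(\psi)$. 2. The flows preserve the constrained form of $L$: $\partial^*_kL$ has order at most $r-2$ and $(\partial^*_kL)_-=\sum_i\bigl((\partial^*_k\Phi_i)D^{-1}\Psi_i+\Phi_iD^{-1}(\partial^*_k\Psi_i)\bigr)$. 3. The flows commute with the isospectral flows: $\partial_n(\partial^*_kL)=\partial^*_k[L^{n/r}_+,L]$ for all $n\ge1$; moreover all the defining equations above (those of a solution and those of the $S^{p,q}_{ij}$) are preserved to first order by $\partial^*_k$. 4. For $k=0,1,2$ the flow is the Orlov–Schulman flow: $\partial^*_kL=[-(ML^k)_-,L]$ and $\partial^*_kW=-(ML^k)_-W$. 5. The flows satisfy the Virasoro relations: $[\partial^*_l,\partial^*_k]L=(k-l)\,\partial^*_{k+l-1}L$ and $[\partial^*_l,\partial^*_k]W=(k-l)\,\partial^*_{k+l-1}W$ (for $k=l=0$ the right-hand side is $0$), i.e. $[\mathcal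 L_a,\mathcal L_b]=(a-b)\mathcal L_{a+b}$ for $\mathcal L_{k-1}=-\partial^*_k$, $a,b\ge-1$. -/

import Mathlib

noncomputable section

namespace CKP

/-- Functions of the times `t₁ = x, t₂, t₃, …`: formal power series over `K` in the (shifted)
times. -/
abbrev Fn (K : Type*) [CommRing K] := MvPowerSeries ℕ+ K

/-- The derivative `∂_n = ∂/∂t_n`. -/
def dt {K : Type*} [CommRing K] (n : ℕ+) (f : Fn K) : Fn K := MvPowerSeries.pderiv K n f

/-- The derivative `∂ = ∂/∂x`, where `x = t₁`. -/
def dx {K : Type*} [CommRing K] (f : Fn K) : Fn K := dt 1 f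

/-- Sum of a locally finite family of power series (each monomial occurs in only finitely many
members of the family). -/
def lsum {K : Type*} [CommRing K] {ι : Type*} (f : ι → Fn K) : Fn K :=
  fun d => ∑ᶠ i, MvPowerSeries.coeff d (f i)

/-- Formal pseudo-differential operators `∑ a_n D^n`, recorded by their coefficients `n ↦ a_n`.
Infinitely many positive powers of `D` are permitted, since they occur in the operator `M`. -/
def PDO (K : Type*) [CommRing K] := ℤ → Fn K

namespace PDO

variable {K : Type*} [CommRing K]

instance : AddCommGroup (PDO K) := inferInstanceAs (AddCommGroup (ℤ → Fn K))

instance [Algebra ℚ K] : Module ℚ (PDO K) := inferInstanceAs (Module ℚ (ℤ → Fn K))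

/-- The operator `f D^n`. -/
def mono (f : Fn K) (n : ℤ) : PDO K := fun p => if p = n then f else 0

/-- The operator `D^n`. -/
def D (n : ℤ) : PDO K := mono 1 n

instance : One (PDO K) := ⟨mono 1 0⟩

/-- The operator product determined by the generalized Leibniz rule
`a D^n ∘ b D^k = ∑_j (n choose j) a (∂^j b) D^(n+k-j)`; the coefficient of `D^p` collects the terms
with `k = p - n + j`. -/
instance : Mul (PDO K) :=
  ⟨fun A B p => lsum fun q : ℤ × ℕ =>
    (Ring.choose q.1 q.2 : ℤ) • (A q.1 * dx^[q.2] (B (p - q.1 + (q.2 : ℤ))))⟩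

/-- Powers `A^0 = 1`, `A^(n+1) = A^n A`. -/
instance : Pow (PDO K) ℕ := ⟨fun A n => Nat.rec 1 (fun _ B => B * A) n⟩

/-- The commutator. -/
instance : Bracket (PDO K) (PDO K) := ⟨fun A B => A * B - B * A⟩

/-- The differential part `A_+`. -/
def plus (A : PDO K) : PDO K := fun n => if 0 ≤ n then A n else 0

/-- The purely pseudo-differential part `A_-`. -/
def minus (A : PDO K) : PDO K := fun n => if n < 0 then A n else 0

/-- The operator `f D⁻¹ g`. -/
def ghost (f g : Fn K) : PDO K := mono f 0 * D (-1) * mono g 0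

/-- `A_+(f) = ∑_{n ≥ 0} a_n ∂^n f`. -/
def plusApply (A : PDO K) (f : Fn K) : Fn K := lsum fun n : ℕ => A n * dx^[n] f

/-- `(A_+)^*(g) = ∑_{n ≥ 0} (-1)^n ∂^n (a_n g)`, the formal adjoint of `A_+` applied to `g`. -/
def plusAdjApply (A : PDO K) (g : Fn K) : Fn K :=
  lsum fun n : ℕ => (-1) ^ n * dx^[n] (A n * g)

/-- The bilinear concomitant of `A_+`, i.e. the differential expression
`∑_{n ≥ 0} ∑_{i < n} (-1)^i ∂^i (a_n g) ∂^(n-1-i) f`, whose `x`-derivative is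
`g A_+(f) - f (A_+)^*(g)`. -/
def concomitant (A : PDO K) (f g : Fn K) : Fn K :=
  lsum fun n : ℕ => ∑ i ∈ Finset.range n,
    (-1) ^ i * dx^[i] (A n * g) * dx^[n - 1 - i] f

/-- The time derivative of all coefficients. -/
def dt (n : ℕ+) (A : PDO K) : PDO K := fun p => CKP.dt n (A p)

end PDO

/-- Formal expressions `(∑_n f_n(t) λ^n) e^{ξ(t,λ)}`, `ξ(t,λ) = ∑_l t_l λ^l`, recorded by
`n ↦ f_n`. -/
def Wave (K : Type*) [CommRing K] := ℤ → Fn K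

/-- The expression `e^{ξ(t,λ)}`. -/
def expXi {K : Type*} [CommRing K] : Wave K := fun n => if n = 0 then 1 else 0

/-- The action of a pseudo-differential operator, given by
`D^n (f λ^k e^ξ) = ∑_j (n choose j) (∂^j f) λ^(n+k-j) e^ξ`. -/
def PDO.applyWave {K : Type*} [CommRing K] (A : PDO K) (F : Wave K) : Wave K :=
  fun p => lsum fun q : ℤ × ℕ =>
    (Ring.choose q.1 q.2 : ℤ) • (A q.1 * dx^[q.2] (F (p - q.1 + (q.2 : ℤ))))

/-- The dynamical variables of the constrained KP hierarchy.

`base` is the point about which all functions are expanded, so that the time `t_l` is the function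
`X l + base l`. `W` is the dressing operator, `Winv` its inverse, and `Φ i`, `Ψ i` are the
(adjoint) eigenfunctions. `pot p q i j` is the function `∂_x⁻¹ (L^p(Φ_i) · (L^*)^q(Ψ_j))`,
integration constants included. -/
structure Data (K : Type*) [CommRing K] (m : ℕ) where
  base : ℕ+ →₀ K
  W : PDO K
  Winv : PDO K
  Φ : Fin m → Fn K
  Ψ : Fin m → Fn K
  pot : ℕ → ℕ → Fin m → Fin m → Fn K

namespace Data

variable {K : Type*} [CommRing K] {m : ℕ}

/-- The time `t_l` as a function. -/
def time (P : Data K m) (l : ℕ+) : Fn K := MvPowerSeries.X l + MvPowerSeries.C (P.base l)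

/-- `L^{n/r} = W D^n W⁻¹`. -/
def root (P : Data K m) (n : ℕ+) : PDO K := P.W * PDO.D (n : ℤ) * P.Winv

/-- The Lax operator `L = W D^r W⁻¹`. -/
def L (r : ℕ) (P : Data K m) : PDO K := P.W * PDO.D (r : ℤ) * P.Winv

/-- The bare operator `M⁽⁰⁾ = ∑_{l ≥ 1} (l/r) t_l D^(l-r)`. -/
def M0 [Algebra ℚ K] (r : ℕ) (P : Data K m) : PDO K := fun n =>
  if h : 0 < n + (r : ℤ) then
    (((n : ℚ) + r) / r) • P.time ⟨(n + (r : ℤ)).toNat, by omega⟩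
  else 0

/-- The Orlov–Schulman operator `M = W M⁽⁰⁾ W⁻¹`. -/
def M [Algebra ℚ K] (r : ℕ) (P : Data K m) : PDO K := P.W * P.M0 r * P.Winv

/-- The Baker–Akhiezer function `ψ = W(e^ξ)`. -/
def ψ (P : Data K m) : Wave K := P.W.applyWave expXi

/-- `L^p(Φ_i)`, where `L(f) = L_+(f) + ∑_j Φ_j ∂_x⁻¹(Ψ_j f)`. -/
def LΦ (r : ℕ) (P : Data K m) : ℕ → Fin m → Fn K
  | 0, i => P.Φ i
  | p + 1, i => (P.L r).plusApply (LΦ r P p i) + ∑ j, P.Φ j * P.pot p 0 i j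

/-- `(L^*)^q(Ψ_i)`, where `L^*(g) = (L_+)^*(g) - ∑_j Ψ_j ∂_x⁻¹(Φ_j g)`. -/
def LΨ (r : ℕ) (P : Data K m) : ℕ → Fin m → Fn K
  | 0, i => P.Ψ i
  | q + 1, i => (P.L r).plusAdjApply (LΨ r P q i) - ∑ j, P.Ψ j * P.pot 0 q j i

/-- `P` is a solution of the hierarchy `cKP_{r,m}`: `W = 1 + ∑_{n ≥ 1} w_n D⁻ⁿ` is invertible with
inverse `Winv`, it satisfies the Sato–Wilson equations, `Φ_i` and `Ψ_i` are eigenfunctions and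
adjoint eigenfunctions, and `L_- = ∑_i Φ_i D⁻¹ Ψ_i`. -/
structure IsSolution (r : ℕ) (P : Data K m) : Prop where
  W_zero : P.W 0 = 1
  W_pos : ∀ n : ℤ, 0 < n → P.W n = 0
  Winv_pos : ∀ n : ℤ, 0 < n → P.Winv n = 0
  W_mul_Winv : P.W * P.Winv = 1
  Winv_mul_W : P.Winv * P.W = 1
  sato : ∀ n : ℕ+, P.W.dt n = -((P.root n).minus * P.W)
  eigen : ∀ (n : ℕ+) (i : Fin m), dt n (P.Φ i) = (P.root n).plusApply (P.Φ i)
  adjEigen : ∀ (n : ℕ+) (i : Fin m), dt n (P.Ψ i) = -(P.root n).plusAdjApply (P.Ψ i)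
  constrained : (P.L r).minus = ∑ i, PDO.ghost (P.Φ i) (P.Ψ i)

/-- The functions `pot p q i j` are consistent choices of
`∂_x⁻¹ (L^p(Φ_i) · (L^*)^q(Ψ_j))`: their `t_n`-derivatives are the differential expressions by which
`∂_n (L^p(Φ_i) (L^*)^q(Ψ_j))` is a total `x`-derivative (for `n = 1` this reads
`∂_x pot p q i j = L^p(Φ_i) (L^*)^q(Ψ_j)`), and, likewise, `∂_x⁻¹ (L(f) g - f L^*(g))` is the
expression of which `L(f) g - f L^*(g)` is the `x`-derivative, for `f = L^p(Φ_i)`,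
`g = (L^*)^q(Ψ_j)`. -/
structure IsPotential (r : ℕ) (P : Data K m) : Prop where
  dt_pot : ∀ (n : ℕ+) (p q : ℕ) (i j : Fin m),
    dt n (P.pot p q i j) = (P.root n).concomitant (P.LΦ r p i) (P.LΨ r q j)
  shift : ∀ (p q : ℕ) (i j : Fin m),
    P.pot (p + 1) q i j - P.pot p (q + 1) i j =
      (P.L r).concomitant (P.LΦ r p i) (P.LΨ r q j)
        + ∑ l, P.pot p 0 i l * P.pot 0 q l j

variable [Algebra ℚ K]

/-- The weight `j - (k-1)/2`. -/
def wt (k j : ℕ) : ℚ := (j : ℚ) - ((k : ℚ) - 1) / 2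

/-- `X⁽¹⁾_k = ∑_i ∑_{j=0}^{k-1} (j - (k-1)/2) L^{k-1-j}(Φ_i) D⁻¹ (L^*)^j(Ψ_i)`, with
`X⁽¹⁾_0 = 0`. -/
def X1 (r k : ℕ) (P : Data K m) : PDO K :=
  ∑ i, ∑ j ∈ Finset.range k,
    wt k j • PDO.ghost (P.LΦ r (k - 1 - j) i) (P.LΨ r j i)

/-- `X⁽¹⁾_k(Φ_i)`. -/
def X1Φ (r k : ℕ) (P : Data K m) (i : Fin m) : Fn K :=
  ∑ l, ∑ j ∈ Finset.range k, wt k j • (P.LΦ r (k - 1 - j) l * P.pot 0 j i l)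

/-- `(X⁽¹⁾_k)^*(Ψ_i)`. -/
def X1Ψ (r k : ℕ) (P : Data K m) (i : Fin m) : Fn K :=
  -∑ l, ∑ j ∈ Finset.range k, wt k j • (P.LΨ r j l * P.pot (k - 1 - j) 0 l i)

/-- `M L^k`. -/
def ML (r k : ℕ) (P : Data K m) : PDO K := P.M r * P.L r ^ k

/-- The generator `-(M L^k)_-` of the Orlov–Schulman flow. -/
def genOS (r k : ℕ) (P : Data K m) : PDO K := -(P.ML r k).minus

/-- The generator `-(M L^k)_- + X⁽¹⁾_{k-1}` of the modified flow, where `X⁽¹⁾_{-1} = 0`. -/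
def gen (r k : ℕ) (P : Data K m) : PDO K := P.genOS r k + P.X1 r (k - 1)

/-- The variation of `Φ_i`:
`(M L^k)_+(Φ_i) + (k/2) L^{k-1}(Φ_i) + X⁽¹⁾_{k-1}(Φ_i)`. -/
def varΦ (r k : ℕ) (P : Data K m) (i : Fin m) : Fn K :=
  (P.ML r k).plusApply (P.Φ i) + ((k : ℚ) / 2) • P.LΦ r (k - 1) i + P.X1Φ r (k - 1) i

/-- The variation of `Ψ_i`:
`-(M L^k)_+^*(Ψ_i) + (k/2) (L^*)^{k-1}(Ψ_i) - (X⁽¹⁾_{k-1})^*(Ψ_i)`. -/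
def varΨ (r k : ℕ) (P : Data K m) (i : Fin m) : Fn K :=
  -(P.ML r k).plusAdjApply (P.Ψ i) + ((k : ℚ) / 2) • P.LΨ r (k - 1) i - P.X1Ψ r (k - 1) i

/-- The variation of `∂_x⁻¹ (f g)`, `f = L^p(Φ_i)`, `g = (L^*)^q(Ψ_j)`, that is
`∂_x⁻¹` of the variation of `f g`, where `f` varies by
`(M L^k)_+(f) + (p + k/2) L^{p+k-1}(Φ_i) + X⁽¹⁾_{k-1}(f)` and `g` by
`-(M L^k)_+^*(g) + (q + k/2) (L^*)^{q+k-1}(Ψ_j) - (X⁽¹⁾_{k-1})^*(g)`. (When an index `p + k - 1` or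
`q + k - 1` is negative, its coefficient is zero.) -/
def varPot (r k : ℕ) (P : Data K m) (p q : ℕ) (i j : Fin m) : Fn K :=
  (P.ML r k).concomitant (P.LΦ r p i) (P.LΨ r q j)
    + ((p : ℚ) + k / 2) • P.pot (p + k - 1) q i j
    + ((q : ℚ) + k / 2) • P.pot p (q + k - 1) i j
    + ∑ l, ∑ s ∈ Finset.range (k - 1),
        wt (k - 1) s • (P.pot p s i l * P.pot (k - 1 - 1 - s) q l j)

end Data

/-- The first-order deformation `f + ε g`. -/
def Fn.deform {K : Type*} [CommRing K] (f g : Fn K) : Fn (DualNumber K) := fun d =>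
  TrivSqZeroExt.inl (MvPowerSeries.coeff d f) + TrivSqZeroExt.inr (MvPowerSeries.coeff d g)

/-- The first-order part `g` of `f + ε g`. -/
def Fn.eps {K : Type*} [CommRing K] (h : Fn (DualNumber K)) : Fn K := fun d =>
  TrivSqZeroExt.snd (MvPowerSeries.coeff d h)

/-- The first-order deformation `A + ε B`. -/
def PDO.deform {K : Type*} [CommRing K] (A B : PDO K) : PDO (DualNumber K) := fun n =>
  Fn.deform (A n) (B n)

/-- The first-order part `B` of `A + ε B`. -/
def PDO.eps {K : Type*} [CommRing K] (A : PDO (DualNumber K)) : PDO K := fun n => Fn.eps (A n)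

/-- The first-order part of a wave expression. -/
def Wave.eps {K : Type*} [CommRing K] (F : Wave (DualNumber K)) : Wave K := fun n => Fn.eps (F n)

namespace Data

variable {K : Type*} [CommRing K] [Algebra ℚ K] {m : ℕ}

/-- The vector field `∂*_k`: the first-order deformation `P + ε ∂*_k P` of `P`, as data over the
dual numbers. For an expression `F` in the data, `∂*_k F` is the `ε`-part of `F (P.flow r k)`. -/
def flow (r k : ℕ) (P : Data K m) : Data (DualNumber K) m where
  base := P.base.mapRange TrivSqZeroExt.inl rfl
  W := PDO.deform P.W (P.gen r k * P.W)
  Winv := PDO.deform P.Winv (-(P.Winv * P.gen r k))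
  Φ i := Fn.deform (P.Φ i) (P.varΦ r k i)
  Ψ i := Fn.deform (P.Ψ i) (P.varΨ r k i)
  pot p q i j := Fn.deform (P.pot p q i j) (P.varPot r k p q i j)

/-- `∂*_k L`. -/
def varL (r k : ℕ) (P : Data K m) : PDO K := PDO.eps ((flow r k P).L r)

/-- `∂*_k W`. -/
def varW (r k : ℕ) (P : Data K m) : PDO K := PDO.eps (flow r k P).W

/-- `∂*_k ψ`. -/
def varψ (r k : ℕ) (P : Data K m) : Wave K := Wave.eps (flow r k P).ψ

/-- The right-hand side `[L^{n/r}_+, L]` of the isospectral Lax equation `∂_n L = [L^{n/r}_+, L]`. -/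
def laxRHS (r : ℕ) (n : ℕ+) (P : Data K m) : PDO K := ⁅(P.root n).plus, P.L r⁆

end Data

end CKP

end

/-! The computations take place in a ring of operators that contains `M`. For large l the time t_l
is the bare variable X_l, so modulo each ideal `van` the operator M⁽⁰⁾ has bounded order. Operators
with this property form an associative ℚ-algebra `Op`, and the rest is noncommutative algebra there.

One pairing governs everything: `om A` is the residue of (D⁻¹ g) A (f D⁻¹), which is the concomitant
Ω_{A₊}(f, g) (`concomitant_val`). If one vector is replaced by the operator 1, the pairing becomes
A₊(f) or A₊^*(g). Index rows by `Ix`, with a formal symbol `inf`, and set s(f, inf) = f, s(inf, g) =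
-g. The statements about L^p(Φ), about (L^*)^q(Ψ) and about S^{p,q} then become instances of a
single identity.

Write Y_k = M L^k. Two facts drive the proof: [L, Y_k] = L^k, and (L^k)₋ = ∑_{a+b=k-1} L^a(Φ) D⁻¹
(L^*)^b(Ψ) (`Frame.IsLax.pow`). The generator is G_k = -Y_k + N_k with N_k = (Y_k)₊ + X_{k-1}, so
[G_k, L] = L^k + [N_k, L]. The coefficients of X are such that [X, L]₋ telescopes
(`conv_telescope`): it cancels (L^k)₋ and leaves two boundary terms with factor k/2. These are the
k/2-terms in the variations of Φ and Ψ, and the constrained form survives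
(`Frame.IsLax.minus_gen_comm`). The same computation at the level of the pairing is
`Frame.IsLax.dS_shift`. It shows that L^p(Φ) varies with weight p + k/2, since each application of L
adds one copy of L^k = [L, Y_k].

Compatibility with the times follows from ∂_n Y_k = [L^{n/r}₊, Y_k], through `Frame.IsEvol.dS` and
`Frame.IsEvol.dt_gen`. A vector field is a point over the dual numbers, which are again a ℚ-algebra,
so preservation of the equations means that the deformed data solve them over K[ε]; each equation is
checked in its ε⁰- and ε¹-parts (`IsSolution.flow`, `IsSolution.flow_isPotential`).

For the Virasoro relations, [∂*_l, ∂*_k]W = (∂*_l G_k - ∂*_k G_l + [G_k, G_l]) W. The bracket in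
front of W is computed from [Y_l, Y_k] = (l - k) Y_{k+l-1} and, for the integral terms, from the
identity `conv_virasoro` (`Frame.gen_virasoro`).

The integrals exist because zero curvature makes the forms ∑ Ω_{L^{n/r}₊}(f, g) dt_n closed
(`Op.dt_om_comm`). The Poincaré lemma `exists_dt_eq` gives S^{0,q}, and the shift relation defines
the others. -/

noncomputable section

namespace CKP

variable {K : Type*} [CommRing K] {ι κ : Type*}

open MvPowerSeries Finset.HasAntidiagonal

/-! ### Locally finite sums of power series. -/

/-- Each monomial occurs in only finitely many members of the family. -/
def LocFin (f : ι → Fn K) : Prop := ∀ d, (Function.support fun i => coeff d (f i)).Finite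

theorem coeff_lsum (f : ι → Fn K) (d : ℕ+ →₀ ℕ) : coeff d (lsum f) = ∑ᶠ i, coeff d (f i) := rfl

theorem LocFin.mono {f : ι → Fn K} (hf : LocFin f) {g : ι → Fn K}
    (h : ∀ d i, coeff d (f i) = 0 → coeff d (g i) = 0) : LocFin g := fun d =>
  (hf d).subset fun i hi => fun h0 => hi (h d i h0)

theorem LocFin.zsmul {f : ι → Fn K} (hf : LocFin f) (c : ι → ℤ) : LocFin fun i => c i • f i :=
  hf.mono fun d i h => by rw [map_zsmul, h, smul_zero]

theorem LocFin.mul_left {f : ι → Fn K} (hf : LocFin f) (g : Fn K) : LocFin fun i => g * f i := by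
  classical
  intro d
  refine (((antidiagonal d).finite_toSet).biUnion fun x _ => hf x.2).subset fun i hi => ?_
  by_contra h
  simp only [Set.mem_iUnion, not_exists, Function.mem_support, not_not] at h
  refine hi ?_
  change coeff d (g * f i) = 0
  rw [coeff_mul]
  exact Finset.sum_eq_zero fun x hx => by rw [h x hx, mul_zero]

theorem LocFin.dt {f : ι → Fn K} (hf : LocFin f) (n : ℕ+) : LocFin fun i => dt n (f i) :=
  fun d => (hf (d + Finsupp.single n 1)).subset fun i hi h0 => hi (by
    simp only [CKP.dt, coeff_pderiv]
    exact mul_eq_zero_of_left h0 _)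

theorem LocFin.comp_injective {f : ι → Fn K} (hf : LocFin f) {e : κ → ι}
    (he : Function.Injective e) : LocFin fun i => f (e i) := fun d =>
  (hf d).preimage he.injOn

theorem lsum_congr {f g : ι → Fn K} (h : ∀ i, f i = g i) : lsum f = lsum g := by
  rw [show f = g from funext h]

/-- Local finiteness is essential here and below: `finsum` assigns 0 to a coefficient with infinite
support, so additivity can fail without it. -/
theorem lsum_add {f g : ι → Fn K} (hf : LocFin f) (hg : LocFin g) :
    (lsum fun i => f i + g i) = lsum f + lsum g := by
  ext d
  rw [map_add, coeff_lsum, coeff_lsum, coeff_lsum]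
  simp only [map_add]
  exact finsum_add_distrib (hf d) (hg d)

theorem lsum_zero : (lsum fun _ : ι => (0 : Fn K)) = 0 := by
  ext d
  rw [coeff_lsum]
  simp

theorem lsum_mul_left {f : ι → Fn K} (hf : LocFin f) (g : Fn K) :
    (lsum fun i => g * f i) = g * lsum f := by
  classical
  ext d
  rw [coeff_lsum, coeff_mul]
  simp only [coeff_mul, coeff_lsum]
  rw [finsum_sum_comm]
  · exact Finset.sum_congr rfl fun x _ => (mul_finsum' _ _ (hf x.2)).symm
  · exact fun x _ => (hf x.2).subset fun i hi h0 => hi (by simp only [h0, mul_zero])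

theorem lsum_zsmul_left {f : ι → Fn K} (hf : LocFin f) (c : ℤ) :
    (lsum fun i => c • f i) = c • lsum f := by
  have := lsum_mul_left hf (c : Fn K)
  simpa only [zsmul_eq_mul] using this

theorem lsum_dt {f : ι → Fn K} (hf : LocFin f) (n : ℕ+) :
    (lsum fun i => dt n (f i)) = dt n (lsum f) := by
  ext d
  simp only [CKP.dt, coeff_pderiv, coeff_lsum]
  exact (finsum_mul' _ _ (hf _)).symm

theorem lsum_dx_iterate {f : ι → Fn K} (hf : LocFin f) (j : ℕ) :
    LocFin (fun i => dx^[j] (f i)) ∧ (lsum fun i => dx^[j] (f i)) = dx^[j] (lsum f) := by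
  induction j with
  | zero => exact ⟨hf, rfl⟩
  | succ j ih =>
    simp only [Function.iterate_succ_apply']
    exact ⟨ih.1.dt 1, (lsum_dt ih.1 1).trans (by rw [ih.2]; rfl)⟩

theorem lsum_prod {f : ι × κ → Fn K} (hf : LocFin f) :
    LocFin (fun i => lsum fun k => f (i, k)) ∧ lsum f = lsum fun i => lsum fun k => f (i, k) := by
  constructor
  · intro d
    refine ((hf d).image Prod.fst).subset fun i hi => ?_
    by_contra h
    refine hi ?_
    change coeff d (lsum fun k => f (i, k)) = 0
    rw [coeff_lsum]
    refine finsum_eq_zero_of_forall_eq_zero fun k => ?_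
    by_contra hk
    exact h ⟨(i, k), hk, rfl⟩
  · ext d
    rw [coeff_lsum, coeff_lsum]
    exact finsum_curry _ (hf d)

theorem lsum_equiv (e : ι ≃ κ) (f : κ → Fn K) : (lsum fun i => f (e i)) = lsum f := by
  ext d
  rw [coeff_lsum, coeff_lsum]
  exact finsum_comp_equiv (f := fun i => coeff d (f i)) e

theorem lsum_eq_single (f : ι → Fn K) (a : ι) (h : ∀ i, i ≠ a → f i = 0) : lsum f = f a := by
  ext d
  rw [coeff_lsum]
  exact finsum_eq_single _ a fun i hi => by rw [h i hi, map_zero]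

theorem lsum_eq_sum (f : ι → Fn K) (s : Finset ι) (h : ∀ i, i ∉ s → f i = 0) :
    lsum f = ∑ i ∈ s, f i := by
  ext d
  rw [coeff_lsum, map_sum]
  refine finsum_eq_sum_of_support_subset _ fun i hi => ?_
  by_contra hn
  exact hi (by simp [h i (by simpa using hn)])

/-- Reindexing along an injection whose range carries all nonzero terms. -/
theorem lsum_injective {e : κ → ι} (he : Function.Injective e) (f : ι → Fn K)
    (h : ∀ i, i ∉ Set.range e → f i = 0) : (lsum fun k => f (e k)) = lsum f := by
  ext d
  rw [coeff_lsum, coeff_lsum, ← finsum_mem_range (f := fun i => coeff d (f i)) he]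
  rw [finsum_mem_def]
  refine finsum_congr fun i => ?_
  by_cases hi : i ∈ Set.range e
  · rw [Set.indicator_of_mem hi]
  · rw [Set.indicator_of_notMem hi, h i hi, map_zero]

theorem lsum_antidiagonal {f : ℕ × ℕ → Fn K} (hf : LocFin f) :
    lsum f = lsum fun s => ∑ x ∈ antidiagonal s, f x := by
  ext d
  rw [coeff_lsum, coeff_lsum]
  have h1 := finsum_comp_equiv (f := fun i => coeff d (f i))
      Finset.HasAntidiagonal.sigmaAntidiagonalEquivProd
  rw [← h1]
  have hfin := (hf d).preimage
    (Finset.HasAntidiagonal.sigmaAntidiagonalEquivProd (A := ℕ)).injective.injOn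
  rw [← finsum_mem_univ]
  have key : ∀ s, coeff d (∑ x ∈ antidiagonal s, f x) =
      ∑ᶠ x : antidiagonal s, coeff d (f x) := fun s => by
    rw [map_sum, finsum_eq_sum_of_fintype]
    exact (Finset.sum_coe_sort (antidiagonal s) fun x => coeff d (f x)).symm
  simp only [key]
  rw [finsum_mem_univ]
  classical
  have hs := hfin.toFinset
  rw [finsum_eq_sum_of_support_subset _ (s := hfin.toFinset) (by
    intro i hi; simpa using hi)]
  rw [finsum_eq_sum_of_support_subset _ (s := hfin.toFinset.image Sigma.fst) (by
    intro i hi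
    simp only [Finset.coe_image, Set.Finite.coe_toFinset, Set.mem_image]
    by_contra h
    refine hi (finsum_eq_zero_of_forall_eq_zero fun x => ?_)
    by_contra hx
    exact h ⟨⟨i, x⟩, hx, rfl⟩)]
  simp only [finsum_eq_sum_of_fintype]
  rw [Finset.sum_sigma']
  refine Finset.sum_subset (fun x hx => ?_) fun x _ hx => ?_
  · simp only [Finset.mem_sigma, Finset.mem_image, Finset.mem_univ, and_true]
    exact ⟨x, hx, rfl⟩
  · by_contra h
    exact hx (by simpa using h)

end CKP

end

/-! ### Leibniz rules, admissible operators, and associativity of their product. -/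

noncomputable section

namespace CKP

variable {K : Type*} [CommRing K] {ι κ : Type*}

open MvPowerSeries Finset.HasAntidiagonal

theorem lsum_prod_antidiagonal {f : ι × (ℕ × ℕ) → Fn K} (hf : LocFin f) :
    LocFin (fun x : ι × ℕ => ∑ y ∈ antidiagonal x.2, f (x.1, y)) ∧
      lsum f = lsum fun x : ι × ℕ => ∑ y ∈ antidiagonal x.2, f (x.1, y) := by
  have h1 : LocFin (fun x : ι × ℕ => ∑ y ∈ antidiagonal x.2, f (x.1, y)) := by
    intro d
    refine ((hf d).image fun z : ι × (ℕ × ℕ) => (z.1, z.2.1 + z.2.2)).subset fun x hx => ?_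
    by_contra h
    refine hx ?_
    change coeff d (∑ y ∈ antidiagonal x.2, f (x.1, y)) = 0
    rw [map_sum]
    refine Finset.sum_eq_zero fun y hy => ?_
    by_contra hne
    refine h ⟨(x.1, y), hne, ?_⟩
    rw [mem_antidiagonal] at hy
    simp [hy]
  refine ⟨h1, ?_⟩
  rw [(lsum_prod hf).2, (lsum_prod h1).2]
  exact lsum_congr fun i => lsum_antidiagonal (hf.comp_injective (Prod.mk_right_injective i))

/-! ### Derivatives of products -/

theorem dt_zero (n : ℕ+) : dt n (0 : Fn K) = 0 := map_zero _
theorem dt_one (n : ℕ+) : dt n (1 : Fn K) = 0 := pderiv_one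
theorem dt_add (n : ℕ+) (f g : Fn K) : dt n (f + g) = dt n f + dt n g := map_add _ _ _
theorem dt_neg (n : ℕ+) (f : Fn K) : dt n (-f) = -dt n f := map_neg _ _
theorem dt_zsmul (n : ℕ+) (c : ℤ) (f : Fn K) : dt n (c • f) = c • dt n f := map_zsmul _ _ _
theorem dt_sum (n : ℕ+) (s : Finset ι) (f : ι → Fn K) :
    dt n (∑ i ∈ s, f i) = ∑ i ∈ s, dt n (f i) := map_sum _ _ _
theorem dt_mul (n : ℕ+) (f g : Fn K) : dt n (f * g) = dt n f * g + f * dt n g := by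
  simp only [dt, Derivation.leibniz, smul_eq_mul]
  ring

theorem dt_comm (m n : ℕ+) (f : Fn K) : dt m (dt n f) = dt n (dt m f) := by
  ext d
  simp only [dt, coeff_pderiv]
  by_cases h : m = n
  · subst h; rfl
  · simp [h, Ne.symm h, add_right_comm]
    ring

/-- `∂_x` as an additive map. -/
def dxHom : AddMonoid.End (Fn K) := (pderiv K (1 : ℕ+)).toLinearMap.toAddMonoidHom

theorem dx_iterate_eq (j : ℕ) (f : Fn K) : dx^[j] f = (dxHom ^ j) f := by
  induction j with
  | zero => rfl
  | succ j ih => rw [Function.iterate_succ_apply', ih, pow_succ']; rfl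

theorem dxi_zero (j : ℕ) : dx^[j] (0 : Fn K) = 0 := by rw [dx_iterate_eq, map_zero]
theorem dxi_add (j : ℕ) (f g : Fn K) : dx^[j] (f + g) = dx^[j] f + dx^[j] g := by
  simp only [dx_iterate_eq, map_add]
theorem dxi_zsmul (j : ℕ) (c : ℤ) (f : Fn K) : dx^[j] (c • f) = c • dx^[j] f := by
  simp only [dx_iterate_eq, map_zsmul]
theorem dxi_one (j : ℕ) (hj : j ≠ 0) : dx^[j] (1 : Fn K) = 0 := by
  obtain ⟨j, rfl⟩ := Nat.exists_eq_succ_of_ne_zero hj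
  rw [Function.iterate_succ_apply, dx, dt_one, dxi_zero]

theorem dt_dxi (n : ℕ+) (j : ℕ) (f : Fn K) : dt n (dx^[j] f) = dx^[j] (dt n f) := by
  induction j with
  | zero => rfl
  | succ j ih => rw [Function.iterate_succ_apply', Function.iterate_succ_apply', dx, dt_comm, ih,
      dx]

theorem dxi_mul (s : ℕ) (f g : Fn K) :
    dx^[s] (f * g) = ∑ x ∈ antidiagonal s, (s.choose x.1 : ℤ) • (dx^[x.1] f * dx^[x.2] g) := by
  induction s with
  | zero => simp
  | succ s ih =>
    rw [Function.iterate_succ_apply', ih]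
    have := Finset.sum_antidiagonal_choose_succ_mul
      (fun i j => dx^[i] f * dx^[j] g) s
    simp only [natCast_zsmul, nsmul_eq_mul]
    rw [this, dx, dt_sum, ← Finset.sum_add_distrib]
    refine Finset.sum_congr rfl fun x hx => ?_
    rw [mem_antidiagonal] at hx
    rw [show (s.choose x.1 : Fn K) * (dx^[x.1] f * dx^[x.2] g) = (s.choose x.1) •
        (dx^[x.1] f * dx^[x.2] g) by
      rw [nsmul_eq_mul]]
    rw [show dt 1 (s.choose x.1 • (dx^[x.1] f * dx^[x.2] g)) =
      s.choose x.1 • dt 1 (dx^[x.1] f * dx^[x.2] g) from map_nsmul _ _ _, dt_mul, nsmul_eq_mul,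
      Function.iterate_succ_apply', Function.iterate_succ_apply', dx,
      ← Nat.choose_symm_of_eq_add hx.symm]
    change _ = _ + _ * (dt 1 _ * _)
    ring

/-! ### Admissible operators -/

/-- The series all of whose monomials fail to divide `d` after forgetting the power of `x`. -/
def van (K : Type*) [CommRing K] (d : ℕ+ →₀ ℕ) : Ideal (Fn K) where
  carrier := {f | ∀ e : ℕ+ →₀ ℕ, (∀ n, n ≠ 1 → e n ≤ d n) → coeff e f = 0}
  zero_mem' := fun e _ => map_zero _
  add_mem' := fun hf hg e he => by rw [map_add, hf e he, hg e he, add_zero]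
  smul_mem' := fun c f hf e he => by
    classical
    rw [smul_eq_mul, coeff_mul]
    refine Finset.sum_eq_zero fun x hx => ?_
    rw [mem_antidiagonal] at hx
    rw [hf x.2 fun n hn => ?_, mul_zero]
    refine le_trans ?_ (he n hn)
    rw [← hx]
    exact Nat.le_add_left _ _

theorem coeff_of_mem_van {d : ℕ+ →₀ ℕ} {f : Fn K} (h : f ∈ van K d) : coeff d f = 0 :=
  h d fun _ _ => le_rfl

theorem dx_mem_van {d : ℕ+ →₀ ℕ} {f : Fn K} (h : f ∈ van K d) : dx f ∈ van K d := fun e he => by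
  simp only [dx, dt, coeff_pderiv]
  rw [h _ fun n hn => ?_, zero_mul]
  rw [Finsupp.add_apply, Finsupp.single_eq_of_ne hn, add_zero]
  exact he n hn

theorem dxi_mem_van {d : ℕ+ →₀ ℕ} {f : Fn K} (h : f ∈ van K d) (j : ℕ) :
    dx^[j] f ∈ van K d := by
  induction j with
  | zero => exact h
  | succ j ih => rw [Function.iterate_succ_apply']; exact dx_mem_van ih

theorem dt_mem_van {d : ℕ+ →₀ ℕ} {f : Fn K} (n : ℕ+) (h : f ∈ van K (d + Finsupp.single n 1)) :
    dt n f ∈ van K d := fun e he => by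
  simp only [dt, coeff_pderiv]
  rw [h _ fun k hk => ?_, zero_mul]
  exact Nat.add_le_add_right (he k hk) _

theorem lsum_mem_van {d : ℕ+ →₀ ℕ} {f : ι → Fn K} (h : ∀ i, f i ∈ van K d) :
    lsum f ∈ van K d := fun e he => by
  rw [coeff_lsum]
  exact finsum_eq_zero_of_forall_eq_zero fun i => h i e he

theorem locFin_of_van {f : ι → Fn K} (h : ∀ d, {i | f i ∉ van K d}.Finite) : LocFin f :=
  fun d => (h d).subset fun _ hi hv => hi (coeff_of_mem_van hv)

/-- Modulo each `van d`, the operator has bounded order. -/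
def Adm (A : PDO K) : Prop := ∀ d, ∃ N : ℤ, ∀ n, N < n → A n ∈ van K d

/-- Modulo `van d` the three orders are bounded above by a, b, c. Since p is fixed, each index is
then also bounded on the other side, so finitely many terms remain. -/
theorem Adm.locFin_mul₃ {A B C : PDO K} (hA : Adm A) (hB : Adm B) (hC : Adm C) (p : ℤ) :
    LocFin fun x : (ℤ × ℤ × ℕ) × ℕ × ℕ =>
      A x.1.1 * dx^[x.1.2.2] (B x.1.2.1) *
        dx^[x.2.1 + x.2.2] (C (p - x.1.1 - x.1.2.1 + x.1.2.2 + x.2.1 + x.2.2)) := by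
  refine locFin_of_van fun d => ?_
  obtain ⟨a, ha⟩ := hA d
  obtain ⟨b, hb⟩ := hB d
  obtain ⟨c, hc⟩ := hC d
  refine (((Set.finite_Icc (p - b - c) a).prod ((Set.finite_Icc (p - a - c) b).prod
    (Set.finite_Iic (c - p + a + b).toNat))).prod ((Set.finite_Iic (c - p + a + b).toNat).prod
    (Set.finite_Iic (c - p + a + b).toNat))).subset ?_
  rintro ⟨⟨n, k, j⟩, i, l⟩ hx
  simp only [Set.mem_ofPred_eq] at hx
  have h1 : n ≤ a := by
    by_contra h
    exact hx (Ideal.mul_mem_right _ _ (Ideal.mul_mem_right _ _ (ha _ (not_le.1 h))))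
  have h2 : k ≤ b := by
    by_contra h
    exact hx (Ideal.mul_mem_right _ _ (Ideal.mul_mem_left _ _ (dxi_mem_van (hb _ (not_le.1 h)) _)))
  have h3 : p - n - k + j + i + l ≤ c := by
    by_contra h
    exact hx (Ideal.mul_mem_left _ _ (dxi_mem_van (hc _ (not_le.1 h)) _))
  simp only [Set.mem_prod, Set.mem_Icc, Set.mem_Iic]
  omega

theorem Adm.locFin_mul₂ {A B : PDO K} (hA : Adm A) (hB : Adm B) (p : ℤ) :
    LocFin fun q : ℤ × ℕ => A q.1 * dx^[q.2] (B (p - q.1 + q.2)) := by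
  refine locFin_of_van fun d => ?_
  obtain ⟨a, ha⟩ := hA d
  obtain ⟨b, hb⟩ := hB d
  refine ((Set.finite_Icc (p - b) a).prod (Set.finite_Iic (b - p + a).toNat)).subset ?_
  rintro ⟨n, j⟩ hx
  simp only [Set.mem_ofPred_eq] at hx
  have h1 : n ≤ a := by
    by_contra h
    exact hx (Ideal.mul_mem_right _ _ (ha _ (not_le.1 h)))
  have h2 : p - n + j ≤ b := by
    by_contra h
    exact hx (Ideal.mul_mem_left _ _ (dxi_mem_van (hb _ (not_le.1 h)) _))
  simp only [Set.mem_prod, Set.mem_Icc, Set.mem_Iic]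
  omega

theorem PDO.mul_apply (A B : PDO K) (p : ℤ) : (A * B) p = lsum fun q : ℤ × ℕ =>
    (Ring.choose q.1 q.2 : ℤ) • (A q.1 * dx^[q.2] (B (p - q.1 + (q.2 : ℤ)))) := rfl

theorem Adm.mul {A B : PDO K} (hA : Adm A) (hB : Adm B) : Adm (A * B) := fun d => by
  obtain ⟨a, ha⟩ := hA d
  obtain ⟨b, hb⟩ := hB d
  refine ⟨a + b, fun p hp => ?_⟩
  rw [PDO.mul_apply]
  refine lsum_mem_van fun q => ?_
  refine Submodule.smul_of_tower_mem _ _ ?_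
  by_cases h : a < q.1
  · exact Ideal.mul_mem_right _ _ (ha _ h)
  · exact Ideal.mul_mem_left _ _ (dxi_mem_van (hb _ (by omega)) _)

theorem PDO.mul_assoc_of_adm {A B C : PDO K} (hA : Adm A) (hB : Adm B) (hC : Adm C) :
    A * B * C = A * (B * C) := by
  funext p
  have hU := hA.locFin_mul₃ hB hC p
  set U : (ℤ × ℤ × ℕ) × ℕ × ℕ → Fn K := fun x =>
      A x.1.1 * dx^[x.1.2.2] (B x.1.2.1) *
        dx^[x.2.1 + x.2.2] (C (p - x.1.1 - x.1.2.1 + x.1.2.2 + x.2.1 + x.2.2)) with hUdef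
  have hV := hU.zsmul fun x => Ring.choose x.1.1 x.1.2.2 * (Ring.choose (x.1.1 - x.1.2.2) x.2.1 *
    Ring.choose x.1.2.1 x.2.2)
  have hV' := lsum_prod_antidiagonal hV
  -- Both bracketings are expanded to this sum over five indices, with coefficient choose(n, j) ·
  -- choose(n - j, i) · choose(k, l).
  trans lsum fun x => (Ring.choose x.1.1 x.1.2.2 * (Ring.choose (x.1.1 - (x.1.2.2 : ℤ)) x.2.1 *
    Ring.choose x.1.2.1 x.2.2)) • U x
  · rw [hV'.2]
    -- the equivalence `((q, i), (n, j)) ↔ ((n, k, j), i)`, `q = n + k - j`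
    let e : (ℤ × ℕ) × ℤ × ℕ ≃ (ℤ × ℤ × ℕ) × ℕ :=
      { toFun := fun x => ((x.2.1, x.1.1 - x.2.1 + x.2.2, x.2.2), x.1.2)
        invFun := fun x => ((x.1.1 + x.1.2.1 - x.1.2.2, x.2), x.1.1, x.1.2.2)
        left_inv := fun x => by ext <;> dsimp only; ring
        right_inv := fun x => by ext <;> dsimp only; ring }
    rw [← lsum_equiv e]
    have h1 := lsum_prod (hV'.1.comp_injective e.injective)
    rw [h1.2, PDO.mul_apply]
    refine lsum_congr fun q => ?_
    rw [PDO.mul_apply, mul_comm, ← lsum_mul_left ((hA.locFin_mul₂ hB q.1).zsmul _),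
      ← lsum_zsmul_left (((hA.locFin_mul₂ hB q.1).zsmul _).mul_left _)]
    refine lsum_congr fun x => ?_
    simp only [e, Equiv.coe_fn_mk]
    -- The exponent q = n + k - j is split as (n - j) + k so that Vandermonde's identity expands
    -- choose(q, ·).
    have h2 : q.1 = (x.1 - x.2) + (q.1 - x.1 + x.2) := by ring
    rw [show Ring.choose q.1 q.2 = Ring.choose ((x.1 - x.2) + (q.1 - x.1 + x.2)) q.2 by rw [← h2],
      Ring.add_choose_eq _ (Commute.all _ _), Finset.sum_smul]
    refine Finset.sum_congr rfl fun y hy => ?_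
    rw [mem_antidiagonal] at hy
    have h3 : p - x.1 - (q.1 - x.1 + (x.2 : ℤ)) + x.2 + y.1 + y.2 = p - q.1 + (q.2 : ℤ) := by
      rw [← hy]; push_cast; ring
    simp only [hUdef, h3, hy, zsmul_eq_mul]
    push_cast
    ring
  · -- the equivalence `((n, s), (k, b)) ↔ ((n, k, b), s)`
    let e₀ : (ℤ × ℤ × ℕ) × ℕ × ℕ ≃ (ℤ × ℤ × ℕ) × ℕ × ℕ :=
      { toFun := fun x => ((x.1.1, x.1.2.1, x.2.1), x.2.2, x.1.2.2)
        invFun := fun x => ((x.1.1, x.1.2.1, x.2.2), x.1.2.2, x.2.1)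
        left_inv := fun x => rfl
        right_inv := fun x => rfl }
    let e : (ℤ × ℕ) × ℤ × ℕ ≃ (ℤ × ℤ × ℕ) × ℕ :=
      { toFun := fun x => ((x.1.1, x.2.1, x.2.2), x.1.2)
        invFun := fun x => ((x.1.1, x.2), x.1.2.1, x.1.2.2)
        left_inv := fun x => rfl
        right_inv := fun x => rfl }
    rw [← lsum_equiv e₀]
    have hW := lsum_prod_antidiagonal (hV.comp_injective e₀.injective)
    rw [hW.2, ← lsum_equiv e]
    have h1 := lsum_prod (hW.1.comp_injective e.injective)
    rw [h1.2, PDO.mul_apply]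
    refine lsum_congr fun q => ?_
    have hBC := (hB.locFin_mul₂ hC (p - q.1 + q.2)).zsmul fun x => Ring.choose x.1 x.2
    rw [PDO.mul_apply, ← (lsum_dx_iterate hBC q.2).2,
      ← lsum_mul_left (lsum_dx_iterate hBC q.2).1,
      ← lsum_zsmul_left ((lsum_dx_iterate hBC q.2).1.mul_left _)]
    refine lsum_congr fun x => ?_
    simp only [e, e₀, Equiv.coe_fn_mk]
    rw [dxi_zsmul, dxi_mul, Finset.smul_sum, Finset.mul_sum, Finset.smul_sum]
    refine Finset.sum_congr rfl fun y hy => ?_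
    rw [mem_antidiagonal] at hy
    have h3 : p - q.1 - x.1 + (y.1 : ℤ) + y.2 + x.2 = p - q.1 + (q.2 : ℤ) - x.1 + x.2 := by
      rw [← hy]; push_cast; ring
    -- After the Leibniz rule, choose(n, s) · choose(s, i) is rewritten as choose(n, i) · choose(n -
    -- i, s - i), which is the form of the coefficients in the common sum.
    have h4 := Ring.choose_smul_choose q.1 (n := q.2) (k := y.1) (by omega)
    rw [show q.2 - y.1 = y.2 by omega] at h4
    simp only [hUdef, h3]
    rw [← mul_assoc, ← h4, ← Function.iterate_add_apply]
    simp only [zsmul_eq_mul, nsmul_eq_mul]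
    push_cast
    ring

end CKP

end

/-! ### The ring of admissible operators, orders, and the splitting into positive and negative
parts. -/

noncomputable section

namespace CKP

variable {K : Type*} [CommRing K] [Algebra ℚ K] {ι κ : Type*}

open MvPowerSeries Finset.HasAntidiagonal

theorem dt_qsmul (n : ℕ+) (c : ℚ) (f : Fn K) : dt n (c • f) = c • dt n f := map_rat_smul _ _ _

theorem dxi_qsmul (j : ℕ) (c : ℚ) (f : Fn K) : dx^[j] (c • f) = c • dx^[j] f := by
  simp only [dx_iterate_eq, map_rat_smul]

theorem lsum_qsmul_left {f : ι → Fn K} (hf : LocFin f) (c : ℚ) :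
    (lsum fun i => c • f i) = c • lsum f := by
  have := lsum_mul_left hf (algebraMap ℚ (Fn K) c)
  simpa only [Algebra.smul_def] using this

/-- The admissible operators. -/
def adm (K : Type*) [CommRing K] [Algebra ℚ K] : Submodule ℚ (PDO K) where
  carrier := {A | Adm A}
  zero_mem' := fun d => ⟨0, fun n _ => Submodule.zero_mem _⟩
  add_mem' := fun hA hB d => by
    obtain ⟨a, ha⟩ := hA d
    obtain ⟨b, hb⟩ := hB d
    exact ⟨max a b, fun n hn => Submodule.add_mem _ (ha n (lt_of_le_of_lt (le_max_left _ _) hn))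
      (hb n (lt_of_le_of_lt (le_max_right _ _) hn))⟩
  smul_mem' := fun c A hA d => by
    obtain ⟨a, ha⟩ := hA d
    exact ⟨a, fun n hn => Submodule.smul_of_tower_mem _ c (ha n hn)⟩

/-- The ring of admissible pseudo-differential operators. -/
def Op (K : Type*) [CommRing K] [Algebra ℚ K] : Type _ := ↥(adm K)

namespace Op

instance : AddCommGroup (Op K) := inferInstanceAs (AddCommGroup (adm K))
instance : Module ℚ (Op K) := inferInstanceAs (Module ℚ (adm K))

/-- The coefficient of `D^n`, as a linear map. -/
def coHom (n : ℤ) : Op K →ₗ[ℚ] Fn K where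
  toFun A := A.1 n
  map_add' _ _ := rfl
  map_smul' _ _ := rfl

/-- The coefficient of `D^n`. -/
def co (A : Op K) (n : ℤ) : Fn K := coHom n A

theorem val_apply (A : Op K) (n : ℤ) : A.1 n = A.co n := rfl

@[ext] theorem ext {A B : Op K} (h : ∀ n, A.co n = B.co n) : A = B := Subtype.ext (funext h)

@[simp] theorem co_zero (n : ℤ) : (0 : Op K).co n = 0 := map_zero (coHom n)
@[simp] theorem co_add (A B : Op K) (n : ℤ) : (A + B).co n = A.co n + B.co n :=
  map_add (coHom n) A B
@[simp] theorem co_sub (A B : Op K) (n : ℤ) : (A - B).co n = A.co n - B.co n :=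
  map_sub (coHom n) A B
@[simp] theorem co_neg (A : Op K) (n : ℤ) : (-A).co n = -A.co n := map_neg (coHom n) A
@[simp] theorem co_smul (c : ℚ) (A : Op K) (n : ℤ) : (c • A).co n = c • A.co n :=
  map_smul (coHom n) c A
theorem co_sum (s : Finset ι) (A : ι → Op K) (n : ℤ) :
    (∑ i ∈ s, A i).co n = ∑ i ∈ s, (A i).co n := map_sum (coHom n) A s

theorem adm_mono {K : Type*} [CommRing K] (f : Fn K) (n : ℤ) : Adm (PDO.mono f n) := fun _ =>
  ⟨n, fun p hp => by
    rw [show PDO.mono f n p = 0 from if_neg hp.ne']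
    exact Submodule.zero_mem _⟩

/-- The operator `f D^n`. -/
def mono (f : Fn K) (n : ℤ) : Op K := ⟨PDO.mono f n, adm_mono f n⟩

theorem co_mono (f : Fn K) (n p : ℤ) : (mono f n).co p = if p = n then f else 0 := rfl

instance : Mul (Op K) := ⟨fun A B => ⟨A.1 * B.1, A.2.mul B.2⟩⟩
instance : One (Op K) := ⟨mono 1 0⟩

theorem val_mul (A B : Op K) : (A * B).1 = A.1 * B.1 := rfl

theorem co_mul (A B : Op K) (p : ℤ) : (A * B).co p = lsum fun q : ℤ × ℕ =>
    (Ring.choose q.1 q.2 : ℤ) • (A.co q.1 * dx^[q.2] (B.co (p - q.1 + (q.2 : ℤ)))) := rfl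

theorem locFin_mul (A B : Op K) (p : ℤ) : LocFin fun q : ℤ × ℕ =>
    (Ring.choose q.1 q.2 : ℤ) • (A.co q.1 * dx^[q.2] (B.co (p - q.1 + (q.2 : ℤ)))) :=
  (A.2.locFin_mul₂ B.2 p).zsmul _

/-- Left multiplication by `f D^n`. -/
theorem co_mono_mul (f : Fn K) (n : ℤ) (B : Op K) (p : ℤ) : (mono f n * B).co p =
    lsum fun j : ℕ => (Ring.choose n j : ℤ) • (f * dx^[j] (B.co (p - n + j))) := by
  rw [co_mul, ← lsum_injective (Prod.mk_right_injective n)]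
  · simp [co_mono]
  · rintro ⟨q, j⟩ h
    have : q ≠ n := fun h' => h ⟨j, by rw [h']⟩
    simp [co_mono, this]

/-- Right multiplication by a function. -/
theorem co_mul_mono_zero (A : Op K) (f : Fn K) (p : ℤ) : (A * mono f 0).co p =
    lsum fun j : ℕ => (Ring.choose (p + j) j : ℤ) • (A.co (p + j) * dx^[j] f) := by
  rw [co_mul, ← lsum_injective (e := fun j : ℕ => ((p + j, j) : ℤ × ℕ))
    (fun a b h => (Prod.ext_iff.1 h).2)]
  · refine lsum_congr fun j => ?_
    simp [co_mono]
  · rintro ⟨q, j⟩ h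
    have : p - q + j ≠ 0 := fun h' => h ⟨j, by ext <;> dsimp only; omega⟩
    simp [co_mono, this, dxi_zero]

theorem co_mul_D (A : Op K) (n p : ℤ) : (A * mono 1 n).co p = A.co (p - n) := by
  rw [co_mul, lsum_eq_single _ ((p - n, 0) : ℤ × ℕ)]
  · simp [co_mono]
  · rintro ⟨q, j⟩ h
    by_cases hj : j = 0
    · subst hj
      have : p - q ≠ n := fun h' => h (by ext <;> dsimp only; omega)
      simp [co_mono, this]
    · simp only [co_mono]
      split_ifs
      · rw [dxi_one j hj, mul_zero, smul_zero]
      · rw [dxi_zero, mul_zero, smul_zero]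

theorem co_fn_mul (f : Fn K) (B : Op K) (p : ℤ) : (mono f 0 * B).co p = f * B.co p := by
  rw [co_mono_mul, lsum_eq_single _ 0]
  · simp
  · intro j hj
    rw [Ring.choose_zero_pos _ (Nat.pos_of_ne_zero hj), zero_smul]

theorem left_distrib' (A B C : Op K) : A * (B + C) = A * B + A * C := by
  ext1 p
  rw [co_add, co_mul, co_mul, co_mul, ← lsum_add (locFin_mul A B p) (locFin_mul A C p)]
  exact lsum_congr fun q => by rw [co_add, dxi_add, mul_add, smul_add]

theorem right_distrib' (A B C : Op K) : (A + B) * C = A * C + B * C := by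
  ext1 p
  rw [co_add, co_mul, co_mul, co_mul, ← lsum_add (locFin_mul A C p) (locFin_mul B C p)]
  exact lsum_congr fun q => by rw [co_add, add_mul, smul_add]

instance : Ring (Op K) :=
  { (inferInstance : AddCommGroup (Op K)) with
    mul := (· * ·)
    one := 1
    left_distrib := left_distrib'
    right_distrib := right_distrib'
    zero_mul := fun a => by simpa using right_distrib' 0 0 a
    mul_zero := fun a => by simpa using left_distrib' a 0 0
    mul_assoc := fun A B C => Subtype.ext (PDO.mul_assoc_of_adm A.2 B.2 C.2)
    one_mul := fun A => ext fun p => (co_fn_mul 1 A p).trans (one_mul _)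
    mul_one := fun A => ext fun p => (co_mul_D A 0 p).trans (by rw [sub_zero]) }

instance : Algebra ℚ (Op K) := Algebra.ofModule
  (fun c A B => ext fun p => by
    rw [co_smul, co_mul, co_mul, ← lsum_qsmul_left (locFin_mul A B p)]
    exact lsum_congr fun q => by rw [co_smul, smul_mul_assoc, smul_comm])
  (fun c A B => ext fun p => by
    rw [co_smul, co_mul, co_mul, ← lsum_qsmul_left (locFin_mul A B p)]
    exact lsum_congr fun q => by rw [co_smul, dxi_qsmul, mul_smul_comm, smul_comm])

/-- Multiplication by a function. -/
def fn : Fn K →+* Op K where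
  toFun f := mono f 0
  map_one' := rfl
  map_mul' f g := ext fun p => by
    rw [co_fn_mul, co_mono, co_mono, mul_ite, mul_zero]
  map_zero' := ext fun p => by rw [co_mono, ite_self, co_zero]
  map_add' f g := ext fun p => by
    rw [co_add, co_mono, co_mono, co_mono]
    split_ifs <;> simp

/-- The operator `D^n`. -/
def D (n : ℤ) : Op K := mono 1 n

theorem co_fn (f : Fn K) (p : ℤ) : (fn f).co p = if p = 0 then f else 0 := rfl
theorem co_D (n p : ℤ) : (D n : Op K).co p = if p = n then 1 else 0 := rfl
theorem co_one (p : ℤ) : (1 : Op K).co p = if p = 0 then 1 else 0 := rfl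
@[simp] theorem co_fn_mul' (f : Fn K) (B : Op K) (p : ℤ) : (fn f * B).co p = f * B.co p :=
  co_fn_mul f B p
@[simp] theorem co_mul_D' (A : Op K) (n p : ℤ) : (A * D n).co p = A.co (p - n) := co_mul_D A n p

theorem D_mul_D (m n : ℤ) : (D m * D n : Op K) = D (m + n) := ext fun p => by
  rw [co_mul_D', co_D, co_D]
  exact if_congr (by omega) rfl rfl

theorem D_zero : (D 0 : Op K) = 1 := rfl

theorem fn_smul (c : ℚ) (f : Fn K) : fn (c • f) = c • fn f := map_rat_smul fn c f

/-- The derivative of all coefficients with respect to `t_n`. -/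
def dt (n : ℕ+) : Op K →ₗ[ℚ] Op K where
  toFun A := ⟨A.1.dt n, fun d => by
    obtain ⟨a, ha⟩ := A.2 (d + Finsupp.single n 1)
    exact ⟨a, fun p hp => dt_mem_van n (ha p hp)⟩⟩
  map_add' A B := ext fun p => dt_add n _ _
  map_smul' c A := ext fun p => dt_qsmul n c _

@[simp] theorem co_dt (n : ℕ+) (A : Op K) (p : ℤ) : (dt n A).co p = CKP.dt n (A.co p) := rfl

theorem dt_mul (n : ℕ+) (A B : Op K) : dt n (A * B) = dt n A * B + A * dt n B := by
  ext1 p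
  rw [co_add, co_dt, co_mul, co_mul, co_mul, ← lsum_dt (locFin_mul A B p),
    ← lsum_add (locFin_mul _ B p) (locFin_mul A _ p)]
  refine lsum_congr fun q => ?_
  rw [dt_zsmul, CKP.dt_mul, smul_add, dt_dxi]
  rfl

theorem dt_fn (n : ℕ+) (f : Fn K) : dt n (fn f) = fn (CKP.dt n f) := ext fun p => by
  rw [co_dt, co_fn, co_fn]
  split_ifs
  · rfl
  · exact dt_zero n

theorem dt_D (n : ℕ+) (k : ℤ) : dt n (D k : Op K) = 0 := ext fun p => by
  rw [co_dt, co_D, co_zero]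
  split_ifs
  · exact dt_one n
  · exact dt_zero n

theorem D_one_mul (A : Op K) : D 1 * A = A * D 1 + dt 1 A := ext fun p => by
  rw [D, co_mono_mul, co_add, co_mul_D, lsum_eq_sum _ (Finset.range 2)]
  · simp [Finset.sum_range_succ, dx]
  · intro j hj
    rw [Finset.mem_range, not_lt] at hj
    rw [show (1 : ℤ) = ((1 : ℕ) : ℤ) from rfl, Ring.choose_natCast,
      Nat.choose_eq_zero_of_lt (by omega), Nat.cast_zero, zero_smul]

/-! ### Orders -/

/-- The order of `A` is at most `a`. -/
def Le (A : Op K) (a : ℤ) : Prop := ∀ p, a < p → A.co p = 0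

/-- `A` is a (possibly infinite) differential operator. -/
def IsPlus (A : Op K) : Prop := ∀ p, p < 0 → A.co p = 0

theorem Le.mono {A : Op K} {a b : ℤ} (h : A.Le a) (hab : a ≤ b) : A.Le b :=
  fun p hp => h p (lt_of_le_of_lt hab hp)
theorem Le.sub {A B : Op K} {a : ℤ} (hA : A.Le a) (hB : B.Le a) : (A - B).Le a :=
  fun p hp => by rw [co_sub, hA p hp, hB p hp, sub_zero]
theorem Le.neg {A : Op K} {a : ℤ} (hA : A.Le a) : (-A).Le a :=
  fun p hp => by rw [co_neg, hA p hp, neg_zero]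
theorem Le.smul {A : Op K} {a : ℤ} (hA : A.Le a) (c : ℚ) : (c • A).Le a :=
  fun p hp => by rw [co_smul, hA p hp, smul_zero]
theorem Le.sum {s : Finset ι} {A : ι → Op K} {a : ℤ} (hA : ∀ i ∈ s, (A i).Le a) :
    (∑ i ∈ s, A i).Le a :=
  fun p hp => by rw [co_sum]; exact Finset.sum_eq_zero fun i hi => hA i hi p hp
theorem le_fn (f : Fn K) : (fn f).Le 0 := fun p hp => by rw [co_fn, if_neg hp.ne']
theorem le_D (n : ℤ) : (D n : Op K).Le n := fun p hp => by rw [co_D, if_neg hp.ne']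

theorem Le.mul {A B : Op K} {a b : ℤ} (hA : A.Le a) (hB : B.Le b) : (A * B).Le (a + b) :=
  fun p hp => by
    rw [co_mul, ← lsum_zero (K := K) (ι := ℤ × ℕ)]
    refine lsum_congr fun q => ?_
    by_cases h : a < q.1
    · rw [hA _ h, zero_mul, smul_zero]
    · rw [hB _ (by omega), dxi_zero, mul_zero, smul_zero]

theorem co_mul_top {A B : Op K} {a b : ℤ} (hA : A.Le a) (hB : B.Le b) :
    (A * B).co (a + b) = A.co a * B.co b := by
  rw [co_mul, lsum_eq_single _ ((a, 0) : ℤ × ℕ)]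
  · simp
  · rintro ⟨q, j⟩ h
    by_cases h1 : a < q
    · rw [hA _ h1, zero_mul, smul_zero]
    · rw [hB _ ?_, dxi_zero, mul_zero, smul_zero]
      by_contra h2
      exact h (by ext <;> dsimp only at * <;> omega)

theorem IsPlus.sub {A B : Op K} (hA : A.IsPlus) (hB : B.IsPlus) : (A - B).IsPlus :=
  fun p hp => by rw [co_sub, hA p hp, hB p hp, sub_zero]
theorem isPlus_fn (f : Fn K) : (fn f).IsPlus := fun p hp => by rw [co_fn, if_neg hp.ne]
theorem isPlus_D {n : ℤ} (hn : 0 ≤ n) : (D n : Op K).IsPlus :=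
  fun p hp => by rw [co_D, if_neg (by omega)]

/-- For n ≥ 0 the Leibniz expansion of D^n stops at j = n because choose(n, j) = 0 beyond, so no
negative power of D appears. -/
theorem IsPlus.mul {A B : Op K} (hA : A.IsPlus) (hB : B.IsPlus) : (A * B).IsPlus :=
  fun p hp => by
    rw [co_mul, ← lsum_zero (K := K) (ι := ℤ × ℕ)]
    refine lsum_congr fun q => ?_
    by_cases h : q.1 < 0
    · rw [hA _ h, zero_mul, smul_zero]
    · by_cases h' : p - q.1 + q.2 < 0
      · rw [hB _ h', dxi_zero, mul_zero, smul_zero]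
      · obtain ⟨n, hn⟩ := Int.eq_ofNat_of_zero_le (not_lt.1 h)
        rw [hn, Ring.choose_natCast, Nat.choose_eq_zero_of_lt (by omega), Nat.cast_zero, zero_smul]

/-- The differential part. -/
def plus : Op K →ₗ[ℚ] Op K where
  toFun A := ⟨A.1.plus, fun d => by
    obtain ⟨a, ha⟩ := A.2 d
    refine ⟨a, fun p hp => ?_⟩
    simp only [PDO.plus]
    split_ifs
    · exact ha p hp
    · exact Submodule.zero_mem _⟩
  map_add' A B := ext fun p => by
    change (if 0 ≤ p then A.co p + B.co p else 0) =
      (if 0 ≤ p then A.co p else 0) + (if 0 ≤ p then B.co p else 0)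
    split_ifs <;> simp
  map_smul' c A := ext fun p => by
    change (if 0 ≤ p then c • A.co p else 0) = c • (if 0 ≤ p then A.co p else 0)
    split_ifs <;> simp

/-- The purely pseudo-differential part. -/
def minus : Op K →ₗ[ℚ] Op K := LinearMap.id - plus

theorem co_plus (A : Op K) (p : ℤ) : (plus A).co p = if 0 ≤ p then A.co p else 0 := rfl

theorem co_minus (A : Op K) (p : ℤ) : (minus A).co p = if p < 0 then A.co p else 0 := by
  change (A - plus A).co p = _
  rw [co_sub, co_plus]
  by_cases h : 0 ≤ p
  · rw [if_pos h, if_neg (by omega), sub_self]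
  · rw [if_neg h, if_pos (by omega), sub_zero]

theorem val_minus (A : Op K) : (minus A).1 = A.1.minus := funext fun p => co_minus A p

theorem plus_add_minus (A : Op K) : plus A + minus A = A := by
  change plus A + (A - plus A) = A
  abel

theorem isPlus_plus (A : Op K) : (plus A).IsPlus := fun p hp => by
  rw [co_plus, if_neg (by omega)]
theorem le_minus (A : Op K) : (minus A).Le (-1) := fun p hp => by
  rw [co_minus, if_neg (by omega)]
theorem plus_of_isPlus {A : Op K} (h : A.IsPlus) : plus A = A := ext fun p => by
  rw [co_plus]
  split_ifs with hp
  · rfl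
  · exact (h p (by omega)).symm
theorem plus_of_le {A : Op K} (h : A.Le (-1)) : plus A = 0 := ext fun p => by
  rw [co_plus, co_zero]
  split_ifs with hp
  · exact h p (by omega)
  · rfl
theorem minus_of_isPlus {A : Op K} (h : A.IsPlus) : minus A = 0 := by
  change A - plus A = 0
  rw [plus_of_isPlus h, sub_self]
theorem minus_of_le {A : Op K} (h : A.Le (-1)) : minus A = A := by
  change A - plus A = A
  rw [plus_of_le h, sub_zero]
theorem plus_dt (n : ℕ+) (A : Op K) : plus (dt n A) = dt n (plus A) := ext fun p => by
  rw [co_plus, co_dt, co_dt, co_plus]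
  split_ifs
  · rfl
  · rw [dt_zero]
theorem minus_dt (n : ℕ+) (A : Op K) : minus (dt n A) = dt n (minus A) := by
  change dt n A - plus (dt n A) = dt n (A - plus A)
  rw [plus_dt, map_sub]

end Op

end CKP

end

/-! ### Residues, the actions A₊(f) and A₊^*(g), and the concomitant as a residue. -/

noncomputable section

namespace CKP

variable {K : Type*} [CommRing K] [Algebra ℚ K] {ι κ : Type*}

open MvPowerSeries Finset.HasAntidiagonal

namespace Op

/-! ### The residue -/

/-- The residue, i.e. the coefficient of `D⁻¹`. -/
def res : Op K →ₗ[ℚ] Fn K := coHom (-1)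

theorem res_eq (A : Op K) : res A = A.co (-1) := rfl

theorem res_fn_mul (f : Fn K) (A : Op K) : res (fn f * A) = f * res A := co_fn_mul' f A (-1)

/-- The terms with j > 0 derivatives of f carry the factor choose(j - 1, j) = 0. -/
theorem res_mul_fn (A : Op K) (f : Fn K) : res (A * fn f) = res A * f := by
  rw [res_eq]
  refine (co_mul_mono_zero A f (-1)).trans ?_
  rw [lsum_eq_single _ 0]
  · simp [res_eq]
  · intro j hj
    obtain ⟨j, rfl⟩ := Nat.exists_eq_succ_of_ne_zero hj
    rw [show (-1 + ((j + 1 : ℕ) : ℤ)) = (j : ℤ) by push_cast; ring, Ring.choose_natCast,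
      Nat.choose_eq_zero_of_lt (by omega), Nat.cast_zero, zero_smul]

theorem res_of_isPlus {A : Op K} (h : A.IsPlus) : res A = 0 := h _ (by norm_num)
theorem res_of_le {A : Op K} (h : A.Le (-2)) : res A = 0 := h _ (by norm_num)

theorem res_mul_D (A : Op K) : res (A * D (-1)) = A.co 0 := by
  rw [res_eq, co_mul_D']
  rfl

theorem D_one_mul_fn (f : Fn K) : D 1 * fn f = fn f * D 1 + fn (dx f) := by
  rw [D_one_mul, dt_fn]
  rfl

theorem D_one_mul_D : (D 1 * D (-1) : Op K) = 1 := D_mul_D 1 (-1)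
theorem D_mul_D_one : (D (-1) * D 1 : Op K) = 1 := D_mul_D (-1) 1

/-- The decomposition of the residue of a product. -/
theorem res_split (X Y : Op K) : res (X * Y) = res (X * minus Y) + res (minus X * Y) := by
  have h1 : res (plus X * plus Y) = 0 := res_of_isPlus ((isPlus_plus X).mul (isPlus_plus Y))
  have h2 : res (minus X * minus Y) = 0 := res_of_le ((le_minus X).mul (le_minus Y))
  have hX := (plus_add_minus X).symm
  have hY := (plus_add_minus Y).symm
  generalize plus X = a at *
  generalize minus X = b at *
  generalize plus Y = c at *
  generalize minus Y = d at *
  subst hX hY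
  simp only [map_add, add_mul, mul_add, h1, h2]
  abel

/-! ### Actions on functions -/

/-- The action of the differential part of `A` on functions. -/
def act (A : Op K) (f : Fn K) : Fn K := (A * fn f).co 0

/-- The action of the formal adjoint of the differential part of `A` on functions. -/
def adj (A : Op K) (g : Fn K) : Fn K := res (D (-1) * fn g * A)

theorem act_eq (A : Op K) (f : Fn K) :
    act A f = lsum fun n : ℕ => A.co n * dx^[n] f := by
  refine (co_mul_mono_zero A f 0).trans (lsum_congr fun n => ?_)
  rw [zero_add, Ring.choose_natCast, Nat.choose_self, Nat.cast_one, one_smul]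

theorem res_D_mul (A : Op K) : res (D (-1) * A) = lsum fun n : ℕ => (-1) ^ n * dx^[n] (A.co n) := by
  rw [res_eq]
  refine (co_mono_mul 1 (-1) A (-1)).trans (lsum_congr fun n => ?_)
  rw [Ring.choose_neg, show (1 + (n : ℤ) - 1) = n by ring, Ring.choose_natCast, Nat.choose_self]
  simp [Int.negOnePow_def, Units.smul_def, zsmul_eq_mul]

theorem locFin_res_D_mul (A : Op K) : LocFin fun n : ℕ => (-1) ^ n * dx^[n] (A.co n) := by
  refine locFin_of_van fun d => ?_
  obtain ⟨a, ha⟩ := A.2 d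
  refine (Set.finite_Iic a.toNat).subset fun n hn => ?_
  by_contra h
  exact hn (Ideal.mul_mem_left _ _ (dxi_mem_van (ha _ (by simp at h; omega)) _))

theorem adj_eq (A : Op K) (g : Fn K) :
    adj A g = lsum fun n : ℕ => (-1) ^ n * dx^[n] (A.co n * g) := by
  rw [adj, mul_assoc, res_D_mul]
  exact lsum_congr fun n => by rw [co_fn_mul', mul_comm g]

theorem act_val (A : Op K) (f : Fn K) : PDO.plusApply A.1 f = act A f := (act_eq A f).symm
theorem adj_val (A : Op K) (g : Fn K) : PDO.plusAdjApply A.1 g = adj A g := (adj_eq A g).symm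

/-- B f is a differential operator, so after right multiplication by D⁻¹ only its constant term B(f)
lands in a negative power. -/
theorem minus_mul_fn_mul_D {B : Op K} (hB : B.IsPlus) (f : Fn K) :
    minus (B * fn f * D (-1)) = fn (act B f) * D (-1) := ext fun p => by
  rw [co_minus, co_mul_D', co_mul_D', co_fn]
  by_cases hp : p < 0
  · rw [if_pos hp]
    by_cases h1 : p = -1
    · subst h1; rfl
    · rw [if_neg (by omega)]
      exact hB.mul (isPlus_fn f) _ (by omega)
  · rw [if_neg hp, if_neg (by omega)]

/-- Division with remainder: B = D Q + b with Q differential and b a function, so (D⁻¹ B)₋ = D⁻¹ b.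
In coefficients, both sides have (-1)^k ∂^k ∑ (-1)^n ∂^n b_n at D^(-1-k). -/
theorem minus_D_mul {B : Op K} (hB : B.IsPlus) : minus (D (-1) * B) =
    D (-1) * fn (res (D (-1) * B)) :=
  ext fun p => by
    rw [co_minus]
    by_cases hp : p < 0
    · rw [if_pos hp]
      obtain ⟨k, hk⟩ := Int.eq_ofNat_of_zero_le (show 0 ≤ -1 - p by omega)
      obtain rfl : p = -1 - k := by omega
      have e1 := co_mono_mul 1 (-1) B (-1 - k)
      have e2 := co_mono_mul 1 (-1) (fn (res (D (-1) * B))) (-1 - k)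
      change (D (-1) * B).co (-1 - k) = _ at e1
      change (D (-1) * fn (res (D (-1) * B))).co (-1 - k) = _ at e2
      rw [e1, e2, lsum_eq_single (fun j : ℕ => (Ring.choose (-1 : ℤ) j : ℤ) •
        (1 * dx^[j] ((fn (res (D (-1) * B))).co (-1 - k - -1 + j)))) k,
        ← lsum_injective (add_left_injective k)]
      · rw [co_fn, if_pos (by ring), one_mul, res_D_mul,
          ← (lsum_dx_iterate (locFin_res_D_mul B) k).2,
          ← lsum_zsmul_left (lsum_dx_iterate (locFin_res_D_mul B) k).1]
        refine lsum_congr fun n => ?_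
        have hc : ∀ n : ℕ, Ring.choose (-1 : ℤ) n = (-1) ^ n := fun n => by
          rw [Ring.choose_neg, show (1 + (n : ℤ) - 1) = n by ring, Ring.choose_natCast,
            Nat.choose_self]
          simp [Int.negOnePow_def, Units.smul_def]
        rw [hc, hc, show -1 - (k : ℤ) - -1 + ((n + k : ℕ) : ℤ) = n by push_cast; ring, one_mul,
          show ((-1 : Fn K) ^ n * dx^[n] (B.co n)) = ((-1 : ℤ) ^ n) • dx^[n] (B.co n) by
            rw [zsmul_eq_mul]; push_cast; rfl, dxi_zsmul, smul_smul, ← pow_add, add_comm k n,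
          add_comm n k, Function.iterate_add_apply]
      · intro i hi
        rw [hB _ ?_, dxi_zero, mul_zero, smul_zero]
        by_contra h
        exact hi ⟨i - k, by dsimp only; omega⟩
      · intro i hi
        rw [co_fn, if_neg (by omega), dxi_zero, mul_zero, smul_zero]
    · rw [if_neg hp]
      exact (((le_D (-1)).mul (le_fn _)) p (by omega)).symm

theorem minus_D_mul_fn_mul {B : Op K} (hB : B.IsPlus) (g : Fn K) :
    minus (D (-1) * fn g * B) = D (-1) * fn (adj B g) := by
  rw [mul_assoc, minus_D_mul ((isPlus_fn g).mul hB), adj, mul_assoc]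

/-! ### The bilinear concomitant -/

theorem co_mul_eq_lsum (A B : Op K) (p : ℤ) :
    (A * B).co p = lsum fun n : ℤ => (mono (A.co n) n * B).co p := by
  rw [co_mul, (lsum_prod (locFin_mul A B p)).2]
  refine lsum_congr fun n => ?_
  rw [co_mono_mul]

theorem act_D (n : ℕ) (f : Fn K) : act (D n) f = dx^[n] f := by
  rw [act_eq, lsum_eq_single _ n]
  · simp [co_D]
  · intro k hk
    rw [co_D, if_neg (by exact_mod_cast hk), zero_mul]

theorem D_mul_fn_mul_D (h : Fn K) :
    D (-1) * fn h * D 1 = fn h - D (-1) * fn (dx h) := by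
  have := congrArg (D (-1) * ·) (D_one_mul_fn h)
  simp only [mul_add, ← mul_assoc, D_mul_D_one, one_mul] at this
  rw [eq_sub_iff_add_eq]
  exact this.symm

/-- Repeated integration by parts: D⁻¹ h D = h - D⁻¹ h' moves one D at a time across D⁻¹, each step
emitting one term of the concomitant. -/
theorem res_concomitant (n : ℕ) (h f : Fn K) : res (D (-1) * fn h * D n * (fn f * D (-1))) =
    ∑ i ∈ Finset.range n, (-1) ^ i * dx^[i] h * dx^[n - 1 - i] f := by
  induction n generalizing h with
  | zero =>
    rw [Finset.range_zero, Finset.sum_empty]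
    rw [Nat.cast_zero, D_zero, mul_one]
    exact res_of_le ((((le_D (-1)).mul (le_fn h)).mul ((le_fn f).mul (le_D (-1)))))
  | succ n ih =>
    rw [show ((n + 1 : ℕ) : ℤ) = 1 + n by push_cast; ring, ← D_mul_D, ← mul_assoc (D (-1) * fn h),
      D_mul_fn_mul_D,      sub_mul, sub_mul, map_sub, ih, Finset.sum_range_succ']
    have : res (fn h * D n * (fn f * D (-1))) = h * dx^[n] f := by
      rw [mul_assoc, res_fn_mul, ← mul_assoc, res_mul_D, ← act_D]
      rfl
    rw [this, sub_eq_neg_add, ← Finset.sum_neg_distrib]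
    congr 1
    · refine Finset.sum_congr rfl fun i hi => ?_
      rw [Function.iterate_succ_apply, pow_succ, show n + 1 - 1 - (i + 1) = n - 1 - i by omega]
      ring
    · simp

/-- This reduces to `res_concomitant` by expanding A into its terms a_n D^n. Since A may have
infinitely many positive powers, the interchange of summations needs local finiteness; negative
powers contribute nothing, for reasons of order. -/
theorem concomitant_val (A : Op K) (f g : Fn K) :
    PDO.concomitant A.1 f g = res (D (-1) * fn g * A * (fn f * D (-1))) := by
  set R : Op K := fn f * D (-1) with hR
  have hRle : R.Le (-1) := (le_fn f).mul (le_D (-1))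
  have hle : ∀ n : ℤ, (mono (A.co n) n * R).Le (n - 1) := fun n =>
    Le.mul (a := n) (fun p hp => by rw [co_mono, if_neg hp.ne']) hRle
  have hloc : LocFin fun x : ℤ × ℕ =>
      (-1) ^ x.2 * dx^[x.2] (g * (mono (A.co x.1) x.1 * R).co x.2) := by
    refine locFin_of_van fun d => ?_
    obtain ⟨a, ha⟩ := A.2 d
    refine ((Set.finite_Icc 0 a).prod (Set.finite_Iic a.toNat)).subset ?_
    rintro ⟨n, j⟩ hx
    simp only [Set.mem_ofPred_eq] at hx
    have h1 : n ≤ a := by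
      by_contra h
      refine hx (Ideal.mul_mem_left _ _ (dxi_mem_van (Ideal.mul_mem_left _ _ ?_) _))
      rw [co_mono_mul]
      exact lsum_mem_van fun i => Submodule.smul_of_tower_mem _ _
        (Ideal.mul_mem_right _ _ (ha _ (not_le.1 h)))
    have h2 : (j : ℤ) ≤ n - 1 := by
      by_contra h
      refine hx ?_
      rw [hle n _ (not_le.1 h), mul_zero, dxi_zero, mul_zero]
      exact Submodule.zero_mem _
    simp only [Set.mem_prod, Set.mem_Icc, Set.mem_Iic]
    omega
  have hzero : ∀ n : ℤ, n < 0 → (lsum fun j : ℕ =>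
      (-1) ^ j * dx^[j] (g * (mono (A.co n) n * R).co j)) = 0 := fun n hn => by
    rw [← lsum_zero (K := K) (ι := ℕ)]
    refine lsum_congr fun j => ?_
    rw [hle n _ (by omega), mul_zero, dxi_zero, mul_zero]
  have hswap := (lsum_prod (hloc.comp_injective (Prod.swap_injective (α := ℕ) (β := ℤ)))).2
  rw [show (lsum fun i : ℕ × ℤ => (-1) ^ (i.swap).2 * dx^[(i.swap).2]
    (g * (mono (A.co (i.swap).1) (i.swap).1 * R).co (i.swap).2)) = _ from
    lsum_equiv (Equiv.prodComm ℕ ℤ) fun x : ℤ × ℕ => (-1) ^ x.2 * dx^[x.2]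
      (g * (mono (A.co x.1) x.1 * R).co x.2), (lsum_prod hloc).2] at hswap
  have hA : ∀ j : ℕ, LocFin fun n : ℤ => (mono (A.co n) n * R).co j := fun j => by
    have := (lsum_prod (locFin_mul A R j)).1
    refine this.mono fun d n h => ?_
    rw [co_mono_mul]
    exact h
  have key : res (D (-1) * fn g * A * R) = lsum fun n : ℤ => lsum fun j : ℕ =>
      (-1) ^ j * dx^[j] (g * (mono (A.co n) n * R).co j) := by
    rw [hswap, mul_assoc, mul_assoc, res_D_mul]
    refine lsum_congr fun j => ?_
    have h1 := (hA j).mul_left g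
    have h2 := lsum_dx_iterate h1 j
    rw [co_fn_mul', co_mul_eq_lsum, ← lsum_mul_left (hA j), ← h2.2, ← lsum_mul_left h2.1]
    rfl
  rw [key, PDO.concomitant, ← lsum_injective (e := fun n : ℕ => (n : ℤ)) Nat.cast_injective]
  · refine lsum_congr fun n => ?_
    have := res_concomitant n (A.co n * g) f
    change _ = _ at this
    simp only [val_apply]
    rw [← this, show D (-1) * fn (A.co n * g) * D n * (fn f * D (-1)) =
      D (-1) * (fn g * (mono (A.co n) n * R)) by
        rw [show (mono (A.co n) n : Op K) = fn (A.co n) * D n from ext fun p => by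
          rw [co_fn_mul', co_mono, co_D]; split_ifs <;> simp]
        rw [mul_comm (A.co n), map_mul, hR]
        simp only [mul_assoc], res_D_mul]
    exact lsum_congr fun j => by rw [co_fn_mul']
  · intro n hn
    refine hzero n ?_
    by_contra h
    exact hn ⟨n.toNat, by dsimp only; omega⟩

end Op

end CKP

end

/-! ### Operators f D⁻¹ g and the pairing that unifies the three actions. -/

noncomputable section

namespace CKP

variable {K : Type*} [CommRing K] [Algebra ℚ K] {ι κ : Type*}

namespace Op

/-- The operator `f D⁻¹ g`. -/
def ghost (f g : Fn K) : Op K := fn f * D (-1) * fn g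

theorem ghost_add_left (f f' g : Fn K) : ghost (f + f') g = ghost f g + ghost f' g := by
  simp only [ghost, map_add, add_mul]
theorem ghost_add_right (f g g' : Fn K) : ghost f (g + g') = ghost f g + ghost f g' := by
  simp only [ghost, map_add, mul_add]
theorem ghost_sub_left (f f' g : Fn K) : ghost (f - f') g = ghost f g - ghost f' g := by
  simp only [ghost, map_sub, sub_mul]
theorem ghost_neg_right (f g : Fn K) : ghost f (-g) = -ghost f g := by
  simp only [ghost, map_neg, mul_neg]
theorem ghost_smul_left (c : ℚ) (f g : Fn K) : ghost (c • f) g = c • ghost f g := by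
  simp only [ghost, fn_smul, smul_mul_assoc]
theorem ghost_smul_right (c : ℚ) (f g : Fn K) : ghost f (c • g) = c • ghost f g := by
  simp only [ghost, fn_smul, mul_smul_comm]
theorem ghost_sum_left (s : Finset ι) (f : ι → Fn K) (g : Fn K) :
    ghost (∑ i ∈ s, f i) g = ∑ i ∈ s, ghost (f i) g := by
  simp only [ghost, map_sum, Finset.sum_mul]
theorem ghost_sum_right (s : Finset ι) (f : Fn K) (g : ι → Fn K) :
    ghost f (∑ i ∈ s, g i) = ∑ i ∈ s, ghost f (g i) := by
  simp only [ghost, map_sum, Finset.mul_sum]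

theorem ghost_le (f g : Fn K) : (ghost f g).Le (-1) := ((le_fn f).mul (le_D (-1))).mul (le_fn g)

theorem plus_mul_fn (A : Op K) (f : Fn K) : plus (A * fn f) = plus A * fn f := by
  conv_lhs => rw [← plus_add_minus A, add_mul, map_add]
  rw [plus_of_isPlus ((isPlus_plus A).mul (isPlus_fn f)),
    plus_of_le ((le_minus A).mul (le_fn f)), add_zero]

theorem plus_fn_mul (A : Op K) (f : Fn K) : plus (fn f * A) = fn f * plus A := by
  conv_lhs => rw [← plus_add_minus A, mul_add, map_add]
  rw [plus_of_isPlus ((isPlus_fn f).mul (isPlus_plus A)),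
    plus_of_le ((le_fn f).mul (le_minus A)), add_zero]

theorem plus_eq_sub (A : Op K) : plus A = A - minus A := by
  conv_rhs => enter [1]; rw [← plus_add_minus A]
  rw [add_sub_cancel_right]

theorem minus_eq_sub (A : Op K) : minus A = A - plus A := rfl

theorem plus_mul_ghost {B : Op K} (hB : B.IsPlus) (u v : Fn K) :
    plus (B * ghost u v) = (B * fn u * D (-1) - fn (act B u) * D (-1)) * fn v := by
  rw [ghost, ← mul_assoc, plus_mul_fn, ← mul_assoc, plus_eq_sub, minus_mul_fn_mul_D hB]

theorem plus_ghost_mul {B : Op K} (hB : B.IsPlus) (u v : Fn K) :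
    plus (ghost u v * B) = fn u * (D (-1) * fn v * B - D (-1) * fn (adj B v)) := by
  rw [ghost, mul_assoc, mul_assoc, plus_fn_mul, ← mul_assoc, plus_eq_sub, minus_D_mul_fn_mul hB]

theorem minus_mul_ghost {B : Op K} (hB : B.IsPlus) (u v : Fn K) :
    minus (B * ghost u v) = ghost (act B u) v := by
  rw [minus_eq_sub, plus_mul_ghost hB, ghost, ghost, sub_mul]
  simp only [← mul_assoc]
  abel

theorem minus_ghost_mul {B : Op K} (hB : B.IsPlus) (u v : Fn K) :
    minus (ghost u v * B) = ghost u (adj B v) := by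
  rw [minus_eq_sub, plus_ghost_mul hB, ghost, ghost, mul_sub]
  simp only [← mul_assoc]
  abel

theorem fn_mul_D_sub (s : Fn K) :
    fn s * D (-1) - D (-1) * fn s = D (-1) * fn (dx s) * D (-1) := by
  rw [eq_sub_of_add_eq' (D_one_mul_fn s).symm, mul_sub, sub_mul, ← mul_assoc, D_mul_D_one, one_mul,
    mul_assoc, mul_assoc, D_one_mul_D, mul_one]

/-- The product of two operators `u D⁻¹ v`, in terms of an antiderivative of `v u'`. -/
theorem ghost_mul_ghost (u v u' v' s : Fn K) (hs : dx s = v * u') :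
    ghost u v * ghost u' v' = ghost (u * s) v' - ghost u (s * v') := by
  have h : fn v * fn u' = D 1 * fn s - fn s * D 1 := by
    rw [← map_mul, ← hs, D_one_mul_fn]
    abel
  have : ghost u v * ghost u' v' = fn u * D (-1) * (fn v * fn u') * D (-1) * fn v' := by
    simp only [ghost, mul_assoc]
  rw [this, h, mul_sub, ← mul_assoc, mul_assoc (fn u) (D (-1)) (D 1), D_mul_D_one, mul_one,
    sub_mul, sub_mul, mul_assoc (fn u * D (-1)) (fn s * D 1), mul_assoc (fn s), D_one_mul_D,
    mul_one, ghost, ghost, map_mul, map_mul]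
  simp only [← mul_assoc]

/-! ### The pairing -/

/-- Right vectors: a function `f`, or the formal symbol `none`. -/
def rv : Option (Fn K) → Op K
  | none => 1
  | some f => fn f * D (-1)

/-- Left vectors: a function `g`, or the formal symbol `none`. -/
def lv : Option (Fn K) → Op K
  | none => 1
  | some g => D (-1) * fn g

/-- The pairing which unifies `A(f)`, `A^*(g)` and the bilinear concomitant. -/
def om (A : Op K) (α β : Option (Fn K)) : Fn K := res (lv β * A * rv α)

theorem om_none_right (A : Op K) (f : Fn K) : om A (some f) none = act A f := by
  rw [om, rv, lv, one_mul, ← mul_assoc, res_mul_D, act]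

theorem om_none_left (A : Op K) (g : Fn K) : om A none (some g) = adj A g := by
  rw [om, rv, lv, mul_one, adj]

theorem om_some (A : Op K) (f g : Fn K) : om A (some f) (some g) = PDO.concomitant A.1 f g :=
  (concomitant_val A f g).symm

/-- `om` as a linear map in the operator. -/
def omHom (α β : Option (Fn K)) : Op K →ₗ[ℚ] Fn K where
  toFun A := om A α β
  map_add' A B := by simp only [om, mul_add, add_mul, map_add]
  map_smul' c A := by simp only [om, mul_smul_comm, smul_mul_assoc, map_smul, RingHom.id_apply]

theorem om_add (A B : Op K) (α β : Option (Fn K)) : om (A + B) α β = om A α β + om B α β :=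
  map_add (omHom α β) A B
theorem om_sub (A B : Op K) (α β : Option (Fn K)) : om (A - B) α β = om A α β - om B α β :=
  map_sub (omHom α β) A B
theorem om_zero (α β : Option (Fn K)) : om (0 : Op K) α β = 0 := map_zero (omHom α β)
theorem om_sum (s : Finset ι) (A : ι → Op K) (α β : Option (Fn K)) :
    om (∑ i ∈ s, A i) α β = ∑ i ∈ s, om (A i) α β := map_sum (omHom α β) A s

/-- `om` as a linear map in the right vector. -/
def omR (A : Op K) (β : Option (Fn K)) : Fn K →ₗ[ℚ] Fn K where
  toFun f := om A (some f) β
  map_add' f g := by simp only [om, rv, map_add, mul_add, add_mul]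
  map_smul' c f := by
    simp only [om, rv, fn_smul, mul_smul_comm, smul_mul_assoc, map_smul, RingHom.id_apply]

/-- `om` as a linear map in the left vector. -/
def omL (A : Op K) (α : Option (Fn K)) : Fn K →ₗ[ℚ] Fn K where
  toFun f := om A α (some f)
  map_add' f g := by simp only [om, lv, map_add, mul_add, add_mul]
  map_smul' c f := by
    simp only [om, lv, fn_smul, mul_smul_comm, smul_mul_assoc, map_smul, RingHom.id_apply]

theorem omR_apply (A : Op K) (β : Option (Fn K)) (f : Fn K) : omR A β f = om A (some f) β := rfl
theorem omL_apply (A : Op K) (α : Option (Fn K)) (f : Fn K) : omL A α f = om A α (some f) := rfl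

theorem rv_le (α : Option (Fn K)) : (rv α).Le 0 := by
  cases α with
  | none => exact le_D 0
  | some f => exact ((le_fn f).mul (le_D (-1))).mono (by norm_num)

theorem lv_le (α : Option (Fn K)) : (lv α).Le 0 := by
  cases α with
  | none => exact le_D 0
  | some f => exact ((le_D (-1)).mul (le_fn f)).mono (by norm_num)

/-- A genuine vector contributes order -1, so the product has order at most -2 and no residue. With
two formal symbols the pairing is `res A`, which need not vanish; hence the condition `h`
throughout. -/
theorem om_of_le {A : Op K} (hA : A.Le (-1)) {α β : Option (Fn K)} (h : α ≠ none ∨ β ≠ none) :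
    om A α β = 0 := by
  refine res_of_le ?_
  rcases h with h | h
  · obtain ⟨f, rfl⟩ := Option.ne_none_iff_exists'.1 h
    exact (((lv_le β).mul hA).mul ((le_fn f).mul (le_D (-1)))).mono (by norm_num)
  · obtain ⟨f, rfl⟩ := Option.ne_none_iff_exists'.1 h
    exact ((((le_D (-1)).mul (le_fn f)).mul hA).mul (rv_le α)).mono (by norm_num)

theorem om_plus (A : Op K) {α β : Option (Fn K)} (h : α ≠ none ∨ β ≠ none) :
    om (plus A) α β = om A α β := by
  rw [plus_eq_sub, om_sub, om_of_le (le_minus A) h, sub_zero]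

/-- `s` is an antiderivative of the product of the right vector `α` and `v`. -/
def PotR (α : Option (Fn K)) (v s : Fn K) : Prop :=
  match α with
  | none => s = -v
  | some f => dx s = f * v

/-- `t` is an antiderivative of the product of `u` and the left vector `β`. -/
def PotL (u : Fn K) (β : Option (Fn K)) (t : Fn K) : Prop :=
  match β with
  | none => t = u
  | some g => dx t = u * g

/-- `A(f) + x`, and `0` on the formal symbol. -/
def nxtR (A : Op K) (α : Option (Fn K)) (x : Fn K) : Fn K :=
  match α with
  | none => 0
  | some f => act A f + x

/-- `A^*(g) - x`, and `0` on the formal symbol. -/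
def nxtL (A : Op K) (β : Option (Fn K)) (x : Fn K) : Fn K :=
  match β with
  | none => 0
  | some g => adj A g - x

/-- `x`, and `0` on the formal symbol. -/
def ifSome (α : Option (Fn K)) (x : Fn K) : Fn K :=
  match α with
  | none => 0
  | some _ => x

theorem nxtR_eq (A : Op K) (α : Option (Fn K)) (x : Fn K) :
    nxtR A α x = nxtR A α 0 + ifSome α x := by
  cases α <;> simp [nxtR, ifSome]

theorem nxtL_eq (A : Op K) (β : Option (Fn K)) (x : Fn K) :
    nxtL A β x = nxtL A β 0 - ifSome β x := by
  cases β <;> simp [nxtL, ifSome]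

theorem ifSome_sum {K : Type*} [CommRing K] {ι : Type*} (α : Option (Fn K)) (s : Finset ι)
    (x : ι → Fn K) :
    ifSome α (∑ i ∈ s, x i) = ∑ i ∈ s, ifSome α (x i) := by
  cases α <;> simp [ifSome]

theorem minus_mul_rv {B : Op K} (hB : B.IsPlus) (α : Option (Fn K)) :
    minus (B * rv α) = rv (some (nxtR B α 0)) := by
  cases α with
  | none => simp only [rv, mul_one, minus_of_isPlus hB, nxtR, map_zero, zero_mul]
  | some f => rw [rv, rv, ← mul_assoc, minus_mul_fn_mul_D hB, nxtR, add_zero]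

theorem minus_lv_mul {B : Op K} (hB : B.IsPlus) (β : Option (Fn K)) :
    minus (lv β * B) = lv (some (nxtL B β 0)) := by
  cases β with
  | none => simp only [lv, one_mul, minus_of_isPlus hB, nxtL, map_zero, mul_zero]
  | some f => rw [lv, lv, minus_D_mul_fn_mul hB, nxtL, sub_zero]

/-- Only products of a positive with a negative part have a residue, and the negative parts of B' f
D⁻¹ and D⁻¹ g B are B'(f) D⁻¹ and D⁻¹ B^*(g). -/
theorem om_mul {B B' : Op K} (hB : B.IsPlus) (hB' : B'.IsPlus) (α β : Option (Fn K)) :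
    om (B * B') α β = om B (some (nxtR B' α 0)) β + om B' α (some (nxtL B β 0)) := by
  rw [om, show lv β * (B * B') * rv α = (lv β * B) * (B' * rv α) by simp only [mul_assoc],
    res_split, minus_mul_rv hB', minus_lv_mul hB, om, om]
  simp only [mul_assoc]

/-- With s' = f v one has v f D⁻¹ = s' D⁻¹ = D s D⁻¹ - s. The convention s = -v for the formal
symbol makes the same formula hold there, with the first term absent. -/
theorem fn_mul_rv {α : Option (Fn K)} {v s : Fn K} (hs : PotR α v s) :
    fn v * rv α = D 1 * fn (ifSome α s) * D (-1) - fn s := by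
  cases α with
  | none =>
    have hs : s = -v := hs
    simp [rv, ifSome, hs]
  | some f =>
    have hs : dx s = f * v := hs
    rw [rv, ifSome, D_one_mul_fn, hs, add_mul, mul_assoc (fn s), D_one_mul_D, mul_comm f, map_mul]
    simp only [mul_assoc, mul_one]
    abel

theorem lv_mul_fn {β : Option (Fn K)} {u t : Fn K} (ht : PotL u β t) :
    lv β * fn u = fn t - D (-1) * fn (ifSome β t) * D 1 := by
  cases β with
  | none =>
    have ht : t = u := ht
    simp [lv, ifSome, ht]
  | some g =>
    have ht : dx t = u * g := ht
    rw [lv, ifSome, mul_assoc, ← map_mul, mul_comm, ← ht, D_mul_fn_mul_D]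
    abel

/-- The positive part of B u D⁻¹ v is (B u - B(u)) D⁻¹ v, and the factor v is absorbed into the
right vector by `fn_mul_rv`. -/
theorem om_plus_mul_ghost {B : Op K} (hB : B.IsPlus) {α β : Option (Fn K)}
    (h : α ≠ none ∨ β ≠ none) {u v s : Fn K} (hs : PotR α v s) :
    om (plus (B * ghost u v)) α β =
      om B (some (u * ifSome α s)) β - s * om B (some u) β := by
  rw [plus_mul_ghost hB, om, show lv β * ((B * fn u * D (-1) - fn (act B u) * D (-1)) * fn v) * rv α
    = lv β * (B * fn u * D (-1) - fn (act B u) * D (-1)) * (fn v * rv α) by simp only [mul_assoc],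
    fn_mul_rv hs, mul_sub, map_sub, res_mul_fn, mul_comm s, om, om, mul_assoc (lv β)]
  have e1 : (B * fn u * D (-1) - fn (act B u) * D (-1)) * (D 1 * fn (ifSome α s) * D (-1)) =
      B * rv (some (u * ifSome α s)) - fn (act B u) * fn (ifSome α s) * D (-1) := by
    rw [sub_mul, mul_assoc, ← mul_assoc (D (-1)), ← mul_assoc (D (-1)), D_mul_D_one,
        mul_assoc (fn _),
      ← mul_assoc (D (-1)), ← mul_assoc (D (-1)), D_mul_D_one, rv, map_mul]
    simp only [mul_assoc, one_mul]
  rw [e1, mul_sub, map_sub, mul_sub, map_sub, sub_mul]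
  -- Moving s across D⁻¹ costs [s, D⁻¹] = D⁻¹ s' D⁻¹, whose order is too low to affect the residue.
  have e2 : res (lv β * (fn (act B u) * fn (ifSome α s) * D (-1))) =
      res (lv β * (fn (act B u) * D (-1))) * s := by
    rw [← res_mul_fn, ← sub_eq_zero, ← map_sub]
    cases α with
    | none =>
      obtain ⟨g, rfl⟩ := Option.ne_none_iff_exists'.1 (h.resolve_left (by simp))
      simp only [ifSome, map_zero, mul_zero, zero_mul, zero_sub, map_neg, neg_eq_zero]
      exact res_of_le ((((le_D (-1)).mul (le_fn g)).mul ((le_fn _).mul (le_D (-1)))).mul (le_fn s))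
    | some f =>
      simp only [ifSome]
      rw [show lv β * (fn (act B u) * fn s * D (-1)) - lv β * (fn (act B u) * D (-1)) * fn s =
        lv β * (fn (act B u) * (fn s * D (-1) - D (-1) * fn s)) by
          simp only [mul_sub, mul_assoc], fn_mul_D_sub]
      exact res_of_le ((lv_le β).mul ((le_fn _).mul (((le_D (-1)).mul (le_fn _)).mul (le_D (-1)))))
  rw [e2, rv, rv]
  simp only [mul_assoc]
  abel

theorem om_plus_ghost_mul {B : Op K} (hB : B.IsPlus) {α β : Option (Fn K)}
    (h : α ≠ none ∨ β ≠ none) {u v t : Fn K} (ht : PotL u β t) :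
    om (plus (ghost u v * B)) α β =
      t * om B α (some v) - om B α (some (v * ifSome β t)) := by
  rw [plus_ghost_mul hB, om, show lv β * (fn u * (D (-1) * fn v * B - D (-1) * fn (adj B v))) * rv α
    = (lv β * fn u) * ((D (-1) * fn v * B - D (-1) * fn (adj B v)) * rv α) by simp only [mul_assoc],
    lv_mul_fn ht, sub_mul, map_sub, res_fn_mul, om, om, ← mul_assoc (D (-1) * _ * _)]
  have e1 : D (-1) * fn (ifSome β t) * D 1 * (D (-1) * fn v * B - D (-1) * fn (adj B v)) =
      lv (some (v * ifSome β t)) * B - D (-1) * fn (ifSome β t) * fn (adj B v) := by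
    rw [mul_sub, mul_assoc _ (D 1), ← mul_assoc (D 1), ← mul_assoc (D 1), D_one_mul_D,
      mul_assoc _ (D 1), ← mul_assoc (D 1), D_one_mul_D, lv, mul_comm v, map_mul]
    simp only [mul_assoc, one_mul]
  rw [e1, sub_mul, map_sub, sub_mul, map_sub, mul_sub]
  have e2 : res (D (-1) * fn (ifSome β t) * fn (adj B v) * rv α) =
      t * res (D (-1) * fn (adj B v) * rv α) := by
    rw [← res_fn_mul, ← sub_eq_zero, ← map_sub]
    cases β with
    | none =>
      obtain ⟨f, rfl⟩ := Option.ne_none_iff_exists'.1 (h.resolve_right (by simp))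
      simp only [ifSome, map_zero, mul_zero, zero_mul, zero_sub, map_neg, neg_eq_zero]
      exact res_of_le ((le_fn t).mul (((le_D (-1)).mul (le_fn _)).mul ((le_fn _).mul (le_D (-1)))))
    | some g =>
      simp only [ifSome]
      rw [show D (-1) * fn t * fn (adj B v) * rv α - fn t * (D (-1) * fn (adj B v) * rv α) =
        -((fn t * D (-1) - D (-1) * fn t) * fn (adj B v) * rv α) by
          rw [sub_mul, sub_mul, neg_sub]; simp only [mul_assoc], fn_mul_D_sub, map_neg, neg_eq_zero]
      exact res_of_le (((((le_D (-1)).mul (le_fn _)).mul (le_D (-1))).mul (le_fn _)).mul (rv_le α))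
  rw [e2, lv, lv]
  abel

/-- The pairing with the differential part of the product of two operators with integral parts
`∑ u_i D⁻¹ v_i`. -/
theorem om_plus_mul {B B' : Op K} (hB : B.IsPlus) (hB' : B'.IsPlus) {α β : Option (Fn K)}
    (h : α ≠ none ∨ β ≠ none) (s : Finset ι) (s' : Finset κ) {u v t : ι → Fn K}
    {u' v' σ : κ → Fn K} (ht : ∀ i ∈ s, PotL (u i) β (t i)) (hσ : ∀ i ∈ s', PotR α (v' i) (σ i)) :
    om (plus ((B + ∑ i ∈ s, ghost (u i) (v i)) * (B' + ∑ i ∈ s', ghost (u' i) (v' i)))) α β =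
      om B (some (nxtR B' α (∑ i ∈ s', u' i * σ i))) β
        + om B' α (some (nxtL B β (∑ i ∈ s, v i * t i)))
        - ∑ i ∈ s', σ i * om B (some (u' i)) β + ∑ i ∈ s, t i * om B' α (some (v i)) := by
  have hGG : ((∑ i ∈ s, ghost (u i) (v i)) * (∑ i ∈ s', ghost (u' i) (v' i))).Le (-1) :=
    (Le.mul (Le.sum fun i _ => ghost_le _ _) (Le.sum fun i _ => ghost_le _ _)).mono (by norm_num)
  rw [add_mul, mul_add, mul_add, map_add, map_add, map_add, plus_of_le hGG, add_zero,
    plus_of_isPlus (hB.mul hB'), om_add, om_add, om_mul hB hB', Finset.mul_sum, Finset.sum_mul,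
    map_sum, map_sum, om_sum, om_sum, nxtR_eq B' α (∑ i ∈ s', _), nxtL_eq B β (∑ i ∈ s, _),
    ← omR_apply, ← omR_apply, ← omL_apply, ← omL_apply, map_add, map_sub, ifSome_sum, ifSome_sum,
    map_sum, map_sum, Finset.sum_congr rfl fun i hi => om_plus_mul_ghost hB h (hσ i hi),
    Finset.sum_congr rfl fun i hi => om_plus_ghost_mul hB' h (ht i hi), Finset.sum_sub_distrib,
    Finset.sum_sub_distrib]
  have e1 : ∀ i, ifSome α (u' i * σ i) = u' i * ifSome α (σ i) := fun i => by
    cases α <;> simp [ifSome]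
  have e2 : ∀ i, ifSome β (v i * t i) = v i * ifSome β (t i) := fun i => by
    cases β <;> simp [ifSome]
  simp only [e1, e2, omR_apply, omL_apply]
  abel

end Op

end CKP

end

/-! ### The Poincaré lemma and the time evolution of the pairing. -/

noncomputable section

namespace CKP

variable {K : Type*} [CommRing K] [Algebra ℚ K] {ι κ : Type*}

open MvPowerSeries

/-- The Poincaré lemma for formal power series. -/
theorem exists_dt_eq (ω : ℕ+ → Fn K) (h : ∀ m n, dt m (ω n) = dt n (ω m)) :
    ∃ F : Fn K, ∀ n, dt n F = ω n := by
  classical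
  have hne : ∀ d : ℕ+ →₀ ℕ, d ≠ 0 → ∃ n, d n ≠ 0 := fun d hd => by
    by_contra! hc
    exact hd (Finsupp.ext hc)
  -- The coefficient of F at d ≠ 0 is forced by ∂_n F = ω_n for any n in the support of d: divide a
  -- coefficient of ω_n by d n. An arbitrary such n is chosen, and the free constant term is set to
  -- 0.
  let F : Fn K := fun d => if hd : d = 0 then 0 else
    (((d (hne d hd).choose : ℚ))⁻¹) •
      coeff (d - Finsupp.single (hne d hd).choose 1) (ω (hne d hd).choose)
  refine ⟨F, fun n => ?_⟩
  ext d
  have hd0 : d + Finsupp.single n 1 ≠ 0 := fun h0 => by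
    have := DFunLike.congr_fun h0 n
    simp at this
  have hF : coeff (d + Finsupp.single n 1) F = _ := dif_neg hd0
  rw [dt, coeff_pderiv, hF]
  generalize_proofs hp
  have hm := hp.choose_spec
  set m := hp.choose with hmdef
  clear_value m
  have hq : ∀ (x : K) (a : ℕ), a ≠ 0 → ((a : ℚ)⁻¹ • x) * (a : K) = x := fun x a ha => by
    rw [smul_mul_assoc, mul_comm, ← nsmul_eq_mul, ← Nat.cast_smul_eq_nsmul ℚ, smul_smul,
      inv_mul_cancel₀ (by exact_mod_cast ha), one_smul]
  by_cases hmn : m = n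
  · subst hmn
    rw [add_tsub_cancel_right]
    have := hq (coeff d (ω m)) (d m + 1) (by omega)
    simpa using this
  · have hdm : d m ≠ 0 := by simpa [Finsupp.single_eq_of_ne hmn] using hm
    have hle : Finsupp.single m 1 ≤ d := by
      rw [Finsupp.single_le_iff]
      omega
    have e1 : d + Finsupp.single n 1 - Finsupp.single m 1 =
        d - Finsupp.single m 1 + Finsupp.single n 1 := by
      rw [tsub_add_eq_add_tsub hle]
    -- Closedness shows that the chosen index m and the given n yield the same value.
    have hc := congrArg (coeff (d - Finsupp.single m 1)) (h n m)
    rw [dt, dt, coeff_pderiv, coeff_pderiv, tsub_add_cancel_of_le hle] at hc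
    have e2 : (d - Finsupp.single m 1 : ℕ+ →₀ ℕ) n = d n := by
      simp [Finsupp.single_eq_of_ne (Ne.symm hmn)]
    have e3 : (d - Finsupp.single m 1 : ℕ+ →₀ ℕ) m + 1 = d m := by
      simp only [Finsupp.tsub_apply, Finsupp.single_eq_same]
      omega
    have e4 : (d + Finsupp.single n 1 : ℕ+ →₀ ℕ) m = d m := by
      simp [Finsupp.single_eq_of_ne hmn]
    rw [e2, show (((d - Finsupp.single m 1 : ℕ+ →₀ ℕ) m : ℕ) : K) + 1 = (d m : K) by
      rw [← e3]; push_cast; ring] at hc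
    rw [e4, e1, smul_mul_assoc, hc, ← smul_mul_assoc]
    exact hq _ _ hdm

namespace Op

/-- The time derivative of a vector. -/
def dtv (n : ℕ+) (α : Option (Fn K)) : Fn K :=
  match α with
  | none => 0
  | some f => CKP.dt n f

theorem dt_rv (n : ℕ+) (α : Option (Fn K)) : dt n (rv α) = rv (some (dtv n α)) := by
  cases α with
  | none => rw [rv, rv, dtv, map_zero, zero_mul]; exact dt_D n 0
  | some f => rw [rv, rv, dt_mul, dt_fn, dt_D, mul_zero, add_zero, dtv]

theorem dt_lv (n : ℕ+) (α : Option (Fn K)) : dt n (lv α) = lv (some (dtv n α)) := by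
  cases α with
  | none => rw [lv, lv, dtv, map_zero, mul_zero]; exact dt_D n 0
  | some f => rw [lv, lv, dt_mul, dt_fn, dt_D, zero_mul, zero_add, dtv]

theorem dt_res (n : ℕ+) (A : Op K) : CKP.dt n (res A) = res (dt n A) := rfl

theorem dt_om (n : ℕ+) (A : Op K) (α β : Option (Fn K)) : CKP.dt n (om A α β) =
    om (dt n A) α β + om A (some (dtv n α)) β + om A α (some (dtv n β)) := by
  rw [om, dt_res, dt_mul, dt_mul, dt_rv, dt_lv, om, om, om]
  simp only [add_mul, map_add]
  abel

theorem om_plus_comm {B B' : Op K} (hB : B.IsPlus) (hB' : B'.IsPlus) {α β : Option (Fn K)}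
    (h : α ≠ none ∨ β ≠ none) (s : Finset ι) {u v σ t : ι → Fn K}
    (ht : ∀ i ∈ s, PotL (u i) β (t i)) (hσ : ∀ i ∈ s, PotR α (v i) (σ i)) :
    om (plus (B * (B' + ∑ i ∈ s, ghost (u i) (v i)) - (B' + ∑ i ∈ s, ghost (u i) (v i)) * B)) α β =
      om B (some (nxtR B' α (∑ i ∈ s, u i * σ i))) β
        - om B α (some (nxtL B' β (∑ i ∈ s, v i * t i)))
        - om B' (some (nxtR B α 0)) β + om B' α (some (nxtL B β 0))
        - ∑ i ∈ s, (σ i * om B (some (u i)) β + t i * om B α (some (v i))) := by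
  have h1 := om_plus_mul hB hB' h (∅ : Finset ι) s (u := u) (v := v) (t := t) (u' := u) (by simp) hσ
  have h2 := om_plus_mul hB' hB h s (∅ : Finset ι) (v := v) (u' := u) (v' := v)
      (σ := σ) ht (by simp)
  simp only [Finset.sum_empty, add_zero, sub_zero] at h1 h2
  rw [map_sub, om_sub, h1, h2, Finset.sum_add_distrib]
  abel

/-- The evolution of the pairing with `B' + ∑ u_i D⁻¹ v_i`. -/
theorem dt_pairing (n : ℕ+) {B B' : Op K} (hB : B.IsPlus) (hB' : B'.IsPlus) {α β : Option (Fn K)}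
    (h : α ≠ none ∨ β ≠ none) (s : Finset ι) {u v σ t : ι → Fn K}
    (ht : ∀ i ∈ s, PotL (u i) β (t i)) (hσ : ∀ i ∈ s, PotR α (v i) (σ i))
    (hα : dtv n α = nxtR B α 0) (hβ : dtv n β = -nxtL B β 0)
    (hdt : ∀ i ∈ s, CKP.dt n (t i) = om B (some (u i)) β)
    (hdσ : ∀ i ∈ s, CKP.dt n (σ i) = om B α (some (v i))) :
    CKP.dt n (om B' α β + ∑ i ∈ s, σ i * t i) =
      om (dt n B' - plus (B * (B' + ∑ i ∈ s, ghost (u i) (v i))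
        - (B' + ∑ i ∈ s, ghost (u i) (v i)) * B)) α β
      + om B (some (nxtR B' α (∑ i ∈ s, u i * σ i))) β
      - om B α (some (nxtL B' β (∑ i ∈ s, v i * t i))) := by
  have e : ∀ x, om B' α (some (-x)) = -om B' α (some x) := fun x => map_neg (omL B' α) x
  rw [CKP.dt_add, dt_om, CKP.dt_sum, om_sub, om_plus_comm hB hB' h s ht hσ, hα, hβ, e]
  have : ∑ i ∈ s, CKP.dt n (σ i * t i) =
      ∑ i ∈ s, (σ i * om B (some (u i)) β + t i * om B α (some (v i))) :=
    Finset.sum_congr rfl fun i hi => by rw [CKP.dt_mul, hdt i hi, hdσ i hi]; ring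
  rw [this]
  abel

/-- Closedness of the form with components Ω_{B_n}(f, g): this is `dt_pairing` with no integral
terms, where zero curvature replaces ∂_m B' - [B, B'] by ∂_n B. -/
theorem dt_om_comm (m n : ℕ+) {B B' : Op K} (hB : B.IsPlus) (hB' : B'.IsPlus)
    {α β : Option (Fn K)} (h : α ≠ none ∨ β ≠ none) (hα : dtv m α = nxtR B α 0)
    (hβ : dtv m β = -nxtL B β 0) (hα' : dtv n α = nxtR B' α 0) (hβ' : dtv n β = -nxtL B' β 0)
    (hz : dt m B' - dt n B = B * B' - B' * B) :
    CKP.dt m (om B' α β) = CKP.dt n (om B α β) := by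
  have h1 := dt_pairing m hB hB' h (∅ : Finset ℕ) (u := 0) (v := 0) (σ := 0) (t := 0)
    (by simp) (by simp) hα hβ (by simp) (by simp)
  have e : ∀ x, om B α (some (-x)) = -om B α (some x) := fun x => map_neg (omL B α) x
  simp only [Finset.sum_empty, add_zero] at h1
  rw [h1, dt_om, hα', hβ', e, plus_of_isPlus ((hB.mul hB').sub (hB'.mul hB)), ← hz,
    sub_sub_cancel]
  abel

end Op

end CKP

end

/-! ### Convolution sums, and frames of functions with antiderivatives of their products. -/

noncomputable section

namespace CKP

variable {K : Type*} [CommRing K] [Algebra ℚ K] {ι κ : Type*} {m : ℕ}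

/-- The sum of `h a b` over `a + b + 1 = k`. -/
def conv {V : Type*} [AddCommMonoid V] (h : ℕ → ℕ → V) (k : ℕ) : V :=
  ∑ j ∈ Finset.range k, h (k - 1 - j) j

section conv

variable {V W : Type*} [AddCommGroup V] [AddCommGroup W]

theorem conv_congr {h h' : ℕ → ℕ → V} (k : ℕ) (e : ∀ a b, a + b + 1 = k → h a b = h' a b) :
    conv h k = conv h' k :=
  Finset.sum_congr rfl fun j hj => e _ _ (by have := Finset.mem_range.1 hj; omega)

theorem conv_add (h h' : ℕ → ℕ → V) (k : ℕ) :
    conv (fun a b => h a b + h' a b) k = conv h k + conv h' k := Finset.sum_add_distrib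
theorem conv_sub (h h' : ℕ → ℕ → V) (k : ℕ) :
    conv (fun a b => h a b - h' a b) k = conv h k - conv h' k := Finset.sum_sub_distrib _ _
theorem conv_neg (h : ℕ → ℕ → V) (k : ℕ) :
    conv (fun a b => -h a b) k = -conv h k := Finset.sum_neg_distrib _
theorem conv_sum (s : Finset ι) (h : ι → ℕ → ℕ → V) (k : ℕ) :
    conv (fun a b => ∑ i ∈ s, h i a b) k = ∑ i ∈ s, conv (h i) k := Finset.sum_comm
theorem map_conv {F : Type*} [FunLike F V W] [AddMonoidHomClass F V W] (φ : F) (h : ℕ → ℕ → V)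
    (k : ℕ) : φ (conv h k) = conv (fun a b => φ (h a b)) k := map_sum φ _ _
theorem conv_eq_zero {h : ℕ → ℕ → V} (k : ℕ) (e : ∀ a b, h a b = 0) : conv h k = 0 :=
  Finset.sum_eq_zero fun _ _ => e _ _
theorem conv_zero (h : ℕ → ℕ → V) : conv h 0 = 0 := Finset.sum_range_zero _
theorem conv_one (h : ℕ → ℕ → V) : conv h 1 = h 0 0 := Finset.sum_range_one _

theorem conv_succ_right (h : ℕ → ℕ → V) (k : ℕ) :
    conv h (k + 1) = conv (fun a b => h a (b + 1)) k + h k 0 := by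
  rw [conv, Finset.sum_range_succ', conv]
  congr 1
  exact Finset.sum_congr rfl fun j hj => by congr 1; omega

theorem conv_succ_left (h : ℕ → ℕ → V) (k : ℕ) :
    conv h (k + 1) = conv (fun a b => h (a + 1) b) k + h 0 k := by
  rw [conv, Finset.sum_range_succ, conv, Nat.add_sub_cancel, Nat.sub_self]
  congr 1
  exact Finset.sum_congr rfl fun j hj => by
    have := Finset.mem_range.1 hj
    congr 1; omega

theorem mul_conv {R : Type*} [Ring R] (x : R) (h : ℕ → ℕ → R) (k : ℕ) :
    x * conv h k = conv (fun a b => x * h a b) k := Finset.mul_sum _ _ _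
theorem conv_mul {R : Type*} [Ring R] (x : R) (h : ℕ → ℕ → R) (k : ℕ) :
    conv h k * x = conv (fun a b => h a b * x) k := Finset.sum_mul _ _ _

/-- The coefficients of the operators `X⁽¹⁾_k`. -/
def cX (a b : ℕ) : ℚ := ((b : ℚ) - a) / 2

/-- The telescoping sum behind the invariance of the constraint. -/
theorem conv_telescope [Module ℚ V] (h : ℕ → ℕ → V) (k : ℕ) :
    conv (fun a b => cX a b • (h (a + 1) b - h a (b + 1))) k =
      conv h (k + 1) - (((k + 1 : ℕ) : ℚ) / 2) • (h k 0 + h 0 k) := by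
  -- Summation by parts: in front of h(a, b), the weight (b - a)/2 becomes (b - a + 1)/2 for the sum
  -- shifted in a and (b - a - 1)/2 for the one shifted in b. These differ by 1, and the two end
  -- terms give the boundary contribution.
  have h1 := conv_succ_right (fun a b => ((b : ℚ) - (a : ℚ) - 1) • h a b) k
  have h2 := conv_succ_left (fun a b => ((b : ℚ) - (a : ℚ) + 1) • h a b) k
  have h3 : conv (fun a b => ((b : ℚ) - (a : ℚ) + 1) • h a b) (k + 1)
      - conv (fun a b => ((b : ℚ) - (a : ℚ) - 1) • h a b) (k + 1) = (2 : ℚ) • conv h (k + 1) := by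
    rw [← conv_sub, conv, conv, Finset.smul_sum]
    exact Finset.sum_congr rfl fun j _ => by module
  have h4 : conv (fun a b => cX a b • (h (a + 1) b - h a (b + 1))) k = (1 / 2 : ℚ) •
      (conv (fun a b => (((b : ℕ) : ℚ) - ((a + 1 : ℕ) : ℚ) + 1) • h (a + 1) b) k -
        conv (fun a b => (((b + 1 : ℕ) : ℚ) - (a : ℚ) - 1) • h a (b + 1)) k) := by
    rw [← conv_sub, conv, conv, Finset.smul_sum]
    exact Finset.sum_congr rfl fun j _ => by
      simp only [cX]
      push_cast
      module
  rw [h4, ← sub_eq_iff_eq_add.2 h1, ← sub_eq_iff_eq_add.2 h2]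
  rw [show ∀ a b c d : V, a - b - (c - d) = (a - c) - b + d from fun a b c d => by abel, h3]
  push_cast
  module

end conv

/-- Indices of rows: the formal symbol `∞`, the zero function, and the functions of a frame. -/
inductive Ix (m : ℕ)
  | inf
  | zero
  | ix (p : ℕ) (i : Fin m)

/-- The functions `L^p(Φ_i)`, `(L^*)^q(Ψ_j)`, and the antiderivatives of their products. -/
structure Frame (K : Type*) [CommRing K] (m : ℕ) where
  f : ℕ → Fin m → Fn K
  g : ℕ → Fin m → Fn K
  S : ℕ → ℕ → Fin m → Fin m → Fn K

namespace Ix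

/-- The shift of the exponent by `k`. -/
def sh (k : ℕ) : Ix m → Ix m
  | inf => zero
  | zero => zero
  | ix p i => ix (p + k) i

/-- At most one of the two indices is the formal symbol. -/
def Ok (α β : Ix m) : Prop := α ≠ inf ∨ β ≠ inf

theorem ok_ix_left (p : ℕ) (i : Fin m) (β : Ix m) : Ok (ix p i) β := Or.inl nofun
theorem ok_ix_right (p : ℕ) (i : Fin m) (α : Ix m) : Ok α (ix p i) := Or.inr nofun
theorem ok_sh_left (k : ℕ) (α β : Ix m) : Ok (sh k α) β := Or.inl (by cases α <;> nofun)
theorem ok_sh_right (k : ℕ) (α β : Ix m) : Ok α (sh k β) := Or.inr (by cases β <;> nofun)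

theorem sh_sh (k l : ℕ) (α : Ix m) : sh k (sh l α) = sh (l + k) α := by
  cases α <;> simp [sh, add_assoc]

end Ix

open Ix

namespace Frame

/-- The right vector with a given index. -/
def r (F : Frame K m) : Ix m → Option (Fn K)
  | inf => none
  | zero => some 0
  | ix p i => some (F.f p i)

/-- The left vector with a given index. -/
def l (F : Frame K m) : Ix m → Option (Fn K)
  | inf => none
  | zero => some 0
  | ix p i => some (F.g p i)

/-- The antiderivatives, extended to all indices. -/
def s (F : Frame K m) : Ix m → Ix m → Fn K
  | ix p i, ix q j => F.S p q i j
  | ix p i, inf => F.f p i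
  | inf, ix q j => -F.g q j
  | _, _ => 0

theorem ok_ne {K : Type*} [CommRing K] {F : Frame K m} {α β : Ix m} (h : Ok α β) :
    F.r α ≠ none ∨ F.l β ≠ none := by
  rcases h with h | h
  · left; cases α <;> simp_all [r]
  · right; cases β <;> simp_all [l]

/-- The function `S p q i j` is an antiderivative of `f p i * g q j`. -/
def IsPot (F : Frame K m) : Prop := ∀ p q i j, dx (F.S p q i j) = F.f p i * F.g q j

open Op

/-- The boundary values s(ix, inf) = f and s(inf, ix) = -g are exactly what `PotL` and `PotR` demand
of the formal symbol, so the pairing formulas apply to all indices uniformly. -/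
theorem IsPot.potR {K : Type*} [CommRing K] {F : Frame K m} (hF : F.IsPot) (α : Ix m) (q : ℕ)
    (j : Fin m) :
    PotR (F.r α) (F.g q j) (F.s α (ix q j)) := by
  cases α with
  | inf => rfl
  | zero => exact (dt_zero 1).trans (zero_mul _).symm
  | ix p i => exact hF p q i j

theorem IsPot.potL {F : Frame K m} (hF : F.IsPot) (β : Ix m) (p : ℕ) (i : Fin m) (c : ℚ) :
    PotL (c • F.f p i) (F.l β) (c • F.s (ix p i) β) := by
  cases β with
  | inf => rfl
  | zero =>
    change dx _ = _ * 0
    rw [s, smul_zero, mul_zero]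
    · exact dt_zero 1
    all_goals simp
  | ix q j =>
    change dx _ = _
    rw [dx, dt_qsmul, smul_mul_assoc]
    exact congrArg (c • ·) (hF p q i j)

/-- The operator `∑_{a+b+1=k} c a b ∑_l f_a D⁻¹ g_b`. -/
def gh (F : Frame K m) (c : ℕ → ℕ → ℚ) (k : ℕ) : Op K :=
  conv (fun a b => c a b • ∑ l, ghost (F.f a l) (F.g b l)) k

/-- The quadratic expression in the antiderivatives belonging to `gh`. -/
def quad (F : Frame K m) (c : ℕ → ℕ → ℚ) (k : ℕ) (α β : Ix m) : Fn K :=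
  conv (fun a b => c a b • ∑ l, F.s α (ix b l) * F.s (ix a l) β) k

/-- The action of `gh` on a right vector. -/
def qR (F : Frame K m) (c : ℕ → ℕ → ℚ) (k : ℕ) (α : Ix m) : Fn K :=
  conv (fun a b => c a b • ∑ l, F.f a l * F.s α (ix b l)) k

/-- The action of the adjoint of `-gh` on a left vector. -/
def qL (F : Frame K m) (c : ℕ → ℕ → ℚ) (k : ℕ) (β : Ix m) : Fn K :=
  conv (fun a b => c a b • ∑ l, F.g b l * F.s (ix a l) β) k

variable {F : Frame K m}

theorem gh_le (c : ℕ → ℕ → ℚ) (k : ℕ) : (F.gh c k).Le (-1) :=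
  Le.sum fun _ _ => (Le.sum fun _ _ => ghost_le _ _).smul _

/-- With a formal symbol in one slot, the quadratic terms in S reduce to the nonlocal action of `gh`
on a function. -/
theorem quad_inf_right (c : ℕ → ℕ → ℚ) (k : ℕ) (p : ℕ) (i : Fin m) :
    F.quad c k (ix p i) inf = F.qR c k (ix p i) :=
  conv_congr k fun a b _ => by simp only [s, mul_comm]

theorem quad_inf_left (c : ℕ → ℕ → ℚ) (k : ℕ) (q : ℕ) (j : Fin m) :
    F.quad c k inf (ix q j) = -F.qL c k (ix q j) := by
  rw [qL, ← conv_neg]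
  exact conv_congr k fun a b _ => by
    rw [← smul_neg, ← Finset.sum_neg_distrib]
    simp only [s, neg_mul]

theorem quad_zero_left (c : ℕ → ℕ → ℚ) (k : ℕ) (β : Ix m) : F.quad c k zero β = 0 :=
  conv_eq_zero _ fun a b => by simp [s]
theorem quad_zero_right (c : ℕ → ℕ → ℚ) (k : ℕ) (α : Ix m) : F.quad c k α zero = 0 :=
  conv_eq_zero _ fun a b => by simp [s]
theorem qR_zero (c : ℕ → ℕ → ℚ) (k : ℕ) : F.qR c k zero = 0 :=
  conv_eq_zero _ fun a b => by simp [s]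
theorem qL_zero (c : ℕ → ℕ → ℚ) (k : ℕ) : F.qL c k zero = 0 :=
  conv_eq_zero _ fun a b => by simp [s]

theorem conv_eq_sum {V : Type*} [AddCommGroup V] (h : ℕ → ℕ → Fin m → V) (k : ℕ) :
    conv (fun a b => ∑ l, h a b l) k =
      ∑ x ∈ Finset.range k ×ˢ (Finset.univ : Finset (Fin m)), h (k - 1 - x.1) x.1 x.2 := by
  rw [Finset.sum_product]
  rfl

theorem gh_eq (c : ℕ → ℕ → ℚ) (k : ℕ) : F.gh c k =
    ∑ x ∈ Finset.range k ×ˢ (Finset.univ : Finset (Fin m)),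
      ghost (c (k - 1 - x.1) x.1 • F.f (k - 1 - x.1) x.2) (F.g x.1 x.2) := by
  simp only [gh, Finset.smul_sum, conv_eq_sum, ghost_smul_left]

theorem om_plus_mul (hF : F.IsPot) {B B' : Op K} (hB : B.IsPlus) (hB' : B'.IsPlus) {α β : Ix m}
    (h : Ok α β) (c c' : ℕ → ℕ → ℚ) (k k' : ℕ) :
    om (plus ((B + F.gh c k) * (B' + F.gh c' k'))) (F.r α) (F.l β) =
      om B (some (nxtR B' (F.r α) (F.qR c' k' α))) (F.l β)
        + om B' (F.r α) (some (nxtL B (F.l β) (F.qL c k β)))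
        - conv (fun a b => c' a b • ∑ l, F.s α (ix b l) * om B (F.r (ix a l)) (F.l β)) k'
        + conv (fun a b => c a b • ∑ l, F.s (ix a l) β * om B' (F.r α) (F.l (ix b l))) k := by
  rw [gh_eq, gh_eq, Op.om_plus_mul hB hB' (ok_ne h) _ _ (fun x _ => hF.potL β _ _ _)
    (fun x _ => hF.potR α _ _)]
  simp only [qR, qL, Finset.smul_sum, conv_eq_sum, ← omR_apply, ← omL_apply, map_smul,
    smul_mul_assoc, mul_smul_comm, r, l]

theorem om_plus_comm (hF : F.IsPot) {B B' : Op K} (hB : B.IsPlus) (hB' : B'.IsPlus) {α β : Ix m}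
    (h : Ok α β) (c c' : ℕ → ℕ → ℚ) (k k' : ℕ) :
    om (plus ((B + F.gh c k) * (B' + F.gh c' k') - (B' + F.gh c' k') * (B + F.gh c k)))
      (F.r α) (F.l β) =
      om B (some (nxtR B' (F.r α) (F.qR c' k' α))) (F.l β)
        - om B (F.r α) (some (nxtL B' (F.l β) (F.qL c' k' β)))
        - (om B' (some (nxtR B (F.r α) (F.qR c k α))) (F.l β)
        - om B' (F.r α) (some (nxtL B (F.l β) (F.qL c k β))))
        - conv (fun a b => c' a b • ∑ l, (F.s α (ix b l) * om B (F.r (ix a l)) (F.l β)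
          + F.s (ix a l) β * om B (F.r α) (F.l (ix b l)))) k'
        + conv (fun a b => c a b • ∑ l, (F.s α (ix b l) * om B' (F.r (ix a l)) (F.l β)
          + F.s (ix a l) β * om B' (F.r α) (F.l (ix b l)))) k := by
  rw [map_sub, om_sub, om_plus_mul hF hB hB' h, om_plus_mul hF hB' hB h]
  simp only [Finset.sum_add_distrib, smul_add, conv_add]
  abel

/-- The frame evolves according to the differential operator `B` in the time `t_n`. -/
structure IsEvol (F : Frame K m) (n : ℕ+) (B : Op K) : Prop where
  f : ∀ p i, CKP.dt n (F.f p i) = act B (F.f p i)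
  g : ∀ q j, CKP.dt n (F.g q j) = -adj B (F.g q j)
  S : ∀ p q i j, CKP.dt n (F.S p q i j) = om B (some (F.f p i)) (some (F.g q j))

theorem om_zero_left (B : Op K) (β : Option (Fn K)) : om B (some 0) β = 0 := map_zero (omR B β)
theorem om_zero_right (B : Op K) (α : Option (Fn K)) : om B α (some 0) = 0 := map_zero (omL B α)

/-- The evolution equations of f, of g and of S are this one identity, for β = inf, for α = inf and
for two genuine indices respectively. -/
theorem IsEvol.s {n : ℕ+} {B : Op K} (h : F.IsEvol n B) {α β : Ix m} (hok : Ok α β) :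
    CKP.dt n (F.s α β) = om B (F.r α) (F.l β) := by
  cases α <;> cases β
  · rcases hok with h | h <;> exact absurd rfl h
  · exact (dt_zero n).trans (om_zero_right _ _).symm
  · change CKP.dt n (-F.g _ _) = _
    rw [dt_neg, h.g, neg_neg]
    exact (om_none_left _ _).symm
  · exact (dt_zero n).trans (om_zero_left _ _).symm
  · exact (dt_zero n).trans (om_zero_left _ _).symm
  · exact (dt_zero n).trans (om_zero_left _ _).symm
  · exact (h.f _ _).trans (om_none_right _ _).symm
  · exact (dt_zero n).trans (om_zero_right _ _).symm
  · exact h.S _ _ _ _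

theorem act_zero (B : Op K) : act B 0 = 0 := by rw [← om_none_right, om_zero_left]
theorem adj_zero (B : Op K) : adj B 0 = 0 := by rw [← om_none_left, om_zero_right]

theorem IsEvol.r {n : ℕ+} {B : Op K} (h : F.IsEvol n B) (α : Ix m) :
    dtv n (F.r α) = nxtR B (F.r α) 0 := by
  cases α with
  | inf => rfl
  | zero => exact (dt_zero n).trans (by rw [Frame.r, nxtR, act_zero, add_zero])
  | ix p i => exact (h.f p i).trans (add_zero _).symm

theorem IsEvol.l {n : ℕ+} {B : Op K} (h : F.IsEvol n B) (β : Ix m) :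
    dtv n (F.l β) = -nxtL B (F.l β) 0 := by
  cases β with
  | inf => exact neg_zero.symm
  | zero => exact (dt_zero n).trans (by rw [Frame.l, nxtL, adj_zero, sub_zero, neg_zero])
  | ix p i => exact (h.g p i).trans (by rw [Frame.l, nxtL, sub_zero])

/-- Later used with B' = (M L^k)₊, where the left side is the part of the variation of S free of the
weights p + k/2 and q + k/2. -/
theorem dt_pairing (hF : F.IsPot) {n : ℕ+} {B B' : Op K} (hB : B.IsPlus) (hB' : B'.IsPlus)
    (hE : F.IsEvol n B) {α β : Ix m} (h : Ok α β) (c : ℕ → ℕ → ℚ) (k : ℕ) :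
    CKP.dt n (om B' (F.r α) (F.l β) + F.quad c k α β) =
      om (Op.dt n B' - plus (B * (B' + F.gh c k) - (B' + F.gh c k) * B)) (F.r α) (F.l β)
      + om B (some (nxtR B' (F.r α) (F.qR c k α))) (F.l β)
      - om B (F.r α) (some (nxtL B' (F.l β) (F.qL c k β))) := by
  have := Op.dt_pairing n hB hB' (ok_ne (F := F) h)
    (Finset.range k ×ˢ (Finset.univ : Finset (Fin m)))
    (u := fun x => c (k - 1 - x.1) x.1 • F.f (k - 1 - x.1) x.2) (v := fun x => F.g x.1 x.2)
    (σ := fun x => F.s α (ix x.1 x.2))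
    (t := fun x => c (k - 1 - x.1) x.1 • F.s (ix (k - 1 - x.1) x.2) β)
    (fun x _ => hF.potL β _ _ _) (fun x _ => hF.potR α _ _) (hE.r α) (hE.l β)
    (fun x _ => by
      rw [dt_qsmul, hE.s (ok_ix_left _ _ _), ← omR_apply, map_smul]
      rfl)
    (fun x _ => hE.s (ok_ix_right _ _ _))
  rw [gh_eq]
  simp only [quad, qR, qL, Finset.smul_sum, conv_eq_sum]
  simp only [smul_mul_assoc, mul_smul_comm] at this
  exact this

end Frame

end CKP

end

/-! ### The action of L and of its powers on a frame. -/

noncomputable section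

namespace CKP

variable {K : Type*} [CommRing K] [Algebra ℚ K] {ι κ : Type*} {m : ℕ}

open Ix Op

namespace Op

theorem act_plus (A : Op K) (f : Fn K) : act (plus A) f = act A f := by
  rw [← om_none_right, om_plus A (Or.inl (by simp)), om_none_right]

theorem adj_plus (A : Op K) (f : Fn K) : adj (plus A) f = adj A f := by
  rw [← om_none_left, om_plus A (Or.inr (by simp)), om_none_left]

theorem nxtR_plus (A : Op K) (α : Option (Fn K)) (x : Fn K) :
    nxtR (plus A) α x = nxtR A α x := by
  cases α <;> simp [nxtR, act_plus]

theorem nxtL_plus (A : Op K) (α : Option (Fn K)) (x : Fn K) :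
    nxtL (plus A) α x = nxtL A α x := by
  cases α <;> simp [nxtL, adj_plus]

theorem act_one (f : Fn K) : act 1 f = f := by
  rw [act, one_mul, co_fn, if_pos rfl]

theorem adj_one (f : Fn K) : adj 1 f = f := by
  have := co_mul_top (le_D (K := K) (-1)) (le_fn f)
  rw [adj, mul_one, res_eq]
  simpa [co_D, co_fn] using this

end Op

namespace Frame

variable {F : Frame K m}

/-- The coefficients of the powers of `L`. -/
def cOne (_ _ : ℕ) : ℚ := 1

/-- `L` acts on the frame: `f (p + 1) = L (f p)` and `g (q + 1) = L^* (g q)`. -/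
structure IsLax (F : Frame K m) (L : Op K) : Prop where
  minus_eq : Op.minus L = F.gh cOne 1
  f_succ : ∀ p i, F.f (p + 1) i = act L (F.f p i) + ∑ l, F.f 0 l * F.S p 0 i l
  g_succ : ∀ q j, F.g (q + 1) j = adj L (F.g q j) - ∑ l, F.g 0 l * F.S 0 q l j
  S_shift : ∀ p q i j, F.S (p + 1) q i j - F.S p (q + 1) i j =
    om L (some (F.f p i)) (some (F.g q j)) + ∑ l, F.S p 0 i l * F.S 0 q l j

theorem s_zero_left {K : Type*} [CommRing K] {F : Frame K m} (β : Ix m) : F.s zero β = 0 := by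
  cases β <;> rfl
theorem s_zero_right {K : Type*} [CommRing K] {F : Frame K m} (α : Ix m) : F.s α zero = 0 := by
  cases α <;> rfl

/-- The recursions for L(f) and L^*(g) and the shift relation of S merge into one identity, because
s(inf, ·) = -g and `sh` sends `inf` to `zero`. -/
theorem IsLax.shift {L : Op K} (hL : F.IsLax L) {α β : Ix m} (h : Ok α β) :
    F.s (sh 1 α) β - F.s α (sh 1 β) =
      om L (F.r α) (F.l β) + ∑ l, F.s α (ix 0 l) * F.s (ix 0 l) β := by
  cases α <;> cases β
  · rcases h with h | h <;> exact absurd rfl h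
  · simp [sh, s, r, l, om_zero_right]
  · simp only [sh, s, r, l, om_none_left, hL.g_succ, neg_mul, Finset.sum_neg_distrib]
    abel
  · simp [sh, s, r, l, om_zero_left]
  · simp [sh, s, r, l, om_zero_left]
  · simp [sh, s, r, l, om_zero_left]
  · simp only [sh, s, r, l, om_none_right, hL.f_succ, mul_comm (F.f 0 _)]
    abel
  · simp [sh, s, r, l, om_zero_right]
  · exact hL.S_shift _ _ _ _

theorem r_sh {A : Op K} {c : ℕ → ℕ → ℚ} {k n : ℕ}
    (h : ∀ p i, F.f (p + k) i = act A (F.f p i) + F.qR c n (ix p i)) (α : Ix m) :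
    F.r (sh k α) = some (nxtR A (F.r α) (F.qR c n α)) := by
  cases α with
  | inf => rfl
  | zero => simp only [sh, r, nxtR, qR_zero, act_zero, add_zero]
  | ix p i => exact congrArg some (h p i)

theorem l_sh {A : Op K} {c : ℕ → ℕ → ℚ} {k n : ℕ}
    (h : ∀ p i, F.g (p + k) i = adj A (F.g p i) - F.qL c n (ix p i)) (α : Ix m) :
    F.l (sh k α) = some (nxtL A (F.l α) (F.qL c n α)) := by
  cases α with
  | inf => rfl
  | zero => simp only [sh, l, nxtL, qL_zero, adj_zero, sub_zero]
  | ix p i => exact congrArg some (h p i)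

theorem IsLax.r_sh {L : Op K} (hL : F.IsLax L) (α : Ix m) :
    F.r (sh 1 α) = some (nxtR L (F.r α) (F.qR cOne 1 α)) :=
  Frame.r_sh (fun p i => by rw [hL.f_succ, qR, conv_one, cOne, one_smul]; rfl) α

theorem IsLax.l_sh {L : Op K} (hL : F.IsLax L) (α : Ix m) :
    F.l (sh 1 α) = some (nxtL L (F.l α) (F.qL cOne 1 α)) :=
  Frame.l_sh (fun p i => by rw [hL.g_succ, qL, conv_one, cOne, one_smul]; rfl) α

theorem IsLax.eq {L : Op K} (hL : F.IsLax L) : L = plus L + F.gh cOne 1 := by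
  rw [← hL.minus_eq, plus_add_minus]

/-- The powers of `L` act on the frame. -/
theorem IsLax.pow {L : Op K} (hF : F.IsPot) (hL : F.IsLax L) (k : ℕ) :
    (∀ α β, Ok α β → F.s (sh k α) β - F.s α (sh k β) =
      om (L ^ k) (F.r α) (F.l β) + F.quad cOne k α β) ∧ minus (L ^ k) = F.gh cOne k := by
  induction k with
  | zero =>
    refine ⟨fun α β h => ?_, ?_⟩
    · rw [pow_zero, quad, conv_zero, add_zero]
      cases α <;> cases β <;>
        simp [sh, s, r, l, om_zero_left, om_zero_right, om_none_left, om_none_right, act_one,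
          adj_one]
      · rcases h with h | h <;> exact absurd rfl h
      · refine (res_of_le ?_).symm
        exact ((((le_D (-1)).mul (le_fn _)).mul (le_D 0)).mul ((le_fn _).mul (le_D (-1)))).mono
          (by norm_num)
    · rw [pow_zero, gh, conv_zero]
      exact minus_of_isPlus (isPlus_D le_rfl)
  | succ k ih =>
    obtain ⟨ih1, ih2⟩ := ih
    -- The cases β = inf and α = inf of the induction hypothesis say that the nonlocal operator L^k
    -- raises the exponents by k.
    have hf : ∀ p i, F.f (p + k) i = act (L ^ k) (F.f p i) + F.qR cOne k (ix p i) := fun p i => by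
      have := ih1 (ix p i) inf (ok_ix_left _ _ _)
      rw [quad_inf_right] at this
      simpa only [sh, s, r, l, om_none_right, sub_zero] using this
    have hg : ∀ q j, F.g (q + k) j = adj (L ^ k) (F.g q j) - F.qL cOne k (ix q j) := fun q j => by
      have := ih1 inf (ix q j) (ok_ix_right _ _ _)
      rw [quad_inf_left] at this
      simpa only [sh, s, r, l, om_none_left, zero_sub, neg_neg, ← sub_eq_add_neg] using this
    have hk : L ^ k = plus (L ^ k) + F.gh cOne k := by rw [← ih2, plus_add_minus]
    have hmul : L ^ (k + 1) = (plus (L ^ k) + F.gh cOne k) * (plus L + F.gh cOne 1) := by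
      rw [← hk, ← hL.eq, pow_succ]
    refine ⟨fun α β h => ?_, ?_⟩
    · rw [← om_plus _ (ok_ne h), hmul,
        om_plus_mul hF (isPlus_plus _) (isPlus_plus _) h, nxtR_plus, nxtL_plus, ← hL.r_sh,
        ← Frame.l_sh hg, om_plus _ (ok_ne (ok_sh_left 1 α β)),
            om_plus _ (ok_ne (ok_sh_right k α β)),
        conv_one]
      have e1 : ∀ x, om (plus (L ^ k)) (F.r (ix 0 x)) (F.l β) =
          F.s (ix k x) β - F.s (ix 0 x) (sh k β) - F.quad cOne k (ix 0 x) β := fun x => by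
        have := ih1 (ix 0 x) β (ok_ix_left _ _ _)
        rw [sh, zero_add] at this
        rw [om_plus _ (ok_ne (ok_ix_left _ _ _)), this, add_sub_cancel_right]
      have e2 : ∀ b x, om (plus L) (F.r α) (F.l (ix b x)) =
          F.s (sh 1 α) (ix b x) - F.s α (ix (b + 1) x) - ∑ y, F.s α (ix 0 y) * F.s (ix 0 y)
              (ix b x) :=
        fun b x => by
          have := hL.shift (ok_ix_right b x α)
          rw [om_plus _ (ok_ne (ok_ix_right _ _ _)), eq_sub_iff_add_eq, ← this]
          rfl
      -- The shift by k + 1 is split through s(sh 1 α, sh k β): k steps are given by the induction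
      -- hypothesis at sh 1 α, and one by the shift relation at sh k β.
      have e3 := ih1 (sh 1 α) β (ok_sh_left 1 α β)
      have e4 := hL.shift (ok_sh_right k α β)
      rw [sh_sh, add_comm 1 k] at e3
      rw [sh_sh] at e4
      simp only [e1, e2, mul_sub, Finset.sum_sub_distrib, smul_sub, conv_sub]
      have e5 : conv (fun a b => cOne a b • ∑ x, F.s (ix a x) β * F.s (sh 1 α) (ix b x)) k =
          F.quad cOne k (sh 1 α) β := conv_congr k fun a b _ => by simp only [mul_comm]
      have e6 : conv (fun a b => cOne a b • ∑ x, F.s (ix a x) β *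
          ∑ y, F.s α (ix 0 y) * F.s (ix 0 y) (ix b x)) k =
          ∑ y, F.s α (ix 0 y) * F.quad cOne k (ix 0 y) β := by
        simp only [quad, mul_conv, ← conv_sum, mul_smul_comm, Finset.mul_sum, ← Finset.smul_sum]
        refine conv_congr k fun a b _ => ?_
        rw [Finset.sum_comm]
        congr 1
        exact Finset.sum_congr rfl fun y _ => Finset.sum_congr rfl fun x _ => by ring
      have e7 : F.quad cOne (k + 1) α β =
          conv (fun a b => cOne a b • ∑ x, F.s (ix a x) β * F.s α (ix (b + 1) x)) k
          + ∑ x, F.s α (ix 0 x) * F.s (ix k x) β := by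
        rw [quad, conv_succ_right]
        simp only [cOne, one_smul, mul_comm]
      rw [e5, e6, e7]
      simp only [cOne, one_smul] at *
      linear_combination e3 + e4
    -- The product of two integral parts collapses by means of the antiderivatives S. It cancels the
    -- nonlocal corrections in `e1` and `e2`, so that f_k D⁻¹ g_0 and the terms with b raised by one
    -- remain.
    · have hGG : F.gh cOne k * F.gh cOne 1 =
          conv (fun a b => cOne a b • ∑ x, ∑ y,
            (ghost (F.f a x * F.S 0 b y x) (F.g 0 y) - ghost (F.f a x)
                (F.S 0 b y x * F.g 0 y))) k := by
        rw [gh, gh, conv_one, cOne, one_smul, conv_mul]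
        refine conv_congr k fun a b _ => ?_
        rw [smul_mul_assoc, Finset.sum_mul_sum]
        congr 1
        exact Finset.sum_congr rfl fun x _ => Finset.sum_congr rfl fun y _ =>
          ghost_mul_ghost _ _ _ _ _ (by rw [hF, mul_comm])
      have h1 : minus (plus (L ^ k) * plus L) = 0 :=
        minus_of_isPlus ((isPlus_plus _).mul (isPlus_plus _))
      have h2 : minus (plus (L ^ k) * F.gh cOne 1) =
          ∑ x, ghost (act (L ^ k) (F.f 0 x)) (F.g 0 x) := by
        rw [gh, conv_one, cOne, one_smul, Finset.mul_sum, map_sum]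
        simp only [minus_mul_ghost (isPlus_plus _), act_plus]
      have h3 : minus (F.gh cOne k * plus L) =
          conv (fun a b => cOne a b • ∑ x, ghost (F.f a x) (adj L (F.g b x))) k := by
        rw [gh, conv_mul, map_conv]
        refine conv_congr k fun a b _ => ?_
        rw [smul_mul_assoc, map_smul, Finset.sum_mul, map_sum]
        simp only [minus_ghost_mul (isPlus_plus _), adj_plus]
      rw [hmul, add_mul, mul_add, mul_add, map_add, map_add, map_add, h1, h2, h3,
        minus_of_le (((gh_le cOne k).mul (gh_le cOne 1)).mono (by norm_num)), hGG, gh,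
        conv_succ_right]
      have e1 : ∀ x, act (L ^ k) (F.f 0 x) = F.f k x - F.qR cOne k (ix 0 x) := fun x => by
        rw [eq_sub_iff_add_eq, ← hf, zero_add]
      have e2 : ∀ b x, adj L (F.g b x) = F.g (b + 1) x + ∑ y, F.g 0 y * F.S 0 b y x := fun b x => by
        rw [hL.g_succ, sub_add_cancel]
      have e3 : ∑ x, ghost (F.qR cOne k (ix 0 x)) (F.g 0 x) =
          conv (fun a b => cOne a b • ∑ x, ∑ y, ghost (F.f a x * F.S 0 b y x) (F.g 0 y)) k := by
        have : ∀ x, ghost (F.qR cOne k (ix 0 x)) (F.g 0 x) = conv (fun a b =>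
            cOne a b • ∑ y, ghost (F.f a y * F.S 0 b x y) (F.g 0 x)) k := fun x => by
          simp only [qR, conv, ghost_sum_left, ghost_smul_left]
          rfl
        simp only [this, ← conv_sum, ← Finset.smul_sum]
        exact conv_congr k fun a b _ => by rw [Finset.sum_comm]
      simp only [e1, e2, ghost_sub_left, ghost_add_right, ghost_sum_right, Finset.sum_sub_distrib,
        Finset.sum_add_distrib, smul_add, smul_sub, conv_add, conv_sub, e3, mul_comm (F.S 0 _ _ _)]
      simp only [cOne, one_smul]
      abel

end Frame

end CKP

end

/-! ### The variations along the k-th flow and the invariance of the shift relation. -/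

noncomputable section

namespace CKP

variable {K : Type*} [CommRing K] [Algebra ℚ K] {ι κ : Type*} {m : ℕ}

open Ix Op

/-- The weight `p + k / 2`. -/
def Ix.wt (k : ℕ) : Ix m → ℚ
  | ix p _ => p + (k : ℚ) / 2
  | _ => 0

/-- The shift of the exponent by `k - 1`. -/
def Ix.lift (k : ℕ) : Ix m → Ix m
  | ix p i => ix (p + k - 1) i
  | _ => zero

theorem Ix.ok_lift_left (k : ℕ) (α β : Ix m) : Ok (lift k α) β := Or.inl (by cases α <;> nofun)
theorem Ix.ok_lift_right (k : ℕ) (α β : Ix m) : Ok α (lift k β) := Or.inr (by cases β <;> nofun)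

namespace Frame

/-- The variation of the antiderivatives along the `k`-th flow, where `Y` is `M L^k`. -/
def dS (F : Frame K m) (Y : Op K) (k : ℕ) (α β : Ix m) : Fn K :=
  om Y (F.r α) (F.l β) + wt k α • F.s (lift k α) β + wt k β • F.s α (lift k β)
    + F.quad cX (k - 1) α β

/-- The variation of the right vectors along the `k`-th flow. -/
def dR (F : Frame K m) (Y : Op K) (k : ℕ) (α : Ix m) : Fn K :=
  nxtR Y (F.r α) (F.qR cX (k - 1) α) + wt k α • F.s (lift k α) inf

/-- The variation of the left vectors along the `k`-th flow. -/
def dL (F : Frame K m) (Y : Op K) (k : ℕ) (β : Ix m) : Fn K :=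
  -nxtL Y (F.l β) (F.qL cX (k - 1) β) - wt k β • F.s inf (lift k β)

variable {F : Frame K m}

theorem some_s_inf {K : Type*} [CommRing K] {F : Frame K m} (k : ℕ) (α : Ix m) :
    some (F.s (lift k α) inf) = F.r (lift k α) := by
  cases α <;> rfl

theorem some_inf_s {K : Type*} [CommRing K] {F : Frame K m} (k : ℕ) (β : Ix m) :
    some (-F.s inf (lift k β)) = F.l (lift k β) := by
  cases β
  · exact congrArg some neg_zero
  · exact congrArg some neg_zero
  · exact congrArg some (neg_neg _)

theorem om_dR (A Y : Op K) (k : ℕ) (α β : Ix m) :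
    om A (some (F.dR Y k α)) (F.l β) =
      om A (some (nxtR Y (F.r α) (F.qR cX (k - 1) α))) (F.l β)
        + wt k α • om A (F.r (lift k α)) (F.l β) := by
  rw [dR, ← some_s_inf, ← omR_apply, map_add, map_smul]
  rfl

theorem om_dL (A Y : Op K) (k : ℕ) (α β : Ix m) :
    om A (F.r α) (some (F.dL Y k β)) =
      -om A (F.r α) (some (nxtL Y (F.l β) (F.qL cX (k - 1) β)))
        + wt k β • om A (F.r α) (F.l (lift k β)) := by
  rw [dL, ← some_inf_s, ← omL_apply, sub_eq_add_neg, ← smul_neg, map_add, map_smul, map_neg]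
  rfl

/-- Raising the exponent raises the weight p + k/2 by one; the extra term is what L^k = [L, M L^k]
contributes. The case p = k = 0 is separate because p + k - 1 truncates, with weight zero. -/
theorem wt_sh_left (k : ℕ) (α β : Ix m) : wt k (sh 1 α) • F.s (lift k (sh 1 α)) β =
    wt k α • F.s (sh 1 (lift k α)) β + F.s (sh k α) β := by
  cases α with
  | inf => simp [sh, wt, lift, s_zero_left]
  | zero => simp [sh, wt, lift, s_zero_left]
  | ix p i =>
    rcases Nat.eq_zero_or_pos (p + k) with h | h
    · obtain ⟨rfl, rfl⟩ := Nat.add_eq_zero_iff.1 h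
      simp [sh, wt, lift]
    · simp only [sh, wt, lift]
      rw [show p + 1 + k - 1 = p + k by omega, show p + k - 1 + 1 = p + k by omega]
      push_cast
      module

theorem wt_sh_right (k : ℕ) (α β : Ix m) : wt k (sh 1 β) • F.s α (lift k (sh 1 β)) =
    wt k β • F.s α (sh 1 (lift k β)) + F.s α (sh k β) := by
  cases β with
  | inf => simp [sh, wt, lift, s_zero_right]
  | zero => simp [sh, wt, lift, s_zero_right]
  | ix p i =>
    rcases Nat.eq_zero_or_pos (p + k) with h | h
    · obtain ⟨rfl, rfl⟩ := Nat.add_eq_zero_iff.1 h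
      simp [sh, wt, lift]
    · simp only [sh, wt, lift]
      rw [show p + 1 + k - 1 = p + k by omega, show p + k - 1 + 1 = p + k by omega]
      push_cast
      module

/-- The generator of the `k`-th flow. -/
def gen (F : Frame K m) (Y : Op K) (k : ℕ) : Op K := -minus Y + F.gh cX (k - 1)

/-- The generator equals -Y + (Y₊ + X), and -[Y, L] = L^k. This exposes a commutator of two
operators of the form "differential plus integral part". -/
theorem gen_comm {L Y : Op K} {k : ℕ} (hL : F.IsLax L) (hY : L * Y - Y * L = L ^ k) :
    F.gen Y k * L - L * F.gen Y k = L ^ k +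
      ((plus Y + F.gh cX (k - 1)) * (plus L + F.gh cOne 1)
        - (plus L + F.gh cOne 1) * (plus Y + F.gh cX (k - 1))) := by
  rw [← hL.eq, ← hY, gen]
  conv_rhs => enter [1]; rw [← plus_add_minus Y]
  noncomm_ring

/-- The shift relation of the antiderivatives is preserved. -/
theorem IsLax.dS_shift {L Y : Op K} {k : ℕ} (hF : F.IsPot) (hL : F.IsLax L)
    (hY : L * Y - Y * L = L ^ k) {α β : Ix m} (h : Ok α β) :
    F.dS Y k (sh 1 α) β - F.dS Y k α (sh 1 β) =
      om (F.gen Y k * L - L * F.gen Y k) (F.r α) (F.l β) + om L (some (F.dR Y k α)) (F.l β)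
        + om L (F.r α) (some (F.dL Y k β))
        + ∑ x, (F.dS Y k α (ix 0 x) * F.s (ix 0 x) β + F.s α (ix 0 x) * F.dS Y k (ix 0 x) β) := by
  rw [gen_comm hL hY, om_add, ← om_plus (_ - _) (ok_ne h),
    om_plus_comm hF (isPlus_plus _) (isPlus_plus _) h, om_dR, om_dL]
  simp only [nxtR_plus, nxtL_plus]
  rw [← hL.r_sh, ← hL.l_sh, conv_one, om_plus _ (ok_ne (ok_sh_left 1 α β)),
    om_plus _ (ok_ne (ok_sh_right 1 α β)), om_plus L (Or.inl (by simp)),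
    om_plus L (Or.inr (by simp))]
  have hs : ∀ {α β : Ix m}, Ok α β → om L (F.r α) (F.l β) =
      F.s (sh 1 α) β - F.s α (sh 1 β) - ∑ x, F.s α (ix 0 x) * F.s (ix 0 x) β := fun h => by
    rw [hL.shift h, add_sub_cancel_right]
  have e0 : ∀ a x, om (plus L) (F.r (ix a x)) (F.l β) =
      F.s (ix (a + 1) x) β - F.s (ix a x) (sh 1 β)
        - ∑ y, F.s (ix a x) (ix 0 y) * F.s (ix 0 y) β :=
    fun a x => by rw [om_plus _ (ok_ne (ok_ix_left _ _ _)), hs (ok_ix_left _ _ _)]; rfl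
  have e1 : ∀ b x, om (plus L) (F.r α) (F.l (ix b x)) =
      F.s (sh 1 α) (ix b x) - F.s α (ix (b + 1) x) - ∑ y, F.s α (ix 0 y) * F.s (ix 0 y) (ix b x) :=
    fun b x => by rw [om_plus _ (ok_ne (ok_ix_right _ _ _)), hs (ok_ix_right _ _ _)]; rfl
  -- Eliminating the pairing with L₊ by the shift relation leaves a telescoping sum, a change of
  -- `quad` under the shift of α and β, and quadratic corrections through the index-0 row.
  have e2 : conv (fun a b => cX a b • ∑ x, (F.s α (ix b x) * om (plus L) (F.r (ix a x)) (F.l β)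
      + F.s (ix a x) β * om (plus L) (F.r α) (F.l (ix b x)))) (k - 1) =
      conv (fun a b => cX a b • (∑ x, F.s α (ix b x) * F.s (ix (a + 1) x) β
        - ∑ x, F.s α (ix (b + 1) x) * F.s (ix a x) β)) (k - 1)
      + F.quad cX (k - 1) (sh 1 α) β - F.quad cX (k - 1) α (sh 1 β)
      - ∑ y, (F.quad cX (k - 1) α (ix 0 y) * F.s (ix 0 y) β
        + F.s α (ix 0 y) * F.quad cX (k - 1) (ix 0 y) β) := by
    have e3 : ∑ y, (F.quad cX (k - 1) α (ix 0 y) * F.s (ix 0 y) β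
        + F.s α (ix 0 y) * F.quad cX (k - 1) (ix 0 y) β) =
        conv (fun a b => cX a b • ∑ x, (F.s α (ix b x) * ∑ y, F.s (ix a x) (ix 0 y) * F.s (ix 0 y) β
          + F.s (ix a x) β * ∑ y, F.s α (ix 0 y) * F.s (ix 0 y) (ix b x))) (k - 1) := by
      simp only [quad, conv_mul, mul_conv, ← conv_add, ← conv_sum]
      refine conv_congr _ fun a b _ => ?_
      simp only [smul_mul_assoc, mul_smul_comm, ← smul_add, ← Finset.smul_sum, Finset.sum_mul,
        Finset.mul_sum, ← Finset.sum_add_distrib]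
      rw [Finset.sum_comm]
      congr 1
      exact Finset.sum_congr rfl fun y _ => Finset.sum_congr rfl fun x _ => by ring
    rw [e3, quad, quad, ← conv_add, ← conv_sub, ← conv_sub]
    refine conv_congr _ fun a b _ => ?_
    simp only [← smul_add, ← smul_sub, e0, e1, ← Finset.sum_sub_distrib, ← Finset.sum_add_distrib]
    congr 1
    exact Finset.sum_congr rfl fun x _ => by ring
  have e4 := conv_telescope (fun a b => ∑ x, F.s α (ix b x) * F.s (ix a x) β) (k - 1)
  have e5 : conv (fun a b => cX a b • (∑ x, F.s α (ix b x) * F.s (ix (a + 1) x) β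
        - ∑ x, F.s α (ix (b + 1) x) * F.s (ix a x) β)) (k - 1) =
      F.quad cOne k α β - ((k : ℚ) / 2) • (∑ x, F.s α (ix 0 x) * F.s (ix (k - 1) x) β)
        - ((k : ℚ) / 2) • (∑ x, F.s α (ix (k - 1) x) * F.s (ix 0 x) β) := by
    rw [e4, sub_sub, ← smul_add]
    -- For k = 0 the truncated k - 1 + 1 equals 1 rather than k; the one remaining term then cancels
    -- against the two boundary halves, and both sides are zero.
    rcases k with _ | k
    · simp [conv_one, quad, conv_zero]
      module
    · simp [quad, cOne]
  have e6 := (hL.pow hF k).1 α β h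
  rw [e2, e5, hs (ok_lift_left k α β), hs (ok_lift_right k α β)]
  have e7 : ∑ x, (F.dS Y k α (ix 0 x) * F.s (ix 0 x) β + F.s α (ix 0 x) * F.dS Y k (ix 0 x) β) =
      ∑ x, (F.s α (ix 0 x) * om Y (F.r (ix 0 x)) (F.l β)
        + F.s (ix 0 x) β * om Y (F.r α) (F.l (ix 0 x)))
      + wt k α • ∑ x, F.s (lift k α) (ix 0 x) * F.s (ix 0 x) β
      + wt k β • ∑ x, F.s α (ix 0 x) * F.s (ix 0 x) (lift k β)
      + ((k : ℚ) / 2) • (∑ x, F.s α (ix 0 x) * F.s (ix (k - 1) x) β)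
      + ((k : ℚ) / 2) • (∑ x, F.s α (ix (k - 1) x) * F.s (ix 0 x) β)
      + ∑ y, (F.quad cX (k - 1) α (ix 0 y) * F.s (ix 0 y) β
        + F.s α (ix 0 y) * F.quad cX (k - 1) (ix 0 y) β) := by
    simp only [Finset.smul_sum, ← Finset.sum_add_distrib]
    refine Finset.sum_congr rfl fun x _ => ?_
    have : lift k (ix 0 x : Ix m) = ix (k - 1) x := by simp [lift]
    have hw : wt k (ix 0 x : Ix m) = (k : ℚ) / 2 := by simp [wt]
    simp only [dS, this, hw, add_mul, mul_add, smul_mul_assoc, mul_smul_comm]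
    ring
  have e8 : ∑ x, (F.s α (ix 0 x) * om (plus Y) (F.r (ix 0 x)) (F.l β)
        + F.s (ix 0 x) β * om (plus Y) (F.r α) (F.l (ix 0 x))) =
      ∑ x, (F.s α (ix 0 x) * om Y (F.r (ix 0 x)) (F.l β)
        + F.s (ix 0 x) β * om Y (F.r α) (F.l (ix 0 x))) :=
    Finset.sum_congr rfl fun x _ => by
      rw [om_plus _ (ok_ne (ok_ix_left _ _ _)), om_plus _ (ok_ne (ok_ix_right _ _ _))]
  rw [e7]
  simp only [cOne, one_smul, e8]
  -- The unit increments of the weights give s(sh k α, β) - s(α, sh k β), which `e6` identifies with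
  -- the pairing of L^k plus the sum left over by the telescoping.
  rw [dS, dS, wt_sh_left, wt_sh_right]
  simp only [smul_sub]
  linear_combination e6

end Frame

end CKP

end

/-! ### Invariance of the constraint and compatibility with the time evolution. -/

noncomputable section

namespace CKP

variable {K : Type*} [CommRing K] [Algebra ℚ K] {ι κ : Type*} {m : ℕ}

open Ix Op

theorem Op.dt_ghost (n : ℕ+) (f g : Fn K) :
    Op.dt n (ghost f g) = ghost (CKP.dt n f) g + ghost f (CKP.dt n g) := by
  simp only [ghost, Op.dt_mul, Op.dt_fn, Op.dt_D, mul_zero, add_zero]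

namespace Frame

variable {F : Frame K m}

theorem dR_ix (Y : Op K) (k p : ℕ) (i : Fin m) : F.dR Y k (ix p i) =
    act Y (F.f p i) + F.qR cX (k - 1) (ix p i) + ((p : ℚ) + k / 2) • F.f (p + k - 1) i := rfl

theorem dL_ix (Y : Op K) (k q : ℕ) (j : Fin m) : F.dL Y k (ix q j) =
    -adj Y (F.g q j) + F.qL cX (k - 1) (ix q j) + ((q : ℚ) + k / 2) • F.g (q + k - 1) j := by
  simp only [dL, nxtL, l, s, lift, wt, smul_neg]
  abel

/-- The variations of f_p and of -g_q are the boundary values of `dS`, so identities for `dS`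
contain those for `dR` and `dL`. -/
theorem dS_inf_right (Y : Op K) (k p : ℕ) (i : Fin m) :
    F.dS Y k (ix p i) inf = F.dR Y k (ix p i) := by
  rw [dR_ix, dS, quad_inf_right]
  simp only [r, l, om_none_right, wt, lift, s, zero_smul]
  abel

theorem dS_inf_left (Y : Op K) (k q : ℕ) (j : Fin m) :
    F.dS Y k inf (ix q j) = -F.dL Y k (ix q j) := by
  rw [dL_ix, dS, quad_inf_left]
  simp only [r, l, om_none_left, wt, lift, s, zero_smul, smul_neg]
  abel

theorem dR_inf (Y : Op K) (k : ℕ) : F.dR Y k inf = 0 := by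
  simp [dR, nxtR, r, wt]
theorem dL_inf (Y : Op K) (k : ℕ) : F.dL Y k inf = 0 := by
  simp [dL, nxtL, l, wt]

theorem gen_le (Y : Op K) (k : ℕ) : (F.gen Y k).Le (-1) := by
  rw [gen, neg_add_eq_sub]
  exact (gh_le _ _).sub (le_minus _)

/-- Each product of two terms is resolved by `ghost_mul_ghost` with S as antiderivative; the double
sum is then collected in either order. -/
theorem gh_mul_gh (hF : F.IsPot) (c c' : ℕ → ℕ → ℚ) (k k' : ℕ) :
    F.gh c k * F.gh c' k' =
      conv (fun a b => c' a b • ∑ x, ghost (F.qR c k (ix a x)) (F.g b x)) k'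
        - conv (fun a b => c a b • ∑ x, ghost (F.f a x) (F.qL c' k' (ix b x))) k := by
  have h1 : F.gh c k * F.gh c' k' = conv (fun a b => conv (fun a' b' => ∑ x, ∑ y,
      (c a b * c' a' b') • (ghost (F.f a x * F.S a' b y x) (F.g b' y) -
        ghost (F.f a x) (F.S a' b y x * F.g b' y))) k') k := by
    rw [gh, gh, conv_mul]
    refine conv_congr k fun a b _ => ?_
    rw [mul_conv]
    refine conv_congr k' fun a' b' _ => ?_
    rw [smul_mul_smul_comm, Finset.sum_mul_sum]
    simp only [Finset.smul_sum]
    exact Finset.sum_congr rfl fun x _ => Finset.sum_congr rfl fun y _ =>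
      congrArg _ (ghost_mul_ghost _ _ _ _ _ (by rw [hF, mul_comm]))
  have h2 : conv (fun a b => c a b • ∑ x, ghost (F.f a x) (F.qL c' k' (ix b x))) k =
      conv (fun a b => conv (fun a' b' => ∑ x, ∑ y,
        (c a b * c' a' b') • ghost (F.f a x) (F.S a' b y x * F.g b' y)) k') k := by
    refine conv_congr k fun a b _ => ?_
    rw [Finset.smul_sum, conv_sum]
    refine Finset.sum_congr rfl fun x _ => ?_
    simp only [qL, conv, ghost_sum_right, ghost_smul_right, Finset.smul_sum, s, mul_comm,
      smul_smul]
  have h3 : conv (fun a b => c' a b • ∑ x, ghost (F.qR c k (ix a x)) (F.g b x)) k' =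
      conv (fun a b => conv (fun a' b' => ∑ x, ∑ y,
        (c a b * c' a' b') • ghost (F.f a x * F.S a' b y x) (F.g b' y)) k') k := by
    have : ∀ h : ℕ → ℕ → ℕ → ℕ → Op K, conv (fun a b => conv (fun a' b' => h a b a' b') k') k =
        conv (fun a' b' => conv (fun a b => h a b a' b') k) k' := fun h => Finset.sum_comm
    rw [this]
    refine conv_congr k' fun a b _ => ?_
    rw [Finset.smul_sum]
    simp only [conv_sum (ι := Fin m)]
    rw [Finset.sum_comm]
    refine Finset.sum_congr rfl fun x _ => ?_
    simp only [qR, conv, ghost_sum_left, ghost_smul_left, Finset.smul_sum, s, smul_smul,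
      mul_comm (c _ _)]
    exact Finset.sum_comm
  rw [h1, h2, h3, ← conv_sub]
  refine conv_congr k fun a b _ => ?_
  rw [← conv_sub]
  simp only [← Finset.sum_sub_distrib, ← smul_sub]

theorem minus_mul_gh {B : Op K} (hB : B.IsPlus) (c : ℕ → ℕ → ℚ) (k : ℕ) :
    minus (B * F.gh c k) = conv (fun a b => c a b • ∑ x, ghost (act B (F.f a x)) (F.g b x)) k := by
  rw [gh, mul_conv, map_conv]
  refine conv_congr k fun a b _ => ?_
  rw [mul_smul_comm, map_smul, Finset.mul_sum, map_sum]
  simp only [minus_mul_ghost hB]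

theorem minus_gh_mul {B : Op K} (hB : B.IsPlus) (c : ℕ → ℕ → ℚ) (k : ℕ) :
    minus (F.gh c k * B) = conv (fun a b => c a b • ∑ x, ghost (F.f a x) (adj B (F.g b x))) k := by
  rw [gh, conv_mul, map_conv]
  refine conv_congr k fun a b _ => ?_
  rw [smul_mul_assoc, map_smul, Finset.sum_mul, map_sum]
  simp only [minus_ghost_mul hB]

theorem minus_comm {B B' : Op K} (hB : B.IsPlus) (hB' : B'.IsPlus) (c c' : ℕ → ℕ → ℚ) (k k' : ℕ) :
    minus ((B + F.gh c k) * (B' + F.gh c' k') - (B' + F.gh c' k') * (B + F.gh c k)) =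
      minus (B * F.gh c' k') - minus (F.gh c' k' * B)
        - (minus (B' * F.gh c k) - minus (F.gh c k * B'))
        + (F.gh c k * F.gh c' k' - F.gh c' k' * F.gh c k) := by
  have h1 : ∀ (c c' : ℕ → ℕ → ℚ) k k', minus (F.gh c k * F.gh c' k') = F.gh c k * F.gh c' k' :=
    fun c c' k k' => minus_of_le (((gh_le c k).mul (gh_le c' k')).mono (by norm_num))
  simp only [add_mul, mul_add, map_sub, map_add, h1, minus_of_isPlus (hB.mul hB'),
    minus_of_isPlus (hB'.mul hB)]
  abel

/-- The constraint on `L` is preserved. -/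
theorem IsLax.minus_gen_comm {L Y : Op K} {k : ℕ} (hF : F.IsPot) (hL : F.IsLax L)
    (hY : L * Y - Y * L = L ^ k) :
    minus (F.gen Y k * L - L * F.gen Y k) =
      ∑ x, (ghost (F.dR Y k (ix 0 x)) (F.g 0 x) + ghost (F.f 0 x) (F.dL Y k (ix 0 x))) := by
  rw [gen_comm hL hY, map_add, (hL.pow hF k).2, minus_comm (isPlus_plus _) (isPlus_plus _),
    minus_mul_gh (isPlus_plus _), minus_mul_gh (isPlus_plus _), minus_gh_mul (isPlus_plus _),
    minus_gh_mul (isPlus_plus _), gh_mul_gh hF, gh_mul_gh hF]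
  simp only [conv_one, act_plus, adj_plus]
  have e1 : ∀ a x, act L (F.f a x) = F.f (a + 1) x - F.qR cOne 1 (ix a x) := fun a x => by
    rw [hL.f_succ, qR, conv_one, cOne, one_smul]
    simp [s]
  have e2 : ∀ b x, adj L (F.g b x) = F.g (b + 1) x + F.qL cOne 1 (ix b x) := fun b x => by
    rw [hL.g_succ, qL, conv_one, cOne, one_smul]
    simp [s]
  have e3 := conv_telescope (fun a b => ∑ x, ghost (F.f a x) (F.g b x)) (k - 1)
  have e5 : conv (fun a b => cX a b • (∑ x, ghost (F.f (a + 1) x) (F.g b x)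
        - ∑ x, ghost (F.f a x) (F.g (b + 1) x))) (k - 1) =
      F.gh cOne k - ((k : ℚ) / 2) • (∑ x, ghost (F.f (k - 1) x) (F.g 0 x))
        - ((k : ℚ) / 2) • (∑ x, ghost (F.f 0 x) (F.g (k - 1) x)) := by
    rw [e3, sub_sub, ← smul_add]
    rcases k with _ | k
    · simp [conv_one, gh, conv_zero]
      module
    · simp [gh, cOne]
  simp only [smul_sub, conv_sub] at e5
  simp only [e1, e2, ghost_sub_left, ghost_add_right, dR_ix, dL_ix, Finset.sum_sub_distrib,
    Finset.sum_add_distrib, smul_add, smul_sub, conv_add, conv_sub, ghost_add_left,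
    ghost_neg_right, ghost_smul_left, ghost_smul_right, ← Finset.smul_sum,
    Finset.sum_neg_distrib, cOne, one_smul, Nat.cast_zero, zero_add] at e5 ⊢
  rw [← sub_eq_zero] at e5 ⊢
  rw [← neg_eq_zero, ← e5]
  abel

/-- This is the linearisation of ∂_n S = Ω_{R₊}(f, g) along the flow. In [G, R]₊ only R₊ matters,
since [G, R₋] has negative order, and ∂_n Y = [R₊, Y] turns it into the operator term of
`dt_pairing`. -/
theorem IsEvol.dS {R Y : Op K} {k : ℕ} {n : ℕ+} (hF : F.IsPot) (hE : F.IsEvol n (plus R))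
    (hY : Op.dt n Y = plus R * Y - Y * plus R) {α β : Ix m} (h : Ok α β) :
    CKP.dt n (F.dS Y k α β) = om (F.gen Y k * R - R * F.gen Y k) (F.r α) (F.l β)
      + om (plus R) (some (F.dR Y k α)) (F.l β) + om (plus R) (F.r α) (some (F.dL Y k β)) := by
  have h1 := dt_pairing hF (isPlus_plus R) (isPlus_plus Y) hE h cX (k - 1)
  rw [om_plus Y (ok_ne h)] at h1
  have h2 : om (F.gen Y k * R - R * F.gen Y k) (F.r α) (F.l β) =
      om (Op.dt n (plus Y) - plus (plus R * (plus Y + F.gh cX (k - 1))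
        - (plus Y + F.gh cX (k - 1)) * plus R)) (F.r α) (F.l β) := by
    rw [← om_plus (_ - _) (ok_ne h), ← plus_dt, hY, ← map_sub]
    congr 1
    have h3 : F.gen Y k * R - R * F.gen Y k = F.gen Y k * plus R - plus R * F.gen Y k
        + (F.gen Y k * minus R - minus R * F.gen Y k) := by
      conv_lhs => rw [← plus_add_minus R]
      noncomm_ring
    rw [h3, map_add, plus_of_le (A := _ * minus R - _), add_zero]
    · congr 1
      rw [gen]
      conv_rhs => enter [1]; rw [← plus_add_minus Y]
      noncomm_ring
    · exact (((gen_le Y k).mul (le_minus R)).sub ((le_minus R).mul (gen_le Y k))).mono (by norm_num)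
  rw [h2, om_dR, om_dL]
  have h4 : ∀ γ δ : Ix m, F.dS Y k γ δ = om Y (F.r γ) (F.l δ) + F.quad cX (k - 1) γ δ
      + wt k γ • F.s (lift k γ) δ + wt k δ • F.s γ (lift k δ) := fun γ δ => by rw [Frame.dS]; abel
  rw [h4, dt_add, dt_add, h1, dt_qsmul, dt_qsmul, hE.s (ok_lift_left _ _ _),
    hE.s (ok_lift_right _ _ _)]
  simp only [nxtR_plus, nxtL_plus]
  abel

/-- For the integral part this is the evolution of f and g; for -Y₋ it holds because [R₊, Y₊] has no
negative part. It supplies the linearised Sato–Wilson equations. -/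
theorem IsEvol.dt_gen {R Y : Op K} {k : ℕ} {n : ℕ+} (hE : F.IsEvol n (plus R))
    (hY : Op.dt n Y = plus R * Y - Y * plus R) :
    Op.dt n (F.gen Y k) = minus (plus R * F.gen Y k - F.gen Y k * plus R) := by
  have h1 : Op.dt n (F.gh cX (k - 1)) =
      minus (plus R * F.gh cX (k - 1) - F.gh cX (k - 1) * plus R) := by
    rw [map_sub, minus_mul_gh (isPlus_plus R), minus_gh_mul (isPlus_plus R), ← conv_sub, gh,
      map_conv]
    refine conv_congr _ fun a b _ => ?_
    simp only [map_smul, map_sum, dt_ghost, hE.f, hE.g, ghost_neg_right, ← smul_sub,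
      ← Finset.sum_sub_distrib, ← sub_eq_add_neg]
  have h2 : minus (plus R * Y - Y * plus R) = minus (plus R * minus Y - minus Y * plus R) := by
    have : plus R * Y - Y * plus R = (plus R * plus Y - plus Y * plus R)
        + (plus R * minus Y - minus Y * plus R) := by
      conv_lhs => rw [← plus_add_minus Y]
      noncomm_ring
    rw [this, map_add, minus_of_isPlus, zero_add]
    exact ((isPlus_plus R).mul (isPlus_plus Y)).sub ((isPlus_plus Y).mul (isPlus_plus R))
  rw [gen, map_add, map_neg, ← minus_dt, hY, h1, h2, ← map_neg, ← map_add]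
  congr 1
  noncomm_ring

end Frame

/-! ### The Virasoro relations for the generators. -/

/-- The combinatorial identity behind the Virasoro relations. -/
theorem conv_virasoro {V : Type*} [AddCommGroup V] [Module ℚ V] (h : ℕ → ℕ → V) (k l : ℕ) :
    conv (fun a b => cX a b • (((a : ℚ) + l / 2) • h (a + l - 1) b
        + ((b : ℚ) + l / 2) • h a (b + l - 1))) (k - 1)
      - conv (fun a b => cX a b • (((a : ℚ) + k / 2) • h (a + k - 1) b
        + ((b : ℚ) + k / 2) • h a (b + k - 1))) (l - 1) =
      ((k : ℚ) - l) • conv (fun a b => cX a b • h a b) (k + l - 1 - 1) := by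
  -- Subtraction truncates when one of the two exponents is 0, so that case is settled separately.
  have h0 : ∀ l : ℕ, conv (fun a b => cX a b • (((a : ℚ) + (0 : ℕ) / 2) • h (a + 0 - 1) b
        + ((b : ℚ) + (0 : ℕ) / 2) • h a (b + 0 - 1))) (l - 1) =
      (l : ℚ) • conv (fun a b => cX a b • h a b) (l - 1 - 1) := fun l => by
    rcases l with _ | _ | n
    · simp [conv_zero]
    · simp [conv_zero]
    · simp only [smul_add, conv_add, Nat.add_sub_cancel]
      rw [conv_succ_left, conv_succ_right]
      simp only [conv, Finset.smul_sum]
      simp only [CharP.cast_eq_zero, zero_div, add_zero, zero_smul, smul_zero,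
        ← Finset.sum_add_distrib]
      refine Finset.sum_congr rfl fun j hj => ?_
      have hj := Finset.mem_range.1 hj
      obtain ⟨a, rfl⟩ : ∃ a, n = a + j + 1 := ⟨n - j - 1, by omega⟩
      rw [show a + j + 1 - 1 - j = a by omega]
      simp only [cX]
      push_cast
      module
  rcases k with _ | k
  · rw [h0, Nat.zero_sub, conv_zero, zero_add]
    push_cast
    module
  rcases l with _ | l
  · rw [h0, Nat.zero_sub, conv_zero, add_zero]
    push_cast
    module
  -- With P_{k,l}(j) = (2j - k + 1)(2k - 2j + l - 1)/4, the four sums are heads and tails of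
  -- ∑_{j<k+l} P_{k,l}(j) h and ∑_{j<k+l} P_{l,k}(j) h, in which h is taken at (k + l - 1 - j, j).
  -- The tails enter with opposite sign, and P_{k,l} - P_{l,k} is k - l times the coefficient `cX`.
  have h1 : ∀ k l : ℕ, conv (fun a b => cX a b • (((a : ℚ) + (l + 1 : ℕ) / 2) • h (a + l) b)) k =
      ∑ j ∈ Finset.range k, ((2 * (j : ℚ) - k + 1) * (2 * k - 2 * j + l - 1) / 4) •
        h (k + l - 1 - j) j := fun k l => Finset.sum_congr rfl fun j hj => by
    have hj := Finset.mem_range.1 hj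
    obtain ⟨a, rfl⟩ : ∃ a, k = a + j + 1 := ⟨k - j - 1, by omega⟩
    rw [show a + j + 1 - 1 - j = a by omega, show a + j + 1 + l - 1 - j = a + l by omega]
    simp only [cX]
    push_cast
    module
  have h2 : ∀ k l : ℕ, conv (fun a b => cX a b • (((b : ℚ) + (l + 1 : ℕ) / 2) • h a (b + l))) k =
      -∑ j ∈ Finset.range k,
          ((2 * ((l + j : ℕ) : ℚ) - l + 1) * (2 * l - 2 * (l + j : ℕ) + k - 1) / 4) •
        h (l + k - 1 - (l + j)) (l + j) := fun k l => by
    rw [← Finset.sum_neg_distrib]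
    refine Finset.sum_congr rfl fun j hj => ?_
    have hj := Finset.mem_range.1 hj
    obtain ⟨a, rfl⟩ : ∃ a, k = a + j + 1 := ⟨k - j - 1, by omega⟩
    rw [show a + j + 1 - 1 - j = a by omega, show l + (a + j + 1) - 1 - (l + j) = a by omega]
    simp only [cX, add_comm j l]
    push_cast
    module
  simp only [smul_add, conv_add, Nat.add_sub_cancel, ← Nat.add_assoc]
  rw [h1 k l, h2 k l, h1 l k, h2 l k]
  have h3 := Finset.sum_range_add (fun j => ((2 * (j : ℚ) - k + 1) * (2 * k - 2 * j + l - 1) / 4) •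
        h (k + l - 1 - j) j) k l
  have h4 := Finset.sum_range_add (fun j => ((2 * (j : ℚ) - l + 1) * (2 * l - 2 * j + k - 1) / 4) •
        h (l + k - 1 - j) j) l k
  have h5 : ((k + 1 : ℕ) - (l + 1 : ℕ) : ℚ) • conv (fun a b => cX a b • h a b) (k + l) =
      ∑ j ∈ Finset.range (k + l), ((2 * (j : ℚ) - k + 1) * (2 * k - 2 * j + l - 1) / 4) •
        h (k + l - 1 - j) j
      - ∑ j ∈ Finset.range (l + k), ((2 * (j : ℚ) - l + 1) * (2 * l - 2 * j + k - 1) / 4) •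
        h (l + k - 1 - j) j := by
    rw [conv, add_comm l k, ← Finset.sum_sub_distrib, Finset.smul_sum]
    refine Finset.sum_congr rfl fun j hj => ?_
    have hj := Finset.mem_range.1 hj
    rw [cX, Nat.cast_sub (by omega : j ≤ k + l - 1), Nat.cast_sub (by omega : 1 ≤ k + l)]
    push_cast
    module
  rw [show k + 1 + l - 1 = k + l by omega, h5, h3, h4]
  abel

namespace Frame

variable {F : Frame K m}

/-- The variation of `gh` along the `l`-th flow. -/
def dgh (F : Frame K m) (Y : Op K) (l : ℕ) (c : ℕ → ℕ → ℚ) (k : ℕ) : Op K :=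
  conv (fun a b => c a b • ∑ x, (ghost (F.dR Y l (ix a x)) (F.g b x)
    + ghost (F.f a x) (F.dL Y l (ix b x)))) k

theorem dgh_eq (Y : Op K) (l k : ℕ) : F.dgh Y l cX (k - 1) =
    conv (fun a b => cX a b • ∑ x, ghost (act Y (F.f a x)) (F.g b x)) (k - 1)
      - conv (fun a b => cX a b • ∑ x, ghost (F.f a x) (adj Y (F.g b x))) (k - 1)
      + conv (fun a b => cX a b • ∑ x, ghost (F.qR cX (l - 1) (ix a x)) (F.g b x)) (k - 1)
      + conv (fun a b => cX a b • ∑ x, ghost (F.f a x) (F.qL cX (l - 1) (ix b x))) (k - 1)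
      + conv (fun a b => cX a b • (((a : ℚ) + l / 2) • ∑ x, ghost (F.f (a + l - 1) x) (F.g b x)
        + ((b : ℚ) + l / 2) • ∑ x, ghost (F.f a x) (F.g (b + l - 1) x))) (k - 1) := by
  simp only [dgh, dR_ix, dL_ix, ghost_add_left, ghost_add_right, ghost_neg_right, ghost_smul_left,
    ghost_smul_right, Finset.sum_add_distrib, smul_add, conv_add, Finset.sum_neg_distrib, smul_neg,
    conv_neg, ← Finset.smul_sum]
  abel

/-- The Virasoro relations for the generators of the flows. -/
theorem gen_virasoro (hF : F.IsPot) {Y : ℕ → Op K} {k l : ℕ}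
    (hY : Y l * Y k - Y k * Y l = ((l : ℚ) - k) • Y (k + l - 1)) :
    -minus (F.gen (Y l) l * Y k - Y k * F.gen (Y l) l) + F.dgh (Y l) l cX (k - 1)
      - (-minus (F.gen (Y k) k * Y l - Y l * F.gen (Y k) k) + F.dgh (Y k) k cX (l - 1))
      + (F.gen (Y k) k * F.gen (Y l) l - F.gen (Y l) l * F.gen (Y k) k) =
      ((k : ℚ) - l) • F.gen (Y (k + l - 1)) (k + l - 1) := by
  have h1 : minus (F.gen (Y k) k * F.gen (Y l) l - F.gen (Y l) l * F.gen (Y k) k) =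
      F.gen (Y k) k * F.gen (Y l) l - F.gen (Y l) l * F.gen (Y k) k :=
    minus_of_le ((((gen_le _ k).mul (gen_le _ l)).sub
      ((gen_le _ l).mul (gen_le _ k))).mono (by norm_num))
  have hA : ∀ k, F.gen (Y k) k = -Y k + (plus (Y k) + F.gh cX (k - 1)) := fun k => by
    rw [gen]
    conv_rhs => enter [1]; rw [← plus_add_minus (Y k)]
    abel
  -- Substituting G = -Y + N with N = Y₊ + X, all mixed commutators of Y and N cancel and [Y_l, Y_k]
  -- + [N_k, N_l] remains.
  have h2 : -(F.gen (Y l) l * Y k - Y k * F.gen (Y l) l)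
      + (F.gen (Y k) k * Y l - Y l * F.gen (Y k) k)
      + (F.gen (Y k) k * F.gen (Y l) l - F.gen (Y l) l * F.gen (Y k) k) =
      (Y l * Y k - Y k * Y l)
      + ((plus (Y k) + F.gh cX (k - 1)) * (plus (Y l) + F.gh cX (l - 1))
        - (plus (Y l) + F.gh cX (l - 1)) * (plus (Y k) + F.gh cX (k - 1))) := by
    rw [hA k, hA l]
    noncomm_ring
  have h3 := congrArg minus h2
  rw [map_add, map_add, map_add, h1, hY, map_neg, map_smul,
    minus_comm (isPlus_plus _) (isPlus_plus _),
    minus_mul_gh (isPlus_plus _), minus_mul_gh (isPlus_plus _), minus_gh_mul (isPlus_plus _),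
    minus_gh_mul (isPlus_plus _), gh_mul_gh hF, gh_mul_gh hF] at h3
  simp only [act_plus, adj_plus] at h3
  have h4 := conv_virasoro (fun a b => ∑ x, ghost (F.f a x) (F.g b x)) k l
  have h5 : ((k : ℚ) - l) • F.gen (Y (k + l - 1)) (k + l - 1) =
      ((l : ℚ) - k) • minus (Y (k + l - 1)) + ((k : ℚ) - l) • F.gh cX (k + l - 1 - 1) := by
    rw [gen]
    module
  rw [h5, gh, ← h4, dgh_eq, dgh_eq]
  rw [← sub_eq_zero] at h3 ⊢
  rw [← h3]
  abel

end Frame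

end CKP

end

/-! ### Dressing, Heisenberg commutators, and the Sato–Wilson equations. -/

noncomputable section

namespace CKP

variable {K : Type*} [CommRing K] [Algebra ℚ K] {ι κ : Type*} {m : ℕ}

open Ix Op

/-- Dressing by an invertible operator `W` with inverse `V`. -/
def conj (W V A : Op K) : Op K := W * A * V

section conj

variable {W V : Op K}

theorem conj_mul (h : V * W = 1) (A B : Op K) :
    conj W V A * conj W V B = conj W V (A * B) := by
  simp only [conj, mul_assoc]
  rw [← mul_assoc V W, h, one_mul]

theorem conj_sub (A B : Op K) : conj W V (A - B) = conj W V A - conj W V B := by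
  simp only [conj, mul_sub, sub_mul]

theorem conj_one (h : W * V = 1) : conj W V 1 = 1 := by rw [conj, mul_one, h]

theorem conj_comm (h : V * W = 1) (A B : Op K) :
    conj W V A * conj W V B - conj W V B * conj W V A = conj W V (A * B - B * A) := by
  rw [conj_mul h, conj_mul h, conj_sub]

theorem dt_inv {n : ℕ+} {A : Op K} (h1 : W * V = 1) (h2 : V * W = 1) (h : Op.dt n W = -(A * W)) :
    Op.dt n V = V * A := by
  have h3 : Op.dt n (W * V) = 0 := by rw [h1]; exact dt_D n 0
  rw [Op.dt_mul, h, neg_mul, mul_assoc, h1, mul_one, neg_add_eq_zero] at h3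
  rw [h3, ← mul_assoc, h2, one_mul]

theorem dt_conj {n : ℕ+} {A B : Op K} (h1 : W * V = 1) (h2 : V * W = 1)
    (h : Op.dt n W = -(A * W)) :
    Op.dt n (conj W V B) = conj W V (Op.dt n B) - (A * conj W V B - conj W V B * A) := by
  rw [conj, Op.dt_mul, Op.dt_mul, dt_inv h1 h2 h, h, conj]
  noncomm_ring

end conj

/-- The relations between the dressing operator `W`, its inverse `V` and the bare operator
`M⁽⁰⁾`. -/
structure IsDressing (r : ℕ) (W V M₀ : Op K) : Prop where
  mul_inv : W * V = 1
  inv_mul : V * W = 1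
  D_comm : ∀ n : ℕ, 1 ≤ n → D n * M₀ - M₀ * D n = ((n : ℚ) / r) • D ((n : ℤ) - r)

/-- The Sato–Wilson equations. -/
def IsSato (W V : Op K) : Prop := ∀ n : ℕ+, Op.dt n W = -(minus (conj W V (D n)) * W)

namespace IsDressing

variable {r : ℕ} {W V M₀ : Op K}

theorem root_comm (h : IsDressing r W V M₀) (a b : ℤ) :
    conj W V (D a) * conj W V (D b) = conj W V (D b) * conj W V (D a) := by
  rw [conj_mul h.inv_mul, conj_mul h.inv_mul, D_mul_D, D_mul_D, add_comm]

theorem L_comm_M (h : IsDressing r W V M₀) (hr : 1 ≤ r) :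
    conj W V (D r) * conj W V M₀ - conj W V M₀ * conj W V (D r) = 1 := by
  have : (r : ℚ) ≠ 0 := by exact_mod_cast (by omega : r ≠ 0)
  rw [conj_comm h.inv_mul, h.D_comm r hr, div_self this, one_smul, sub_self, D_zero,
    conj_one h.mul_inv]

end IsDressing

/-- Commutators in the Heisenberg algebra. -/
theorem pow_comm_of_comm_eq_one {R : Type*} [Ring R] {L M : R} (h : L * M - M * L = 1) (k : ℕ) :
    L ^ k * M - M * L ^ k = k * L ^ (k - 1) := by
  induction k with
  | zero => simp
  | succ k ih =>
    have h1 : L ^ (k + 1) * M - M * L ^ (k + 1) =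
        L * (L ^ k * M - M * L ^ k) + (L * M - M * L) * L ^ k := by
      rw [pow_succ']
      noncomm_ring
    rw [h1, ih, h, one_mul, ← mul_assoc, (Nat.cast_commute k L).symm.eq, mul_assoc]
    rcases k with _ | k
    · simp
    · rw [← pow_succ', Nat.add_sub_cancel, Nat.add_sub_cancel]
      push_cast
      noncomm_ring

theorem comm_mul_pow {R : Type*} [Ring R] {L M : R} (h : L * M - M * L = 1) (k : ℕ) :
    L * (M * L ^ k) - M * L ^ k * L = L ^ k := by
  have : L * (M * L ^ k) - M * L ^ k * L = (L * M - M * L) * L ^ k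
      + M * (L * L ^ k - L ^ k * L) := by noncomm_ring
  rw [this, h, one_mul, ← pow_succ', ← pow_succ, sub_self, mul_zero, add_zero]

/-- Normal ordering gives M L^l M L^k = M² L^(k+l) + l M L^(k+l-1), whose first term is symmetric in
k and l. For k = l = 0 the truncated exponent is harmless because its coefficient is zero. -/
theorem mul_pow_comm {R : Type*} [Ring R] [Algebra ℚ R] {L M : R} (h : L * M - M * L = 1)
    (k l : ℕ) : M * L ^ l * (M * L ^ k) - M * L ^ k * (M * L ^ l) =
      ((l : ℚ) - k) • (M * L ^ (k + l - 1)) := by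
  have h1 : ∀ k l : ℕ, M * L ^ l * (M * L ^ k) = M * M * L ^ (k + l)
      + (l : ℚ) • (M * L ^ (k + l - 1)) := fun k l => by
    have h2 := sub_eq_iff_eq_add.1 (pow_comm_of_comm_eq_one h l)
    rw [mul_assoc M, ← mul_assoc _ M, h2, add_mul, mul_add, mul_assoc M (L ^ l), ← pow_add,
      add_comm l k, add_comm, ← mul_assoc M M, mul_assoc (l : R), ← pow_add]
    rcases l with _ | l
    · simp
    · rw [show l + 1 - 1 + k = k + (l + 1) - 1 by omega, ← mul_assoc, ← (Nat.cast_commute _ _).eq,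
        mul_assoc, Nat.cast_smul_eq_nsmul ℚ, nsmul_eq_mul, mul_assoc]
  rw [h1, h1, add_comm l k]
  module

namespace IsSato

variable {r : ℕ} {W V M₀ : Op K}

/-- The first Sato–Wilson equation, with ∂₁W = [D, W], says W D W⁻¹ = D + (W D W⁻¹)₋. Hence the
t₁-equations of S give ∂S = f g. -/
theorem plus_root_one (h : IsSato W V) (h1 : W * V = 1) :
    plus (conj W V (D 1)) = D 1 := by
  have h2 := D_one_mul W
  have h3 := h 1
  rw [h3] at h2
  have h4 : conj W V (D 1) = D 1 + minus (conj W V (D 1)) := by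
    have h5 : W * D 1 = D 1 * W + minus (conj W V (D 1)) * W := by
      rw [h2]
      simp
    have h6 : conj W V (D 1) = (W * D 1) * V := rfl
    conv_lhs => rw [h6, h5, add_mul, mul_assoc, mul_assoc, h1, mul_one, mul_one]
  rw [h4, map_add, plus_of_isPlus (isPlus_D (by norm_num)), plus_of_le (le_minus _), add_zero]

/-- L^{n/r} and L^{k/r} commute, so -[A₋, ·] may be replaced by [A₊, ·]. -/
theorem dt_root (h : IsSato W V) (hD : IsDressing r W V M₀) (n : ℕ+) (k : ℤ) :
    Op.dt n (conj W V (D k)) = plus (conj W V (D n)) * conj W V (D k)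
      - conj W V (D k) * plus (conj W V (D n)) := by
  rw [dt_conj hD.mul_inv hD.inv_mul (h n), dt_D, conj, mul_zero, zero_mul, zero_sub]
  have h1 := hD.root_comm n k
  conv at h1 => enter [1, 1]; rw [← plus_add_minus (conj W V (D n))]
  conv at h1 => enter [2, 2]; rw [← plus_add_minus (conj W V (D n))]
  rw [add_mul, mul_add] at h1
  rw [neg_sub, sub_eq_sub_iff_add_eq_add, add_comm, h1.symm, add_comm]

/-- The explicit t_n-dependence satisfies ∂_n M⁽⁰⁾ = [D^n, M⁽⁰⁾]. After dressing it contributes the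
full commutator with L^{n/r}, from which the Sato–Wilson equation removes the negative part. -/
theorem dt_M (h : IsSato W V) (hD : IsDressing r W V M₀) (n : ℕ+)
    (hM : Op.dt n M₀ = ((n : ℚ) / r) • D ((n : ℤ) - r)) :
    Op.dt n (conj W V M₀) = plus (conj W V (D n)) * conj W V M₀
      - conj W V M₀ * plus (conj W V (D n)) := by
  rw [dt_conj hD.mul_inv hD.inv_mul (h n), hM]
  have h1 := hD.D_comm n n.pos
  rw [← h1, ← conj_comm hD.inv_mul]
  conv_lhs =>
    enter [1]; rw [← plus_add_minus (conj W V (D n))]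
  noncomm_ring

theorem dt_pow {R : Op K} {L : Op K} {n : ℕ+} (h : Op.dt n L = R * L - L * R) (k : ℕ) :
    Op.dt n (L ^ k) = R * L ^ k - L ^ k * R := by
  induction k with
  | zero => rw [pow_zero, mul_one, one_mul, sub_self]; exact dt_D n 0
  | succ k ih =>
    rw [pow_succ, Op.dt_mul, ih, h]
    noncomm_ring

theorem dt_ML {R M L : Op K} {n : ℕ+} (h : Op.dt n L = R * L - L * R)
    (h' : Op.dt n M = R * M - M * R) (k : ℕ) :
    Op.dt n (M * L ^ k) = R * (M * L ^ k) - M * L ^ k * R := by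
  rw [Op.dt_mul, dt_pow h, h']
  noncomm_ring

/-- The zero curvature equations. -/
theorem zero_curvature (h : IsSato W V) (hD : IsDressing r W V M₀) (a b : ℕ+) :
    Op.dt a (plus (conj W V (D b))) - Op.dt b (plus (conj W V (D a))) =
      plus (conj W V (D a)) * plus (conj W V (D b))
        - plus (conj W V (D b)) * plus (conj W V (D a)) := by
  set A := conj W V (D a) with hA
  set B := conj W V (D b) with hB
  have h1 : A * B - B * A = 0 := by rw [hA, hB, hD.root_comm, sub_self]
  -- Subtracting the vanishing commutator [A, B] leaves the curvature of the positive parts minus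
  -- [A₋, B₋], which has no positive part.
  have h2 : plus A * B - B * plus A - (plus B * A - A * plus B) =
      plus A * plus B - plus B * plus A - (minus A * minus B - minus B * minus A) := by
    rw [← sub_zero (_ - _ - (plus B * A - A * plus B)), ← h1]
    conv_lhs => rw [← plus_add_minus A, ← plus_add_minus B]
    simp only [map_add, plus_of_isPlus (isPlus_plus _), plus_of_le (le_minus _), add_zero]
    noncomm_ring
  rw [← plus_dt, ← plus_dt, hA, hB, h.dt_root hD, h.dt_root hD, ← hA, ← hB, ← map_sub, h2, map_sub,
    plus_of_isPlus
      (((isPlus_plus A).mul (isPlus_plus B)).sub ((isPlus_plus B).mul (isPlus_plus A))),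
    plus_of_le (A := minus A * minus B - minus B * minus A), sub_zero]
  exact (((le_minus A).mul (le_minus B)).sub ((le_minus B).mul (le_minus A))).mono (by norm_num)

end IsSato

/-- The leading coefficients are commuting functions, so the commutator loses one order more than
the products do. -/
theorem comm_le {A L : Op K} {r : ℤ} (hA : A.Le (-1)) (hL : L.Le r) :
    (A * L - L * A).Le (r - 2) := fun p hp => by
  rcases eq_or_ne p (r - 1) with rfl | h
  · have h1 := co_mul_top hA hL
    have h2 := co_mul_top hL hA
    rw [show (-1 : ℤ) + r = r - 1 by ring] at h1
    rw [show r + (-1 : ℤ) = r - 1 by ring] at h2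
    rw [co_sub, h1, h2, mul_comm, sub_self]
  · exact ((hA.mul hL).mono (by omega)).sub ((hL.mul hA).mono (by omega)) p
      (show r - 1 < p by omega)

end CKP

end

/-! ### A solution of the hierarchy as a dressing with an evolving frame. -/

noncomputable section

namespace CKP

variable {K : Type*} [CommRing K] [Algebra ℚ K] {ι κ : Type*} {m : ℕ}

open Ix Op

theorem Op.om_D_one (f g : Fn K) : om (D 1) (some f) (some g) = f * g := by
  have h : (D 1 : Op K) * (fn f * D (-1)) = fn f + fn (dx f) * D (-1) := by
    rw [← mul_assoc, D_one_mul_fn, add_mul, mul_assoc, D_one_mul_D, mul_one]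
  rw [om, rv, lv, mul_assoc, h, mul_add, map_add,
    res_of_le ((((le_D (-1)).mul (le_fn g)).mul ((le_fn (dx f)).mul (le_D (-1)))).mono
      (by norm_num)), add_zero, mul_assoc, ← map_mul]
  have := co_mul_top (le_D (K := K) (-1)) (le_fn (g * f))
  rw [res_eq]
  simpa [co_D, co_fn, mul_comm] using this

/-- In `dt_pairing` with B' = L₊ the operator term vanishes by the Lax equation. What remains shows
how L acts on eigenfunctions, on adjoint eigenfunctions and on their antiderivatives. -/
theorem Op.dt_om_add {L B : Op K} {n : ℕ+} (hB : B.IsPlus) (hdL : Op.dt n L = B * L - L * B)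
    {u v : Fin m → Fn K} (hL : minus L = ∑ i, ghost (u i) (v i)) {α β : Option (Fn K)}
    (h : α ≠ none ∨ β ≠ none) {σ t : Fin m → Fn K} (ht : ∀ i, PotL (u i) β (t i))
    (hσ : ∀ i, PotR α (v i) (σ i)) (hα : dtv n α = nxtR B α 0) (hβ : dtv n β = -nxtL B β 0)
    (hdt : ∀ i, CKP.dt n (t i) = om B (some (u i)) β)
    (hdσ : ∀ i, CKP.dt n (σ i) = om B α (some (v i))) :
    CKP.dt n (om L α β + ∑ i, σ i * t i) = om B (some (nxtR L α (∑ i, u i * σ i))) β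
      - om B α (some (nxtL L β (∑ i, v i * t i))) := by
  have := Op.dt_pairing n hB (isPlus_plus L) h Finset.univ (fun i _ => ht i) (fun i _ => hσ i)
    hα hβ (fun i _ => hdt i) (fun i _ => hdσ i)
  rw [← hL, plus_add_minus, ← hdL, plus_dt, sub_self, om_zero, zero_add, om_plus L h, nxtR_plus,
    nxtL_plus] at this
  exact this

theorem adm_of_pos {K : Type*} [CommRing K] {A : PDO K} (h : ∀ n : ℤ, 0 < n → A n = 0) :
    Adm A := fun _ => ⟨0, fun n hn => by rw [h n hn]; exact Submodule.zero_mem _⟩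

namespace Data

/-- The dressing operator and its inverse have order at most zero. -/
structure Ord {K : Type*} [CommRing K] (P : Data K m) : Prop where
  W_pos : ∀ n : ℤ, 0 < n → P.W n = 0
  Winv_pos : ∀ n : ℤ, 0 < n → P.Winv n = 0

section

variable {P : Data K m} (h : P.Ord) (r : ℕ)

/-- The operator `W`. -/
def oW : Op K := ⟨P.W, adm_of_pos h.W_pos⟩

/-- The operator `W⁻¹`. -/
def oV : Op K := ⟨P.Winv, adm_of_pos h.Winv_pos⟩

/-- The base point has finite support, so beyond it t_l = X_l, and X_l lies in `van d` once l ≠ 1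
does not occur in d. -/
theorem time_mem_van {K : Type*} [CommRing K] (P : Data K m) (d : ℕ+ →₀ ℕ) :
    ∃ N : ℤ, ∀ l : ℕ+, N < l → P.time l ∈ van K d := by
  classical
  obtain ⟨N, hN⟩ := (P.base.support ∪ d.support ∪ {1}).bddAbove
  refine ⟨(N : ℤ), fun l hl => ?_⟩
  have hl : N < l := by exact_mod_cast hl
  have h0 : l ∉ P.base.support ∪ d.support ∪ {1} := fun h => absurd (hN h) (not_le.2 hl)
  simp only [Finset.mem_union, Finsupp.mem_support_iff, Finset.mem_singleton, not_or,
    not_not] at h0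
  intro e he
  rw [time, h0.1.1, map_zero, add_zero, MvPowerSeries.coeff_X, if_neg]
  rintro rfl
  have := he l h0.2
  rw [Finsupp.single_eq_same, h0.1.2] at this
  omega

/-- The operator `M⁽⁰⁾`. -/
def oM0 (P : Data K m) (r : ℕ) : Op K := ⟨P.M0 r, fun d => by
  obtain ⟨N, hN⟩ := P.time_mem_van d
  refine ⟨N, fun n hn => ?_⟩
  rw [M0]
  split_ifs with h0
  · refine Submodule.smul_of_tower_mem _ _ (hN _ ?_)
    change N < ((n + (r : ℤ)).toNat : ℤ)
    omega
  · exact Submodule.zero_mem _⟩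

/-- The operator `L^{n/r}`. -/
def oR (n : ℤ) : Op K := conj (oW h) (oV h) (D n)

/-- The operator `L`. -/
def oL : Op K := oR h r

/-- The operator `M`. -/
def oM : Op K := conj (oW h) (oV h) (P.oM0 r)

/-- The operator `M L^k`. -/
def oY (k : ℕ) : Op K := oM h r * oL h r ^ k

theorem val_oR (n : ℕ+) : (oR h n).1 = P.root n := rfl
theorem val_oL : (oL h r).1 = P.L r := rfl

theorem _root_.CKP.Op.val_pow (A : Op K) (k : ℕ) : (A ^ k).1 = A.1 ^ k := by
  induction k with
  | zero => rfl
  | succ k ih =>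
    rw [pow_succ, val_mul, ih]
    rfl

theorem val_oY (k : ℕ) : (oY h r k).1 = P.ML r k := by
  rw [oY, val_mul, val_pow]
  rfl

/-- The functions `L^p(Φ_i)`, `(L^*)^q(Ψ_j)` and their antiderivatives. -/
def frame {K : Type*} [CommRing K] (P : Data K m) (r : ℕ) : Frame K m := ⟨P.LΦ r, P.LΨ r, P.pot⟩

theorem _root_.CKP.Op.val_sum (s : Finset ι) (A : ι → Op K) : (∑ i ∈ s, A i).1 = ∑ i ∈ s, (A i).1 :=
  map_sum (adm K).subtype A s
theorem _root_.CKP.Op.val_smul (c : ℚ) (A : Op K) : (c • A).1 = c • A.1 := rfl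
theorem _root_.CKP.Op.val_add (A B : Op K) : (A + B).1 = A.1 + B.1 := rfl
theorem _root_.CKP.Op.val_sub (A B : Op K) : (A - B).1 = A.1 - B.1 := rfl
theorem _root_.CKP.Op.val_neg (A : Op K) : (-A).1 = -A.1 := rfl

theorem wt_eq (k j : ℕ) (hj : j ∈ Finset.range k) : wt k j = cX (k - 1 - j) j := by
  have hj := Finset.mem_range.1 hj
  obtain ⟨a, rfl⟩ : ∃ a, k = a + j + 1 := ⟨k - 1 - j, by omega⟩
  rw [show a + j + 1 - 1 - j = a by omega, wt, cX]
  push_cast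
  ring

theorem val_gh (P : Data K m) (r k : ℕ) : ((P.frame r).gh cX k).1 = P.X1 r k := by
  rw [Frame.gh, conv, Op.val_sum, X1, Finset.sum_comm]
  refine Finset.sum_congr rfl fun j hj => ?_
  rw [Op.val_smul, Op.val_sum, ← wt_eq k j hj, Finset.smul_sum]
  rfl

theorem val_gen (k : ℕ) : ((P.frame r).gen (oY h r k) k).1 = P.gen r k := by
  rw [Frame.gen, val_add, val_neg, val_minus, val_oY, val_gh]
  rfl

theorem X1Φ_eq (P : Data K m) (r k : ℕ) (i : Fin m) :
    P.X1Φ r k i = (P.frame r).qR cX k (ix 0 i) := by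
  rw [X1Φ, Frame.qR, conv, Finset.sum_comm]
  refine Finset.sum_congr rfl fun j hj => ?_
  rw [← wt_eq k j hj, Finset.smul_sum]
  rfl

theorem X1Ψ_eq (P : Data K m) (r k : ℕ) (i : Fin m) :
    P.X1Ψ r k i = -(P.frame r).qL cX k (ix 0 i) := by
  rw [X1Ψ, Frame.qL, conv, Finset.sum_comm]
  congr 1
  refine Finset.sum_congr rfl fun j hj => ?_
  rw [← wt_eq k j hj, Finset.smul_sum]
  rfl

theorem varΦ_eq (k : ℕ) (i : Fin m) : P.varΦ r k i = (P.frame r).dR (oY h r k) k (ix 0 i) := by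
  rw [varΦ, Frame.dR_ix, X1Φ_eq, ← val_oY h, act_val, Nat.cast_zero, zero_add, zero_add,
    add_right_comm]
  rfl

theorem varΨ_eq (k : ℕ) (i : Fin m) : P.varΨ r k i = (P.frame r).dL (oY h r k) k (ix 0 i) := by
  rw [varΨ, Frame.dL_ix, X1Ψ_eq, ← val_oY h, adj_val, Nat.cast_zero, zero_add, zero_add,
    sub_neg_eq_add, add_right_comm]
  rfl

theorem varPot_eq (k p q : ℕ) (i j : Fin m) :
    P.varPot r k p q i j = (P.frame r).dS (oY h r k) k (ix p i) (ix q j) := by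
  rw [varPot, Frame.dS, Frame.quad, conv, Finset.sum_comm, ← val_oY h, ← om_some]
  congr 1
  refine Finset.sum_congr rfl fun s hs => ?_
  rw [← wt_eq _ s hs, Finset.smul_sum]
  rfl

theorem LΦ_succ (p : ℕ) (i : Fin m) :
    P.LΦ r (p + 1) i = act (oL h r) (P.LΦ r p i) + ∑ l, P.Φ l * P.pot p 0 i l := by
  rw [LΦ, ← val_oL h, act_val]

theorem LΨ_succ (q : ℕ) (i : Fin m) :
    P.LΨ r (q + 1) i = adj (oL h r) (P.LΨ r q i) - ∑ l, P.Ψ l * P.pot 0 q l i := by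
  rw [LΨ, ← val_oL h, adj_val]

end

theorem dt_time {K : Type*} [CommRing K] (P : Data K m) (n l : ℕ+) :
    CKP.dt n (P.time l) = if n = l then 1 else 0 := by
  classical
  rw [time, CKP.dt_add]
  change MvPowerSeries.pderiv K n _ + MvPowerSeries.pderiv K n _ = _
  rw [MvPowerSeries.pderiv_C, add_zero]
  split_ifs with h
  · rw [h, MvPowerSeries.pderiv_X_self]
  · rw [MvPowerSeries.pderiv_X_of_ne (Ne.symm h)]

theorem dt_M0 (P : Data K m) (r : ℕ) (n : ℕ+) :
    Op.dt n (P.oM0 r) = ((n : ℚ) / r) • D ((n : ℤ) - r) := ext fun p => by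
  change CKP.dt n (P.M0 r p) = _
  have hn : 0 < (n : ℤ) := by exact_mod_cast n.pos
  rw [co_smul, co_D, M0]
  split_ifs with h1 h2 h2
  · subst h2
    rw [dt_qsmul]
    refine (congrArg _ (dt_time P n _)).trans ?_
    rw [if_pos]
    · push_cast
      rw [sub_add_cancel]
    · refine PNat.eq ?_
      change (n : ℕ) = ((n : ℤ) - r + r).toNat
      omega
  · rw [dt_qsmul]
    refine (congrArg _ (dt_time P n _)).trans ?_
    rw [if_neg, smul_zero, smul_zero]
    rintro rfl
    refine h2 ?_
    change p = ((p + r).toNat : ℤ) - r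
    omega
  · omega
  · rw [dt_zero, smul_zero]

/-- [D, M⁽⁰⁾] is the coefficientwise x-derivative, and only t₁ depends on x, so it equals (1/r)
D^(1-r); powers of D follow by induction. -/
theorem D_comm_M0 (P : Data K m) (r n : ℕ) :
    D n * P.oM0 r - P.oM0 r * D n = ((n : ℚ) / r) • D ((n : ℤ) - r) := by
  induction n with
  | zero => simp [D_zero]
  | succ n ih =>
    have h1 : (D ((n + 1 : ℕ) : ℤ) : Op K) = D n * D 1 := by rw [D_mul_D]; rfl
    have h2 := dt_M0 P r 1
    have h3 : D ((n + 1 : ℕ) : ℤ) * P.oM0 r - P.oM0 r * D ((n + 1 : ℕ) : ℤ) =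
        (D n * P.oM0 r - P.oM0 r * D n) * D 1 + D n * (D 1 * P.oM0 r - P.oM0 r * D 1) := by
      rw [h1]
      noncomm_ring
    rw [h3, ih, D_one_mul, add_sub_cancel_left, h2, smul_mul_assoc, mul_smul_comm, D_mul_D, D_mul_D]
    rw [show (n : ℤ) - r + 1 = (n + 1 : ℕ) - r by push_cast; ring,
      show (n : ℤ) + (((1 : ℕ+) : ℕ) - r) = (n + 1 : ℕ) - r by push_cast; ring, ← add_smul]
    push_cast
    congr 1
    ring

namespace IsSolution

theorem ord {K : Type*} [CommRing K] {P : Data K m} {r : ℕ} (hs : P.IsSolution r) : P.Ord :=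
  ⟨hs.W_pos, hs.Winv_pos⟩

variable {P : Data K m} {r : ℕ}

theorem dressing (hs : P.IsSolution r) : IsDressing r (oW hs.ord) (oV hs.ord) (P.oM0 r) where
  mul_inv := Subtype.ext hs.W_mul_Winv
  inv_mul := Subtype.ext hs.Winv_mul_W
  D_comm n _ := D_comm_M0 P r n

theorem isSato (hs : P.IsSolution r) : IsSato (oW hs.ord) (oV hs.ord) := fun n =>
  Subtype.ext ((hs.sato n).trans (by
    rw [Op.val_neg, Op.val_mul, Op.val_minus]
    rfl))

theorem minus_L (hs : P.IsSolution r) : minus (oL hs.ord r) = ∑ i, ghost (P.Φ i) (P.Ψ i) :=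
  Subtype.ext (by
    rw [Op.val_minus, Op.val_sum]
    exact hs.constrained)

theorem dt_Φ (hs : P.IsSolution r) (n : ℕ+) (i : Fin m) :
    CKP.dt n (P.Φ i) = act (plus (oR hs.ord n)) (P.Φ i) := by
  rw [hs.eigen, act_plus, ← act_val]
  rfl

theorem dt_Ψ (hs : P.IsSolution r) (n : ℕ+) (i : Fin m) :
    CKP.dt n (P.Ψ i) = -adj (plus (oR hs.ord n)) (P.Ψ i) := by
  rw [hs.adjEigen, adj_plus, ← adj_val]
  rfl

theorem dt_L (hs : P.IsSolution r) (n : ℕ+) :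
    Op.dt n (oL hs.ord r) = plus (oR hs.ord n) * oL hs.ord r - oL hs.ord r * plus (oR hs.ord n) :=
  hs.isSato.dt_root hs.dressing n r

theorem dt_Y (hs : P.IsSolution r) (n : ℕ+) (k : ℕ) : Op.dt n (oY hs.ord r k) =
    plus (oR hs.ord n) * oY hs.ord r k - oY hs.ord r k * plus (oR hs.ord n) :=
  IsSato.dt_ML (hs.dt_L n) (hs.isSato.dt_M hs.dressing n (dt_M0 P r n)) k

theorem L_comm_Y (hs : P.IsSolution r) (hr : 1 ≤ r) (k : ℕ) :
    oL hs.ord r * oY hs.ord r k - oY hs.ord r k * oL hs.ord r = oL hs.ord r ^ k :=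
  comm_mul_pow (hs.dressing.L_comm_M hr) k

theorem Y_comm (hs : P.IsSolution r) (hr : 1 ≤ r) (k l : ℕ) :
    oY hs.ord r l * oY hs.ord r k - oY hs.ord r k * oY hs.ord r l =
      ((l : ℚ) - k) • oY hs.ord r (k + l - 1) :=
  mul_pow_comm (hs.dressing.L_comm_M hr) k l

theorem dx_of_dt (hs : P.IsSolution r) {s f g : Fn K}
    (h : ∀ n : ℕ+, CKP.dt n s = om (plus (oR hs.ord n)) (some f) (some g)) : dx s = f * g := by
  have := h 1
  rwa [show plus (oR hs.ord ((1 : ℕ+) : ℕ)) = D 1 from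
    hs.isSato.plus_root_one (Subtype.ext hs.W_mul_Winv), om_D_one] at this

section evolution

variable {n : ℕ+} {f g : Fn K}

/-- L maps eigenfunctions to eigenfunctions as long as the antiderivatives σ evolve by the
concomitant. This carries the induction over p, both for given integrals and in their construction.
-/
theorem dt_act (hs : P.IsSolution r) (hf : CKP.dt n f = act (plus (oR hs.ord n)) f)
    {σ : Fin m → Fn K} (hσ : ∀ i, dx (σ i) = f * P.Ψ i)
    (hdσ : ∀ i, CKP.dt n (σ i) = om (plus (oR hs.ord n)) (some f) (some (P.Ψ i))) :
    CKP.dt n (act (oL hs.ord r) f + ∑ i, P.Φ i * σ i) =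
      act (plus (oR hs.ord n)) (act (oL hs.ord r) f + ∑ i, P.Φ i * σ i) := by
  have := dt_om_add (isPlus_plus _) (hs.dt_L n) hs.minus_L (α := some f) (β := none)
    (Or.inl (by simp)) (t := P.Φ) (fun _ => rfl) hσ (by rw [nxtR, add_zero]; exact hf)
    (by rw [nxtL, neg_zero]; rfl) (fun i => by rw [om_none_right]; exact hs.dt_Φ n i) hdσ
  rw [om_none_right, om_none_right] at this
  simp only [mul_comm (σ _), nxtR, nxtL, Frame.om_zero_right, sub_zero] at this
  exact this

theorem dt_adj (hs : P.IsSolution r) (hg : CKP.dt n g = -adj (plus (oR hs.ord n)) g)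
    {t : Fin m → Fn K} (ht : ∀ i, dx (t i) = P.Φ i * g)
    (hdt : ∀ i, CKP.dt n (t i) = om (plus (oR hs.ord n)) (some (P.Φ i)) (some g)) :
    CKP.dt n (adj (oL hs.ord r) g - ∑ i, P.Ψ i * t i) =
      -adj (plus (oR hs.ord n)) (adj (oL hs.ord r) g - ∑ i, P.Ψ i * t i) := by
  have := dt_om_add (isPlus_plus _) (hs.dt_L n) hs.minus_L (α := none) (β := some g)
    (Or.inr (by simp)) (σ := fun i => -P.Ψ i) ht (fun _ => rfl) (by rw [nxtR]; rfl)
    (by rw [nxtL, sub_zero]; exact hg) hdt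
    (fun i => by rw [om_none_left, dt_neg, hs.dt_Ψ, neg_neg])
  rw [om_none_left, om_none_left] at this
  simp only [neg_mul, Finset.sum_neg_distrib, nxtR, nxtL, Frame.om_zero_left, zero_sub,
    ← sub_eq_add_neg] at this
  exact this

theorem dt_om_add (hs : P.IsSolution r) (hf : CKP.dt n f = act (plus (oR hs.ord n)) f)
    {σ t : Fin m → Fn K} (hσ : ∀ i, dx (σ i) = f * P.Ψ i)
    (hdσ : ∀ i, CKP.dt n (σ i) = om (plus (oR hs.ord n)) (some f) (some (P.Ψ i)))
    (hg : CKP.dt n g = -adj (plus (oR hs.ord n)) g)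
    (ht : ∀ i, dx (t i) = P.Φ i * g)
    (hdt : ∀ i, CKP.dt n (t i) = om (plus (oR hs.ord n)) (some (P.Φ i)) (some g)) :
    CKP.dt n (om (oL hs.ord r) (some f) (some g) + ∑ i, σ i * t i) =
      om (plus (oR hs.ord n)) (some (act (oL hs.ord r) f + ∑ i, P.Φ i * σ i)) (some g)
      - om (plus (oR hs.ord n)) (some f) (some (adj (oL hs.ord r) g - ∑ i, P.Ψ i * t i)) :=
  Op.dt_om_add (isPlus_plus _) (hs.dt_L n) hs.minus_L (α := some f) (β := some g)
    (Or.inl (by simp)) ht hσ (by rw [nxtR, add_zero]; exact hf) (by rw [nxtL, sub_zero]; exact hg)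
    hdt hdσ

end evolution

theorem _root_.CKP.Data.IsPotential.dt_pot' (hs : P.IsSolution r) (hp : P.IsPotential r) (n : ℕ+)
    (p q : ℕ) (i j : Fin m) : CKP.dt n (P.pot p q i j) =
      om (plus (oR hs.ord n)) (some (P.LΦ r p i)) (some (P.LΨ r q j)) := by
  rw [hp.dt_pot, om_plus _ (Or.inl (by simp)), om_some]
  rfl

theorem isPot (hs : P.IsSolution r) (hp : P.IsPotential r) : (P.frame r).IsPot := fun p q i j =>
  hs.dx_of_dt fun n => hp.dt_pot' hs n p q i j

theorem isEvol (hs : P.IsSolution r) (hp : P.IsPotential r) (n : ℕ+) :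
    (P.frame r).IsEvol n (plus (oR hs.ord n)) where
  f p := by
    induction p with
    | zero => exact hs.dt_Φ n
    | succ p ih =>
        intro i
        simp only [frame, LΦ_succ hs.ord]
        exact hs.dt_act (ih i) (fun l => hs.isPot hp p 0 i l) (fun l => hp.dt_pot' hs n p 0 i l)
  g q := by
    induction q with
    | zero => exact hs.dt_Ψ n
    | succ q ih =>
        intro j
        simp only [frame, LΨ_succ hs.ord]
        exact hs.dt_adj (ih j) (fun l => hs.isPot hp 0 q l j) (fun l => hp.dt_pot' hs n 0 q l j)
  S := hp.dt_pot' hs n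

theorem isLax (hs : P.IsSolution r) (hp : P.IsPotential r) :
    (P.frame r).IsLax (oL hs.ord r) where
  minus_eq := by
    rw [hs.minus_L, Frame.gh, conv_one, Frame.cOne, one_smul]
    rfl
  f_succ := LΦ_succ hs.ord r
  g_succ := LΨ_succ hs.ord r
  S_shift p q i j := by
    rw [om_some]
    exact hp.shift p q i j

end IsSolution

end Data

end CKP

end

/-! ### Existence of consistent antiderivatives. -/

noncomputable section

namespace CKP

variable {K : Type*} [CommRing K] [Algebra ℚ K] {ι κ : Type*} {m : ℕ}

open Ix Op

namespace Data

namespace IsSolution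

variable {P : Data K m} {r : ℕ}

theorem exists_pot_zero (hs : P.IsSolution r) {g : Fin m → Fn K}
    (hg : ∀ (n : ℕ+) j, CKP.dt n (g j) = -adj (plus (oR hs.ord n)) (g j)) :
    ∃ S : Fin m → Fin m → Fn K, ∀ (n : ℕ+) i j,
      CKP.dt n (S i j) = om (plus (oR hs.ord n)) (some (P.Φ i)) (some (g j)) := by
  have : ∀ i j, ∃ F : Fn K, ∀ n : ℕ+,
      CKP.dt n F = om (plus (oR hs.ord n)) (some (P.Φ i)) (some (g j)) := fun i j =>
    exists_dt_eq _ fun a b => dt_om_comm a b (isPlus_plus _) (isPlus_plus _) (Or.inl (by simp))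
      (by rw [nxtR, add_zero]; exact hs.dt_Φ a i) (by rw [nxtL, sub_zero]; exact hg a j)
      (by rw [nxtR, add_zero]; exact hs.dt_Φ b i) (by rw [nxtL, sub_zero]; exact hg b j)
      (hs.isSato.zero_curvature hs.dressing a b)
  choose S hS using this
  exact ⟨S, fun n i j => hS i j n⟩

/-- Tuples of adjoint eigenfunctions. -/
def AdjTuple (hs : P.IsSolution r) : Type _ :=
  {g : Fin m → Fn K // ∀ (n : ℕ+) j, CKP.dt n (g j) = -adj (plus (oR hs.ord n)) (g j)}

/-- Antiderivatives of the products of `Φ_i` with adjoint eigenfunctions. -/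
def potZero (hs : P.IsSolution r) (g : hs.AdjTuple) : Fin m → Fin m → Fn K :=
  (hs.exists_pot_zero g.2).choose

theorem dt_potZero (hs : P.IsSolution r) (g : hs.AdjTuple) (n : ℕ+) (i j : Fin m) :
    CKP.dt n (hs.potZero g i j) = om (plus (oR hs.ord n)) (some (P.Φ i)) (some (g.1 j)) :=
  (hs.exists_pot_zero g.2).choose_spec n i j

/-- The tuples `(L^*)^q(Ψ_j)`. -/
def adjSeq (hs : P.IsSolution r) : ℕ → hs.AdjTuple
  | 0 => ⟨P.Ψ, hs.dt_Ψ⟩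
  | q + 1 => ⟨fun j => adj (oL hs.ord r) ((hs.adjSeq q).1 j)
      - ∑ l, P.Ψ l * hs.potZero (hs.adjSeq q) l j, fun n j =>
        hs.dt_adj ((hs.adjSeq q).2 n j) (fun l => hs.dx_of_dt fun n => hs.dt_potZero _ n l j)
          (fun l => hs.dt_potZero _ n l j)⟩

/-- The functions `L^p(Φ_i)` together with the antiderivatives of `L^p(Φ_i) (L^*)^q(Ψ_j)`. -/
def eigSeq (hs : P.IsSolution r) : ℕ → (Fin m → Fn K) × (ℕ → Fin m → Fin m → Fn K)
  | 0 => (P.Φ, fun q => hs.potZero (hs.adjSeq q))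
  | p + 1 => (fun i => act (oL hs.ord r) ((hs.eigSeq p).1 i)
        + ∑ l, P.Φ l * (hs.eigSeq p).2 0 i l,
      -- Only S^{0,q} is obtained by integration. S^{p+1,q} is defined from S^{p,q+1} by the shift
      -- relation, so that relation holds by construction and only the evolution must be proved.
      fun q i j => (hs.eigSeq p).2 (q + 1) i j
        + (om (oL hs.ord r) (some ((hs.eigSeq p).1 i)) (some ((hs.adjSeq q).1 j))
          + ∑ l, (hs.eigSeq p).2 0 i l * hs.potZero (hs.adjSeq q) l j))

/-- The term added in passing from S^{p,q+1} to S^{p+1,q} has t_n-derivative Ω(L f, g) - Ω(f, L^*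
g), which moves L from the right factor to the left one. -/
theorem dt_eigSeq (hs : P.IsSolution r) (p : ℕ) :
    (∀ (n : ℕ+) i, CKP.dt n ((hs.eigSeq p).1 i) =
      act (plus (oR hs.ord n)) ((hs.eigSeq p).1 i)) ∧
    ∀ (n : ℕ+) q i j, CKP.dt n ((hs.eigSeq p).2 q i j) =
      om (plus (oR hs.ord n)) (some ((hs.eigSeq p).1 i)) (some ((hs.adjSeq q).1 j)) := by
  induction p with
  | zero => exact ⟨hs.dt_Φ, fun n q i j => hs.dt_potZero _ n i j⟩
  | succ p ih =>
    have hσ : ∀ i l, dx ((hs.eigSeq p).2 0 i l) = (hs.eigSeq p).1 i * P.Ψ l := fun i l =>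
      hs.dx_of_dt fun n => ih.2 n 0 i l
    refine ⟨fun n i => hs.dt_act (ih.1 n i) (hσ i) (fun l => ih.2 n 0 i l), fun n q i j => ?_⟩
    rw [eigSeq, CKP.dt_add, ih.2,
      hs.dt_om_add (ih.1 n i) (hσ i) (fun l => ih.2 n 0 i l) ((hs.adjSeq q).2 n j)
        (fun l => hs.dx_of_dt fun n => hs.dt_potZero _ n l j) (fun l => hs.dt_potZero _ n l j),
      adjSeq, add_sub_cancel]

theorem exists_isPotential (hs : P.IsSolution r) :
    ∃ S : ℕ → ℕ → Fin m → Fin m → Fn K, IsPotential r { P with pot := S } := by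
  set Q : Data K m := { P with pot := fun p q => (hs.eigSeq p).2 q } with hQ
  have hq : Q.Ord := ⟨hs.W_pos, hs.Winv_pos⟩
  have hL : oL hq r = oL hs.ord r := rfl
  have h1 : ∀ p i, Q.LΦ r p i = (hs.eigSeq p).1 i := fun p => by
    induction p with
    | zero => exact fun i => rfl
    | succ p ih =>
      intro i
      rw [LΦ_succ hq, ih, hL]
      rfl
  have h2 : ∀ q j, Q.LΨ r q j = (hs.adjSeq q).1 j := fun q => by
    induction q with
    | zero => exact fun i => rfl
    | succ q ih =>
      intro i
      rw [LΨ_succ hq, ih, hL]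
      rfl
  refine ⟨fun p q => (hs.eigSeq p).2 q, fun n p q i j => ?_, fun p q i j => ?_⟩
  · rw [h1, h2]
    refine ((hs.dt_eigSeq p).2 n q i j).trans ?_
    rw [om_plus _ (Or.inl (by simp)), om_some]
    rfl
  · rw [h1, h2]
    refine (add_sub_cancel_left _ _).trans ?_
    rw [om_some]
    rfl

end IsSolution

end Data

end CKP

end

/-! ### Dual numbers: components of order zero and one of series and operators. -/

noncomputable section

namespace CKP

variable {K : Type*} [CommRing K] [Algebra ℚ K] {ι κ : Type*} {m : ℕ}

open MvPowerSeries

namespace Fn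

/-- The part of order zero of `f + ε g`. -/
def fst {K : Type*} [CommRing K] : Fn (DualNumber K) →+* Fn K :=
  MvPowerSeries.map (TrivSqZeroExt.fstHom K K K).toRingHom

/-- The first-order part as an additive map. -/
def epsHom {K : Type*} [CommRing K] : Fn (DualNumber K) →+ Fn K where
  toFun := eps
  map_zero' := rfl
  map_add' _ _ := rfl

section

variable {K : Type*} [CommRing K]

theorem coeff_fst (f : Fn (DualNumber K)) (d : ℕ+ →₀ ℕ) :
    coeff d (fst f) = (coeff d f).fst := rfl
theorem coeff_eps (f : Fn (DualNumber K)) (d : ℕ+ →₀ ℕ) :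
    coeff d (eps f) = (coeff d f).snd := rfl

/-- The means by which preservation to first order is proved: an equation over K[ε] is the original
equation together with its linearisation. -/
theorem ext_dual {f g : Fn (DualNumber K)} (h1 : fst f = fst g) (h2 : eps f = eps g) : f = g := by
  ext d
  · exact congrArg (coeff d) h1
  · exact congrArg (coeff d) h2

theorem fst_deform (f g : Fn K) : fst (deform f g) = f := by
  ext d
  exact (TrivSqZeroExt.fst_add _ _).trans (by simp)

theorem eps_deform (f g : Fn K) : eps (deform f g) = g := by
  ext d
  exact (TrivSqZeroExt.snd_add _ _).trans (by simp)

theorem eps_mul (f g : Fn (DualNumber K)) : eps (f * g) = eps f * fst g + fst f * eps g := by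
  classical
  ext d
  rw [coeff_eps, coeff_mul, map_add, coeff_mul, coeff_mul, ← Finset.sum_add_distrib]
  refine (map_sum (TrivSqZeroExt.sndHom K K) _ _).trans (Finset.sum_congr rfl fun x _ => ?_)
  change (_ * _ : DualNumber K).snd = _
  rw [TrivSqZeroExt.snd_mul, coeff_eps, coeff_eps, coeff_fst, coeff_fst, op_smul_eq_smul,
    smul_eq_mul, smul_eq_mul]
  ring

theorem fst_dt (n : ℕ+) (f : Fn (DualNumber K)) : fst (dt n f) = dt n (fst f) := by
  ext d
  simp only [coeff_fst, dt, coeff_pderiv, TrivSqZeroExt.fst_mul, TrivSqZeroExt.fst_add,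
    TrivSqZeroExt.fst_natCast, TrivSqZeroExt.fst_one]

theorem eps_dt (n : ℕ+) (f : Fn (DualNumber K)) : eps (dt n f) = dt n (eps f) := by
  ext d
  simp only [coeff_eps, dt, coeff_pderiv, TrivSqZeroExt.snd_mul, TrivSqZeroExt.snd_add,
    TrivSqZeroExt.fst_add, TrivSqZeroExt.fst_natCast, TrivSqZeroExt.snd_natCast,
    TrivSqZeroExt.fst_one, TrivSqZeroExt.snd_one, add_zero, smul_zero, smul_eq_mul, mul_comm]

theorem fst_dxi (j : ℕ) (f : Fn (DualNumber K)) : fst (dx^[j] f) = dx^[j] (fst f) :=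
  Function.Semiconj.iterate_right (f := fst) (fun g => fst_dt 1 g) j f

theorem eps_dxi (j : ℕ) (f : Fn (DualNumber K)) : eps (dx^[j] f) = dx^[j] (eps f) :=
  Function.Semiconj.iterate_right (f := eps) (fun g => eps_dt 1 g) j f

theorem fst_zsmul (c : ℤ) (f : Fn (DualNumber K)) : fst (c • f) = c • fst f := map_zsmul fst c f
theorem eps_zsmul (c : ℤ) (f : Fn (DualNumber K)) : eps (c • f) = c • eps f :=
  map_zsmul epsHom c f

theorem fst_lsum {f : ι → Fn (DualNumber K)} (hf : LocFin f) :
    fst (lsum f) = lsum fun i => fst (f i) := by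
  ext d
  exact AddMonoidHom.map_finsum
    ((TrivSqZeroExt.fstHom K K K).toRingHom.toAddMonoidHom) (hf d)

theorem eps_lsum {f : ι → Fn (DualNumber K)} (hf : LocFin f) :
    eps (lsum f) = lsum fun i => eps (f i) := by
  ext d
  exact AddMonoidHom.map_finsum (TrivSqZeroExt.sndHom K K).toAddMonoidHom (hf d)

theorem fst_mem_van {d : ℕ+ →₀ ℕ} {f : Fn (DualNumber K)} (h : f ∈ van (DualNumber K) d) :
    fst f ∈ van K d := fun e he => by rw [coeff_fst, h e he, TrivSqZeroExt.fst_zero]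
theorem eps_mem_van {d : ℕ+ →₀ ℕ} {f : Fn (DualNumber K)} (h : f ∈ van (DualNumber K) d) :
    eps f ∈ van K d := fun e he => by rw [coeff_eps, h e he, TrivSqZeroExt.snd_zero]

end

theorem eps_qsmul (c : ℚ) (f : Fn (DualNumber K)) : eps (c • f) = c • eps f :=
  map_rat_smul epsHom c f
theorem fst_qsmul (c : ℚ) (f : Fn (DualNumber K)) : fst (c • f) = c • fst f :=
  map_rat_smul fst c f
theorem eps_one {K : Type*} [CommRing K] : eps (1 : Fn (DualNumber K)) = 0 := by
  classical
  ext d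
  rw [coeff_eps, coeff_one]
  split_ifs
  · exact TrivSqZeroExt.snd_one
  · exact TrivSqZeroExt.snd_zero

theorem eps_zero {K : Type*} [CommRing K] : eps (0 : Fn (DualNumber K)) = 0 := rfl
theorem eps_sum {K : Type*} [CommRing K] (s : Finset ι) (f : ι → Fn (DualNumber K)) :
    eps (∑ i ∈ s, f i) = ∑ i ∈ s, eps (f i) := map_sum epsHom f s
theorem eps_add {K : Type*} [CommRing K] (f g : Fn (DualNumber K)) :
    eps (f + g) = eps f + eps g := rfl
theorem eps_sub {K : Type*} [CommRing K] (f g : Fn (DualNumber K)) :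
    eps (f - g) = eps f - eps g := map_sub epsHom f g
theorem eps_neg {K : Type*} [CommRing K] (f : Fn (DualNumber K)) :
    eps (-f) = -eps f := map_neg epsHom f

end Fn

namespace Op

/-- The first-order part of an operator over the dual numbers. -/
def eps : Op (DualNumber K) →ₗ[ℚ] Op K where
  toFun A := ⟨PDO.eps A.1, fun d => by
    obtain ⟨N, hN⟩ := A.2 d
    exact ⟨N, fun n hn => Fn.eps_mem_van (hN n hn)⟩⟩
  map_add' _ _ := rfl
  map_smul' c A := ext fun n => Fn.eps_qsmul c _

theorem co_eps (A : Op (DualNumber K)) (n : ℤ) : (eps A).co n = Fn.eps (A.co n) := rfl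
theorem val_eps (A : Op (DualNumber K)) : (eps A).1 = PDO.eps A.1 := rfl

/-- The part of order zero of an operator over the dual numbers. -/
def fst : Op (DualNumber K) →+* Op K where
  toFun A := ⟨fun n => Fn.fst (A.1 n), fun d => by
    obtain ⟨N, hN⟩ := A.2 d
    exact ⟨N, fun n hn => Fn.fst_mem_van (hN n hn)⟩⟩
  map_zero' := ext fun n => map_zero Fn.fst
  map_add' _ _ := ext fun n => map_add Fn.fst _ _
  map_one' := ext fun n => by
    change Fn.fst (co 1 n) = _
    rw [co_one, co_one]
    split_ifs
    · exact map_one Fn.fst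
    · exact map_zero Fn.fst
  map_mul' A B := ext fun n => by
    change Fn.fst (co (A * B) n) = _
    rw [co_mul, Fn.fst_lsum (locFin_mul A B n)]
    refine lsum_congr fun q => ?_
    rw [Fn.fst_zsmul, map_mul, Fn.fst_dxi]
    rfl

theorem co_fst (A : Op (DualNumber K)) (n : ℤ) : (fst A).co n = Fn.fst (A.co n) := rfl

theorem ext_dual {A B : Op (DualNumber K)} (h1 : fst A = fst B) (h2 : eps A = eps B) : A = B :=
  ext fun n => Fn.ext_dual (congrArg (fun A => co A n) h1) (congrArg (fun A => co A n) h2)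

theorem eps_mul (A B : Op (DualNumber K)) : eps (A * B) = eps A * fst B + fst A * eps B :=
  ext fun n => by
    have h := locFin_mul A B n
    rw [co_eps, co_mul, Fn.eps_lsum h, co_add, co_mul, co_mul, ← lsum_add (locFin_mul _ _ n)
      (locFin_mul _ _ n)]
    refine lsum_congr fun q => ?_
    rw [Fn.eps_zsmul, Fn.eps_mul, Fn.fst_dxi, Fn.eps_dxi, smul_add]
    rfl

theorem fst_fn (f : Fn (DualNumber K)) : fst (fn f) = fn (Fn.fst f) := ext fun n => by
  rw [co_fst, co_fn, co_fn, apply_ite Fn.fst, map_zero]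
theorem eps_fn (f : Fn (DualNumber K)) : eps (fn f) = fn (Fn.eps f) := ext fun n => by
  rw [co_eps, co_fn, co_fn, apply_ite Fn.eps, Fn.eps_zero]
theorem fst_D (k : ℤ) : fst (D k : Op (DualNumber K)) = D k := ext fun n => by
  rw [co_fst, co_D, co_D, apply_ite Fn.fst, map_zero, map_one]
theorem eps_D (k : ℤ) : eps (D k : Op (DualNumber K)) = 0 := ext fun n => by
  rw [co_eps, co_D, apply_ite Fn.eps, Fn.eps_zero, Fn.eps_one, ite_self, co_zero]
theorem eps_one : eps (1 : Op (DualNumber K)) = 0 := eps_D 0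
theorem fst_dt (n : ℕ+) (A : Op (DualNumber K)) : fst (dt n A) = dt n (fst A) :=
  ext fun _ => Fn.fst_dt n _
theorem eps_dt (n : ℕ+) (A : Op (DualNumber K)) : eps (dt n A) = dt n (eps A) :=
  ext fun _ => Fn.eps_dt n _
theorem fst_minus (A : Op (DualNumber K)) : fst (minus A) = minus (fst A) := ext fun p => by
  rw [co_fst, co_minus, co_minus, apply_ite Fn.fst, map_zero, co_fst]
theorem eps_minus (A : Op (DualNumber K)) : eps (minus A) = minus (eps A) := ext fun p => by
  rw [co_eps, co_minus, co_minus, apply_ite Fn.eps, Fn.eps_zero, co_eps]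
theorem fst_smul (c : ℚ) (A : Op (DualNumber K)) : fst (c • A) = c • fst A := map_rat_smul fst c A

theorem fst_ghost (f g : Fn (DualNumber K)) :
    fst (ghost f g) = ghost (Fn.fst f) (Fn.fst g) := by
  simp only [ghost, map_mul, fst_fn, fst_D]
theorem eps_ghost (f g : Fn (DualNumber K)) :
    eps (ghost f g) = ghost (Fn.eps f) (Fn.fst g) + ghost (Fn.fst f) (Fn.eps g) := by
  simp only [ghost, eps_mul, eps_fn, eps_D, map_mul, fst_fn, fst_D, mul_zero, add_zero]

theorem fst_act (A : Op (DualNumber K)) (f : Fn (DualNumber K)) :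
    Fn.fst (act A f) = act (fst A) (Fn.fst f) := by
  rw [act, ← co_fst, map_mul, fst_fn, act]
theorem eps_act (A : Op (DualNumber K)) (f : Fn (DualNumber K)) :
    Fn.eps (act A f) = act (eps A) (Fn.fst f) + act (fst A) (Fn.eps f) := by
  rw [act, ← co_eps, eps_mul, fst_fn, eps_fn, act, act, co_add]

theorem fst_res (A : Op (DualNumber K)) : Fn.fst (res A) = res (fst A) := rfl
theorem eps_res (A : Op (DualNumber K)) : Fn.eps (res A) = res (eps A) := rfl

theorem fst_adj (A : Op (DualNumber K)) (g : Fn (DualNumber K)) :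
    Fn.fst (adj A g) = adj (fst A) (Fn.fst g) := by
  rw [adj, fst_res, map_mul fst, map_mul fst, fst_fn, fst_D, adj]
theorem eps_adj (A : Op (DualNumber K)) (g : Fn (DualNumber K)) :
    Fn.eps (adj A g) = adj (eps A) (Fn.fst g) + adj (fst A) (Fn.eps g) := by
  rw [adj, eps_res, eps_mul, eps_mul, eps_D, zero_mul, zero_add, map_mul, fst_fn, fst_D, eps_fn,
    map_add, adj, adj, add_comm]

theorem fst_om (A : Op (DualNumber K)) (f g : Fn (DualNumber K)) :
    Fn.fst (om A (some f) (some g)) = om (fst A) (some (Fn.fst f)) (some (Fn.fst g)) := by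
  simp only [om, fst_res, map_mul, rv, lv, fst_fn, fst_D]
theorem eps_om (A : Op (DualNumber K)) (f g : Fn (DualNumber K)) :
    Fn.eps (om A (some f) (some g)) = om (eps A) (some (Fn.fst f)) (some (Fn.fst g))
      + om (fst A) (some (Fn.eps f)) (some (Fn.fst g))
      + om (fst A) (some (Fn.fst f)) (some (Fn.eps g)) := by
  simp only [om, eps_res, eps_mul, map_mul, rv, lv, fst_fn, fst_D, eps_fn, eps_D, zero_mul,
    mul_zero, add_zero, zero_add, add_mul, map_add]
  abel

end Op

end CKP

end

/-! ### The deformed data solve the hierarchy over the dual numbers. -/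

noncomputable section

namespace CKP

variable {K : Type*} [CommRing K] [Algebra ℚ K] {ι κ : Type*} {m : ℕ}

open Ix Op

namespace Frame

variable {F : Frame K m}

theorem dS_zero_right (Y : Op K) (k : ℕ) (α : Ix m) : F.dS Y k α zero = 0 := by
  have h : om Y (F.r α) (F.l zero) = 0 := om_zero_right _ _
  have h' : lift k (zero : Ix m) = zero := rfl
  rw [dS, h, h', quad_zero_right, s_zero_right, s_zero_right]
  simp

theorem dS_zero_left (Y : Op K) (k : ℕ) (β : Ix m) : F.dS Y k zero β = 0 := by
  have h : om Y (F.r zero) (F.l β) = 0 := om_zero_left _ _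
  have h' : lift k (zero : Ix m) = zero := rfl
  rw [dS, h, h', quad_zero_left, s_zero_left, s_zero_left]
  simp

/-- The case β = inf of `IsLax.dS_shift`; likewise `dL_succ` is the case α = inf. -/
theorem IsLax.dR_succ {L Y : Op K} {k : ℕ} (hF : F.IsPot) (hL : F.IsLax L)
    (hY : L * Y - Y * L = L ^ k) (p : ℕ) (i : Fin m) :
    F.dR Y k (ix (p + 1) i) = act (F.gen Y k * L - L * F.gen Y k) (F.f p i)
      + act L (F.dR Y k (ix p i))
      + ∑ x, (F.f 0 x * F.dS Y k (ix p i) (ix 0 x) + F.S p 0 i x * F.dR Y k (ix 0 x)) := by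
  have := hL.dS_shift hF hY (ok_ix_left p i inf)
  rw [dL_inf] at this
  simp only [sh, dS_zero_right, dS_inf_right, sub_zero, r, l, s, om_none_right, om_zero_right,
    add_zero, mul_comm (F.dS _ _ _ _)] at this
  exact this

theorem IsLax.dL_succ {L Y : Op K} {k : ℕ} (hF : F.IsPot) (hL : F.IsLax L)
    (hY : L * Y - Y * L = L ^ k) (q : ℕ) (j : Fin m) :
    F.dL Y k (ix (q + 1) j) = adj (F.gen Y k * L - L * F.gen Y k) (F.g q j)
      + adj L (F.dL Y k (ix q j))
      - ∑ x, (F.dL Y k (ix 0 x) * F.S 0 q x j + F.g 0 x * F.dS Y k (ix 0 x) (ix q j)) := by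
  have := hL.dS_shift hF hY (ok_ix_right q j inf)
  rw [dR_inf] at this
  simp only [sh, dS_zero_left, dS_inf_left, r, l, s, om_none_left, om_zero_left, add_zero,
    neg_mul, zero_sub, neg_neg, ← neg_add, Finset.sum_neg_distrib] at this
  exact this.trans (sub_eq_add_neg _ _).symm

theorem IsEvol.dR {R Y : Op K} {k : ℕ} {n : ℕ+} (hF : F.IsPot) (hE : F.IsEvol n (plus R))
    (hY : Op.dt n Y = plus R * Y - Y * plus R) (p : ℕ) (i : Fin m) :
    CKP.dt n (F.dR Y k (ix p i)) = act (F.gen Y k * R - R * F.gen Y k) (F.f p i)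
      + act R (F.dR Y k (ix p i)) := by
  have := hE.dS (k := k) hF hY (ok_ix_left p i inf)
  rw [dL_inf] at this
  simpa only [dS_inf_right, Frame.r, Frame.l, om_none_right, om_zero_right, add_zero,
      act_plus] using this

theorem IsEvol.dL {R Y : Op K} {k : ℕ} {n : ℕ+} (hF : F.IsPot) (hE : F.IsEvol n (plus R))
    (hY : Op.dt n Y = plus R * Y - Y * plus R) (q : ℕ) (j : Fin m) :
    CKP.dt n (F.dL Y k (ix q j)) = -(adj (F.gen Y k * R - R * F.gen Y k) (F.g q j)
      + adj R (F.dL Y k (ix q j))) := by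
  have := hE.dS (k := k) hF hY (ok_ix_right q j inf)
  rw [dR_inf] at this
  simp only [dS_inf_left, Frame.r, Frame.l, om_none_left, om_zero_left, add_zero, adj_plus,
    dt_neg] at this
  rw [← this, neg_neg]

end Frame

namespace Data

section

variable {P : Data K m} {r : ℕ} (k : ℕ)

theorem Ord.flow (h : P.Ord) : (P.flow r k).Ord := by
  have h0 : ∀ f g : Fn K, f = 0 → g = 0 → Fn.deform f g = 0 := by
    rintro _ _ rfl rfl
    exact Fn.ext_dual (by rw [Fn.fst_deform, map_zero]) (by rw [Fn.eps_deform, Fn.eps_zero])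
  have hA : ((P.frame r).gen (oY h r k) k).Le 0 := (Frame.gen_le _ _).mono (by norm_num)
  constructor
  · refine fun n hn => h0 _ _ (h.W_pos n hn) ?_
    have := hA.mul (show (oW h).Le 0 from h.W_pos) n (by simpa using hn)
    rwa [← val_apply, val_mul, val_gen] at this
  · refine fun n hn => h0 _ _ (h.Winv_pos n hn) ?_
    have := ((show (oV h).Le 0 from h.Winv_pos).mul hA).neg n (by simpa using hn)
    rwa [← val_apply, val_neg, val_mul, val_gen] at this

variable (h : P.Ord)

theorem fst_oW : Op.fst (oW (h.flow (r := r) k)) = oW h := Op.ext fun _ => Fn.fst_deform _ _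
theorem fst_oV : Op.fst (oV (h.flow (r := r) k)) = oV h := Op.ext fun _ => Fn.fst_deform _ _
theorem eps_oW : Op.eps (oW (h.flow (r := r) k)) = (P.frame r).gen (oY h r k) k * oW h :=
  Op.ext fun n => by
    rw [← val_apply (_ * _), val_mul, val_gen]
    exact Fn.eps_deform _ _
theorem eps_oV : Op.eps (oV (h.flow (r := r) k)) = -(oV h * (P.frame r).gen (oY h r k) k) :=
  Op.ext fun n => by
    rw [← val_apply (-_), val_neg, val_mul, val_gen]
    exact Fn.eps_deform _ _

theorem fst_X {K : Type*} [CommRing K] (l : ℕ+) :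
    Fn.fst (MvPowerSeries.X l : Fn (DualNumber K)) = MvPowerSeries.X l :=
  MvPowerSeries.map_X _ l

theorem fst_time (P : Data K m) (r k : ℕ) (l : ℕ+) : Fn.fst ((P.flow r k).time l) = P.time l := by
  rw [time, time, map_add, fst_X]
  congr 1
  exact MvPowerSeries.map_C _ _

theorem eps_time (P : Data K m) (r k : ℕ) (l : ℕ+) : Fn.eps ((P.flow r k).time l) = 0 := by
  classical
  ext d
  rw [Fn.coeff_eps, time, map_add, MvPowerSeries.coeff_X, MvPowerSeries.coeff_C]
  have hb : ((P.flow r k).base l).snd = 0 := TrivSqZeroExt.snd_inl K (P.base l)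
  split_ifs <;> simp [hb]

theorem fst_oM0 (P : Data K m) (r k : ℕ) : Op.fst ((P.flow r k).oM0 r) = P.oM0 r :=
  Op.ext fun n => by
    change Fn.fst (M0 r (P.flow r k) n) = M0 r P n
    rw [M0, M0]
    split_ifs
    · rw [Fn.fst_qsmul]
      exact congrArg _ (fst_time P r k _)
    · exact map_zero _

theorem eps_oM0 (P : Data K m) (r k : ℕ) : Op.eps ((P.flow r k).oM0 r) = 0 :=
  Op.ext fun n => by
    change Fn.eps (M0 r (P.flow r k) n) = 0
    rw [M0]
    split_ifs
    · rw [Fn.eps_qsmul]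
      exact (congrArg _ (eps_time P r k _)).trans (smul_zero _)
    · rfl

theorem fst_conj (W V A : Op (DualNumber K)) :
    Op.fst (conj W V A) = conj (Op.fst W) (Op.fst V) (Op.fst A) := by
  simp only [conj, map_mul]

/-- W and W⁻¹ vary by G W and -W⁻¹ G, so dressing an undeformed bare operator gives variation [G,
·]. This covers D^n and M⁽⁰⁾, since the times are not deformed. -/
theorem eps_conj (A : Op (DualNumber K)) (hA : Op.eps A = 0) :
    Op.eps (conj (oW (h.flow (r := r) k)) (oV (h.flow (r := r) k)) A) =
      (P.frame r).gen (oY h r k) k * conj (oW h) (oV h) (Op.fst A)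
        - conj (oW h) (oV h) (Op.fst A) * (P.frame r).gen (oY h r k) k := by
  simp only [conj, Op.eps_mul, hA, eps_oW k h, eps_oV k h, fst_oW k h, fst_oV k h, map_mul]
  noncomm_ring

theorem fst_oR (n : ℤ) : Op.fst (oR (h.flow (r := r) k) n) = oR h n := by
  rw [oR, fst_conj, fst_oW k h, fst_oV k h, Op.fst_D, oR]

theorem eps_oR (n : ℤ) : Op.eps (oR (h.flow (r := r) k) n) =
    (P.frame r).gen (oY h r k) k * oR h n - oR h n * (P.frame r).gen (oY h r k) k := by
  rw [oR, eps_conj _ _ _ (Op.eps_D n), Op.fst_D, oR]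

theorem fst_oL : Op.fst (oL (h.flow (r := r) k) r) = oL h r := fst_oR k h r
theorem eps_oL : Op.eps (oL (h.flow (r := r) k) r) =
    (P.frame r).gen (oY h r k) k * oL h r - oL h r * (P.frame r).gen (oY h r k) k := eps_oR k h r

theorem eps_pow {A : Op (DualNumber K)} {G : Op K}
    (hA : Op.eps A = G * Op.fst A - Op.fst A * G) (l : ℕ) :
    Op.eps (A ^ l) = G * Op.fst A ^ l - Op.fst A ^ l * G := by
  induction l with
  | zero => rw [pow_zero, pow_zero, Op.eps_one, mul_one, one_mul, sub_self]
  | succ l ih =>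
    rw [pow_succ, Op.eps_mul, ih, hA, pow_succ, map_pow]
    noncomm_ring

theorem fst_oY (l : ℕ) : Op.fst (oY (h.flow (r := r) k) r l) = oY h r l := by
  rw [oY, map_mul, map_pow, fst_oL k h, oM, fst_conj, fst_oW k h, fst_oV k h, fst_oM0]
  rfl

theorem eps_oY (l : ℕ) : Op.eps (oY (h.flow (r := r) k) r l) =
    (P.frame r).gen (oY h r k) k * oY h r l - oY h r l * (P.frame r).gen (oY h r k) k := by
  have h1 := eps_pow ((eps_oL (r := r) k h).trans (by rw [fst_oL k h])) l
  have h2 := eps_conj (r := r) k h _ (eps_oM0 P r k)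
  rw [fst_oM0] at h2
  rw [fst_oL k h] at h1
  generalize (P.frame r).gen (oY h r k) k = G at h1 h2 ⊢
  rw [oY, oM, Op.eps_mul, h1, h2, fst_conj, fst_oW k h, fst_oV k h, fst_oM0, map_pow, fst_oL k h,
    oY, oM]
  generalize conj (oW h) (oV h) (P.oM0 r) = M
  generalize oL h r ^ l = N
  noncomm_ring

theorem fst_Φ (i : Fin m) : Fn.fst ((P.flow r k).Φ i) = P.Φ i := Fn.fst_deform _ _
theorem fst_Ψ (i : Fin m) : Fn.fst ((P.flow r k).Ψ i) = P.Ψ i := Fn.fst_deform _ _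
theorem fst_pot (p q : ℕ) (i j : Fin m) : Fn.fst ((P.flow r k).pot p q i j) = P.pot p q i j :=
  Fn.fst_deform _ _
theorem eps_Φ (i : Fin m) :
    Fn.eps ((P.flow r k).Φ i) = (P.frame r).dR (oY h r k) k (ix 0 i) :=
  (Fn.eps_deform _ _).trans (varΦ_eq h r k i)
theorem eps_Ψ (i : Fin m) :
    Fn.eps ((P.flow r k).Ψ i) = (P.frame r).dL (oY h r k) k (ix 0 i) :=
  (Fn.eps_deform _ _).trans (varΨ_eq h r k i)
theorem eps_pot (p q : ℕ) (i j : Fin m) :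
    Fn.eps ((P.flow r k).pot p q i j) = (P.frame r).dS (oY h r k) k (ix p i) (ix q j) :=
  (Fn.eps_deform _ _).trans (varPot_eq h r k p q i j)

theorem fst_LΦ (h : P.Ord) (p : ℕ) (i : Fin m) :
    Fn.fst ((P.flow r k).LΦ r p i) = P.LΦ r p i := by
  induction p generalizing i with
  | zero => exact fst_Φ k i
  | succ p ih =>
    rw [LΦ_succ (h.flow k), map_add, fst_act, ih, fst_oL k h, LΦ_succ h, map_sum]
    simp only [map_mul, fst_Φ, fst_pot]

theorem fst_LΨ (h : P.Ord) (q : ℕ) (j : Fin m) :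
    Fn.fst ((P.flow r k).LΨ r q j) = P.LΨ r q j := by
  induction q generalizing j with
  | zero => exact fst_Ψ k j
  | succ q ih =>
    rw [LΨ_succ (h.flow k), map_sub, fst_adj, ih, fst_oL k h, LΨ_succ h, map_sum]
    simp only [map_mul, fst_Ψ, fst_pot]

end

namespace IsSolution

variable {P : Data K m} {r : ℕ}

/-- Only Φ, W and S are deformed directly; the variation of L^p(Φ) is a consequence. The recursion
defining L^p(Φ), linearised, is `dR_succ`. -/
theorem eps_LΦ (hr : 1 ≤ r) (hs : P.IsSolution r) (hp : P.IsPotential r) (k p : ℕ) (i : Fin m) :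
    Fn.eps ((P.flow r k).LΦ r p i) = (P.frame r).dR (oY hs.ord r k) k (ix p i) := by
  induction p generalizing i with
  | zero => exact eps_Φ k hs.ord i
  | succ p ih =>
    rw [LΦ_succ (hs.ord.flow k), Fn.eps_add, eps_act, ih, fst_oL k hs.ord, eps_oL k hs.ord,
        fst_LΦ k hs.ord,
      (hs.isLax hp).dR_succ (hs.isPot hp) (hs.L_comm_Y hr k), Fn.eps_sum]
    congr 1
    refine Finset.sum_congr rfl fun x _ => ?_
    rw [Fn.eps_mul, fst_Φ, fst_pot, eps_Φ k hs.ord, eps_pot k hs.ord, mul_comm, add_comm]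
    rfl

theorem eps_LΨ (hr : 1 ≤ r) (hs : P.IsSolution r) (hp : P.IsPotential r) (k q : ℕ) (j : Fin m) :
    Fn.eps ((P.flow r k).LΨ r q j) = (P.frame r).dL (oY hs.ord r k) k (ix q j) := by
  induction q generalizing j with
  | zero => exact eps_Ψ k hs.ord j
  | succ q ih =>
    rw [LΨ_succ (hs.ord.flow k), Fn.eps_sub, eps_adj, ih, fst_oL k hs.ord, eps_oL k hs.ord,
        fst_LΨ k hs.ord,
      (hs.isLax hp).dL_succ (hs.isPot hp) (hs.L_comm_Y hr k), Fn.eps_sum]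
    congr 1
    refine Finset.sum_congr rfl fun x _ => ?_
    rw [Fn.eps_mul, fst_Ψ, fst_pot, eps_Ψ k hs.ord, eps_pot k hs.ord]
    rfl

/-- The flows deform solutions into solutions to first order. -/
theorem flow (hr : 1 ≤ r) (hs : P.IsSolution r) (hp : P.IsPotential r) (k : ℕ) :
    (P.flow r k).IsSolution r where
  W_zero := by
    refine Fn.ext_dual ((Fn.fst_deform _ _).trans (hs.W_zero.trans (map_one _).symm))
      ((Fn.eps_deform _ _).trans (Eq.trans ?_ Fn.eps_one.symm))
    -- G W has order at most -1, so the leading coefficient 1 of W is not deformed.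
    have := ((Frame.gen_le (F := P.frame r) (oY hs.ord r k) k).mul
      (show (oW hs.ord).Le 0 from hs.W_pos)) 0 (by norm_num)
    rwa [← val_apply, val_mul, val_gen] at this
  W_pos := (hs.ord.flow k).W_pos
  Winv_pos := (hs.ord.flow k).Winv_pos
  W_mul_Winv := by
    refine congrArg Subtype.val
      (show oW (hs.ord.flow (r := r) k) * oV (hs.ord.flow k) = 1 from Op.ext_dual ?_ ?_)
    · rw [map_mul, fst_oW k hs.ord, fst_oV k hs.ord, hs.dressing.mul_inv, map_one]
    · rw [Op.eps_mul, fst_oW k hs.ord, fst_oV k hs.ord, eps_oW k hs.ord, eps_oV k hs.ord,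
        Op.eps_one, mul_neg, mul_assoc, ← mul_assoc,
        ← mul_assoc, mul_assoc _ (oW _), hs.dressing.mul_inv, mul_one, one_mul, add_neg_cancel]
  Winv_mul_W := by
    refine congrArg Subtype.val
      (show oV (hs.ord.flow (r := r) k) * oW (hs.ord.flow k) = 1 from Op.ext_dual ?_ ?_)
    · rw [map_mul, fst_oW k hs.ord, fst_oV k hs.ord, hs.dressing.inv_mul, map_one]
    · rw [Op.eps_mul, fst_oW k hs.ord, fst_oV k hs.ord, eps_oW k hs.ord, eps_oV k hs.ord,
        Op.eps_one, neg_mul, mul_assoc,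
        neg_add_cancel]
  sato n := by
    have : Op.dt n (oW (hs.ord.flow (r := r) k)) =
        -(minus (oR (hs.ord.flow (r := r) k) n) * oW (hs.ord.flow (r := r) k)) := by
      refine Op.ext_dual ?_ ?_
      · rw [Op.fst_dt, map_neg, map_mul, fst_oW k hs.ord, fst_minus, fst_oR k hs.ord]
        exact hs.isSato n
      · have h1 : Op.dt n (oW hs.ord) = -(minus (oR hs.ord n) * oW hs.ord) := hs.isSato n
        set G := (P.frame r).gen (oY hs.ord r k) k with hG
        have h2 : Op.dt n G = minus (plus (oR hs.ord n) * G - G * plus (oR hs.ord n)) :=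
          (hs.isEvol hp n).dt_gen (hs.dt_Y n k)
        -- The splitting R = R₊ + R₋ gives [G, R]₋ = -[R₊, G]₋ + [G, R₋], in which the first term is
        -- -∂_n G and the second is already purely negative.
        have h3 : minus (G * oR hs.ord n - oR hs.ord n * G) =
            -Op.dt n G + (G * minus (oR hs.ord n) - minus (oR hs.ord n) * G) := by
          have h4 : minus (G * minus (oR hs.ord n) - minus (oR hs.ord n) * G) =
              G * minus (oR hs.ord n) - minus (oR hs.ord n) * G :=
            minus_of_le ((((Frame.gen_le _ k).mul (le_minus _)).sub
              ((le_minus _).mul (Frame.gen_le _ k))).mono (by norm_num))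
          rw [h2, ← h4, ← map_neg, ← map_add]
          congr 1
          conv_lhs => rw [← plus_add_minus (oR hs.ord n)]
          noncomm_ring
        rw [Op.eps_dt, map_neg, Op.eps_mul, eps_oW k hs.ord, fst_oW k hs.ord, eps_minus,
            fst_minus, fst_oR k hs.ord, eps_oR k hs.ord,
          ← hG, Op.dt_mul, h1, h3]
        noncomm_ring
    exact (congrArg Subtype.val this).trans (by
      rw [Op.val_neg, Op.val_mul, Op.val_minus]
      rfl)
  eigen n i := by
    rw [← val_oR (hs.ord.flow k), act_val]
    refine Fn.ext_dual ?_ ?_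
    · rw [Fn.fst_dt, fst_act, fst_Φ, fst_oR k hs.ord, hs.dt_Φ, act_plus]
    · rw [Fn.eps_dt, eps_act, fst_Φ, fst_oR k hs.ord, eps_Φ k hs.ord, eps_oR k hs.ord]
      exact (hs.isEvol hp n).dR (hs.isPot hp) (hs.dt_Y n k) 0 i
  adjEigen n i := by
    rw [← val_oR (hs.ord.flow k), adj_val]
    refine Fn.ext_dual ?_ ?_
    · rw [Fn.fst_dt, map_neg, fst_adj, fst_Ψ, fst_oR k hs.ord, hs.dt_Ψ, adj_plus]
    · rw [Fn.eps_dt, Fn.eps_neg, eps_adj, fst_Ψ, fst_oR k hs.ord, eps_Ψ k hs.ord, eps_oR k hs.ord]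
      exact (hs.isEvol hp n).dL (hs.isPot hp) (hs.dt_Y n k) 0 i
  constrained := by
    have : minus (oL (hs.ord.flow (r := r) k) r) =
        ∑ i, ghost ((P.flow r k).Φ i) ((P.flow r k).Ψ i) := by
      refine Op.ext_dual ?_ ?_
      · rw [fst_minus, fst_oL k hs.ord, map_sum, hs.minus_L]
        simp only [fst_ghost, fst_Φ, fst_Ψ]
      · rw [eps_minus, eps_oL k hs.ord, map_sum,
          (hs.isLax hp).minus_gen_comm (hs.isPot hp) (hs.L_comm_Y hr k)]
        simp only [eps_ghost, fst_Φ, fst_Ψ, eps_Φ k hs.ord, eps_Ψ k hs.ord]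
        rfl
    have h2 := congrArg Subtype.val this
    rw [Op.val_minus, Op.val_sum] at h2
    exact h2

theorem flow_isPotential (hr : 1 ≤ r) (hs : P.IsSolution r) (hp : P.IsPotential r) (k : ℕ) :
    (P.flow r k).IsPotential r where
  dt_pot n p q i j := by
    rw [← val_oR (hs.ord.flow k), ← om_some]
    refine Fn.ext_dual ?_ ?_
    · rw [Fn.fst_dt, fst_om, fst_pot, fst_oR k hs.ord, fst_LΦ k hs.ord, fst_LΨ k hs.ord,
        hp.dt_pot' hs,
        om_plus _ (Or.inl (by simp))]
    · rw [Fn.eps_dt, eps_om, fst_oR k hs.ord, fst_LΦ k hs.ord, fst_LΨ k hs.ord, eps_oR k hs.ord,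
        eps_pot k hs.ord,
        eps_LΦ hr hs hp, eps_LΨ hr hs hp,
        (hs.isEvol hp n).dS (hs.isPot hp) (hs.dt_Y n k) (ok_ix_left p i (ix q j)),
        om_plus _ (Or.inl (by simp)), om_plus _ (Or.inr (by simp))]
      rfl
  shift p q i j := by
    rw [← val_oL (hs.ord.flow k), ← om_some]
    refine Fn.ext_dual ?_ ?_
    · have := hp.shift p q i j
      rw [← val_oL hs.ord, ← om_some] at this
      rw [map_sub, map_add, map_sum, fst_om, fst_oL k hs.ord, fst_LΦ k hs.ord, fst_LΨ k hs.ord]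
      simp only [map_mul, fst_pot]
      exact this
    · have := (hs.isLax hp).dS_shift (hs.isPot hp) (hs.L_comm_Y hr k) (ok_ix_left p i (ix q j))
      rw [Fn.eps_sub, Fn.eps_add, Fn.eps_sum, eps_om, fst_oL k hs.ord, fst_LΦ k hs.ord,
          fst_LΨ k hs.ord,
        eps_oL k hs.ord, eps_LΦ hr hs hp, eps_LΨ hr hs hp]
      simp only [Fn.eps_mul, fst_pot, eps_pot k hs.ord]
      exact this

end IsSolution

end Data

end CKP

end

/-! ### Variations of L, W and ψ, and the commutators of the flows. -/

noncomputable section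

namespace CKP

variable {K : Type*} [CommRing K] [Algebra ℚ K] {ι κ : Type*} {m : ℕ}

open Ix Op

namespace Data

theorem Ord.L_le {P : Data K m} (h : P.Ord) (r : ℕ) : (oL h r).Le r := by
  have := ((show (oW h).Le 0 from h.W_pos).mul (le_D r)).mul (show (oV h).Le 0 from h.Winv_pos)
  rwa [zero_add, add_zero] at this

theorem varL_eq {P : Data K m} (h : P.Ord) (r k : ℕ) : P.varL r k =
    ((P.frame r).gen (oY h r k) k * oL h r - oL h r * (P.frame r).gen (oY h r k) k).1 := by
  rw [← eps_oL k h]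
  rfl

theorem varW_eq {P : Data K m} (h : P.Ord) (r k : ℕ) :
    P.varW r k = ((P.frame r).gen (oY h r k) k * oW h).1 := by
  rw [← eps_oW k h]
  rfl

theorem lie_val (A B : Op K) : ⁅A.1, B.1⁆ = (A * B - B * A).1 := rfl

/-- The action on `e^ξ` is right multiplication by the unit. -/
theorem ψ_eq {P : Data K m} (h : P.Ord) : P.ψ = P.W :=
  congrArg Subtype.val (mul_one (oW h))

theorem varψ_eq {P : Data K m} (h : P.Ord) (r k : ℕ) :
    P.varψ r k = PDO.applyWave (P.gen r k) P.ψ := by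
  rw [varψ, ψ_eq (h.flow k), ψ_eq h]
  change P.varW r k = P.gen r k * P.W
  rw [varW_eq h, val_mul, val_gen]
  rfl

/-- For k ≤ 1 the correction is an empty sum; for k = 2 its only coefficient is 0. -/
theorem gen_eq_genOS (P : Data K m) (r : ℕ) {k : ℕ} (hk : k ≤ 2) : P.gen r k = P.genOS r k := by
  have : P.X1 r (k - 1) = 0 := by
    interval_cases k
    · simp [X1]
    · simp [X1]
    · simp [X1, wt]
  rw [gen, this, add_zero]

namespace IsSolution

variable {P : Data K m} {r : ℕ}

theorem fst_gen (hs : P.IsSolution r) (k l : ℕ) :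
    Op.fst (((P.flow r l).frame r).gen (oY (hs.ord.flow (r := r) l) r k) k) =
      (P.frame r).gen (oY hs.ord r k) k := by
  rw [Frame.gen, Frame.gen, map_add, map_neg, fst_minus, fst_oY l hs.ord, Frame.gh, Frame.gh,
      map_conv]
  congr 1
  refine conv_congr _ fun a b _ => ?_
  rw [fst_smul, map_sum]
  simp only [fst_ghost, frame, fst_LΦ l hs.ord, fst_LΨ l hs.ord]

theorem eps_gen (hr : 1 ≤ r) (hs : P.IsSolution r) (hp : P.IsPotential r) (k l : ℕ) :
    Op.eps (((P.flow r l).frame r).gen (oY (hs.ord.flow (r := r) l) r k) k) =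
      -minus ((P.frame r).gen (oY hs.ord r l) l * oY hs.ord r k
        - oY hs.ord r k * (P.frame r).gen (oY hs.ord r l) l)
      + (P.frame r).dgh (oY hs.ord r l) l cX (k - 1) := by
  rw [Frame.gen, map_add, map_neg, eps_minus, eps_oY l hs.ord, Frame.gh, map_conv, Frame.dgh]
  congr 1
  refine conv_congr _ fun a b _ => ?_
  rw [map_smul, map_sum]
  simp only [eps_ghost, frame, fst_LΦ l hs.ord, fst_LΨ l hs.ord, eps_LΦ hr hs hp, eps_LΨ hr hs hp]

theorem virasoro_gen (hr : 1 ≤ r) (hs : P.IsSolution r) (hp : P.IsPotential r) (k l : ℕ) :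
    Op.eps (((P.flow r l).frame r).gen (oY (hs.ord.flow (r := r) l) r k) k)
      - Op.eps (((P.flow r k).frame r).gen (oY (hs.ord.flow (r := r) k) r l) l)
      + ((P.frame r).gen (oY hs.ord r k) k * (P.frame r).gen (oY hs.ord r l) l
        - (P.frame r).gen (oY hs.ord r l) l * (P.frame r).gen (oY hs.ord r k) k) =
      ((k : ℚ) - l) • (P.frame r).gen (oY hs.ord r (k + l - 1)) (k + l - 1) := by
  rw [eps_gen hr hs hp, eps_gen hr hs hp]
  exact Frame.gen_virasoro (Y := fun k => oY hs.ord r k) (hs.isPot hp) (hs.Y_comm hr k l)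

/-- Since ∂*_k W = G_k W, the second variation is (∂*_l G_k) W + G_k G_l W, and the antisymmetrised
coefficient of W is computed in `virasoro_gen`. The formula for `varW` is applied over K[ε], where
the deformed data live. -/
theorem virasoro_W (hr : 1 ≤ r) (hs : P.IsSolution r) (hp : P.IsPotential r) (k l : ℕ) :
    PDO.eps ((P.flow r l).varW r k) - PDO.eps ((P.flow r k).varW r l) =
      ((k : ℚ) - l) • P.varW r (k + l - 1) := by
  rw [varW_eq (hs.ord.flow l), varW_eq (hs.ord.flow k), varW_eq hs.ord, ← val_eps, ← val_eps,
    ← val_sub, ← val_smul, ← smul_mul_assoc, ← virasoro_gen hr hs hp k l, Op.eps_mul, Op.eps_mul,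
    eps_oW l hs.ord, eps_oW k hs.ord, fst_oW l hs.ord, fst_oW k hs.ord, fst_gen hs, fst_gen hs]
  congr 1
  generalize (P.frame r).gen (oY hs.ord r k) k = A
  generalize (P.frame r).gen (oY hs.ord r l) l = B
  generalize Op.eps (((P.flow r l).frame r).gen _ k) = A'
  generalize Op.eps (((P.flow r k).frame r).gen _ l) = B'
  noncomm_ring

theorem virasoro_L (hr : 1 ≤ r) (hs : P.IsSolution r) (hp : P.IsPotential r) (k l : ℕ) :
    PDO.eps ((P.flow r l).varL r k) - PDO.eps ((P.flow r k).varL r l) =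
      ((k : ℚ) - l) • P.varL r (k + l - 1) := by
  rw [varL_eq (hs.ord.flow l), varL_eq (hs.ord.flow k), varL_eq hs.ord, ← val_eps, ← val_eps,
    ← val_sub, ← val_smul, smul_sub, ← smul_mul_assoc, ← mul_smul_comm,
    ← virasoro_gen hr hs hp k l, map_sub, map_sub]
  simp only [Op.eps_mul, eps_oL l hs.ord, eps_oL k hs.ord, fst_oL l hs.ord, fst_oL k hs.ord,
    fst_gen hs]
  congr 1
  generalize (P.frame r).gen (oY hs.ord r k) k = A
  generalize (P.frame r).gen (oY hs.ord r l) l = B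
  generalize Op.eps (((P.flow r l).frame r).gen _ k) = A'
  generalize Op.eps (((P.flow r k).frame r).gen _ l) = B'
  noncomm_ring

theorem minus_varL (hr : 1 ≤ r) (hs : P.IsSolution r) (hp : P.IsPotential r) (k : ℕ) :
    (P.varL r k).minus =
      ∑ i, (PDO.ghost (P.varΦ r k i) (P.Ψ i) + PDO.ghost (P.Φ i) (P.varΨ r k i)) := by
  rw [varL_eq hs.ord, ← val_minus, (hs.isLax hp).minus_gen_comm (hs.isPot hp) (hs.L_comm_Y hr k),
    val_sum]
  simp only [varΦ_eq hs.ord, varΨ_eq hs.ord]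
  rfl

/-- The ε-part of the Lax equation satisfied by the deformed solution. -/
theorem dt_varL (hr : 1 ≤ r) (hs : P.IsSolution r) (hp : P.IsPotential r) (k : ℕ) (n : ℕ+) :
    (P.varL r k).dt n = PDO.eps ((P.flow r k).laxRHS r n) := by
  have h := congrArg Op.eps ((hs.flow hr hp k).dt_L n)
  rw [Op.eps_dt, eps_oL k hs.ord] at h
  rw [varL_eq hs.ord]
  exact congrArg Subtype.val h

end IsSolution

end Data

end CKP

end

theorem proposition4p1 {K : Type*} [CommRing K] [Algebra ℚ K] (r m : ℕ) (hr : 1 ≤ r) :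
    -- the nonlocal functions `L^p(Φ_i)`, `(L^*)^q(Ψ_i)` exist for every solution
    (∀ P : CKP.Data K m, P.IsSolution r →
      ∃ S : ℕ → ℕ → Fin m → Fin m → CKP.Fn K,
        CKP.Data.IsPotential r { P with pot := S }) ∧
    ∀ P : CKP.Data K m, P.IsSolution r → P.IsPotential r →
      (∀ k : ℕ,
        -- the flow on the Lax operator, the dressing operator and the Baker–Akhiezer function
        P.varL r k = ⁅-(P.M r * P.L r ^ k).minus + P.X1 r (k - 1), P.L r⁆ ∧
        P.varW r k = (-(P.M r * P.L r ^ k).minus + P.X1 r (k - 1)) * P.W ∧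
        P.varψ r k = (-(P.M r * P.L r ^ k).minus + P.X1 r (k - 1)).applyWave P.ψ ∧
        -- the constrained form is preserved
        (∀ n : ℤ, (r : ℤ) - 1 ≤ n → P.varL r k n = 0) ∧
        (P.varL r k).minus =
          ∑ i, (CKP.PDO.ghost (P.varΦ r k i) (P.Ψ i) + CKP.PDO.ghost (P.Φ i) (P.varΨ r k i)) ∧
        -- the flow commutes with the isospectral flows and, more precisely, deforms solutions of
        -- the hierarchy into solutions to first order
        (∀ n : ℕ+, (P.varL r k).dt n = CKP.PDO.eps ((P.flow r k).laxRHS r n)) ∧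
        (P.flow r k).IsSolution r ∧ (P.flow r k).IsPotential r ∧
        -- for `k = 0, 1, 2` the flow is the Orlov–Schulman flow
        (k ≤ 2 → P.varL r k = ⁅-(P.M r * P.L r ^ k).minus, P.L r⁆ ∧
          P.varW r k = -(P.M r * P.L r ^ k).minus * P.W)) ∧
      -- the Virasoro relations `[∂*_l, ∂*_k] = (k - l) ∂*_{k+l-1}`
      (∀ k l : ℕ,
        CKP.PDO.eps ((P.flow r l).varL r k) - CKP.PDO.eps ((P.flow r k).varL r l) =
          ((k : ℚ) - l) • P.varL r (k + l - 1) ∧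
        CKP.PDO.eps ((P.flow r l).varW r k) - CKP.PDO.eps ((P.flow r k).varW r l) =
          ((k : ℚ) - l) • P.varW r (k + l - 1)) := by
  refine ⟨fun P hs => hs.exists_isPotential, fun P hs hp => ⟨fun k => ?_, fun k l =>
    ⟨hs.virasoro_L hr hp k l, hs.virasoro_W hr hp k l⟩⟩⟩
  have hL : P.varL r k = ⁅P.gen r k, P.L r⁆ := by
    rw [CKP.Data.varL_eq hs.ord, ← CKP.Data.lie_val, CKP.Data.val_gen]
    rfl
  have hW : P.varW r k = P.gen r k * P.W := by
    rw [CKP.Data.varW_eq hs.ord, CKP.Op.val_mul, CKP.Data.val_gen]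
    rfl
  refine ⟨hL, hW, CKP.Data.varψ_eq hs.ord r k, fun n hn => ?_, hs.minus_varL hr hp k,
    hs.dt_varL hr hp k, hs.flow hr hp k, hs.flow_isPotential hr hp k, fun hk => ?_⟩
  · rw [CKP.Data.varL_eq hs.ord]
    exact CKP.comm_le (CKP.Frame.gen_le _ k) (hs.ord.L_le r) n (by omega)
  · rw [hL, hW, P.gen_eq_genOS r hk]
    exact ⟨rfl, rfl⟩
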